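/- \textbf{Lemma (FVM Galerkin defect by oscillations).} Let $d\in\{2,3\}$ and let $\Omega\subset\mathbb R^d$ be a bounded Lipschitz domain with polygonal boundary $\Gamma=\partial\Omega$. Let $\mathcal T_\times$ be a regular (conforming) triangulation of $\Omega$ into non-degenerate closed simplices, write $h_T:=|T|^{1/d}$, and suppose that $\mathcal T_\times$ is $\sigma$-shape regular, i.e. $\operatorname{diam}(T)\le\sigma h_T$ for all $T\in\mathcal T_\times$. Let $f\in L^2(\Omega)$; let $\mathbf A$ be a symmetric matrix function with $\lambda_{\min}|\mathbf v|^2\le \mathbf v^T\mathbf A(x)\mathbf v\le\lambda_{\max}|\mathbf v|^2$ for all $\mathbf v\in\mathbb R^d$ and a.e. $x\in\Omega$, with constants $\lambda_{\min},\lambda_{\max}>0$, and $\mathbf A\in W^{1,\infty}(T)^{d\times d}$ for all $T\in\mathcal T_\times$; let $\mathbf b\in W^{1,\infty}(\Omega)^d$ and $c\in L^\infty(\Omega)$ with $\frac12\operatorname{div}\mathbf b+c\ge0$ a.e. in $\Omega$. Put $$\mathcal A(v,w):=\int_\Omega(\mathbf A\nabla v-\mathbf b v)\cdot\nabla w\,dx+\int_\Omega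 c\,v\,w\,dx ,$$ and let $u\in H^1_0(\Omega)$ be the solution of $\mathcal A(u,w)=\int_\Omega f w\,dx$ for all $w\in H^1_0(\Omega)$. Let $\mathcal S^1_0(\mathcal T_\times)$ be the space of continuous, $\mathcal T_\times$-piecewise affine functions on $\overline\Omega$ that vanish on $\Gamma$. Let $\mathcal T^*_\times=\{V_i\}$ be the barycentric dual mesh: $V_i$ belongs to the node $a_i$, and $V_i\cap T$, for an element $T$ with vertex $a_i$, is the polytope spanned by the centers of gravity of all faces of $T$ (including $a_i$, edges and $T$ itself) that contain $a_i$. Let $\mathcal P^0_0(\mathcal T^*_\times)$ be the space of $\mathcal T^*_\times$-piecewise constant functions that vanish on all $V_i$ with $\partial V_i\cap\Gamma\ne\emptyset$. Let $u_\times\in\mathcal S^1_0(\mathcal T_\times)$ be a solution of the finite volume scheme $$\sum_{a_i\in\Omega}w^*|_{V_i}\Big(\int_{\partial V_i}(-\mathbf A\nabla u_\times+\mathbf b u_\times)\cdot\mathbf n\,ds+\int_{V_i}c\,u_\times\,dx\Big)=\int_\Omega f\,w^*\,dx\quad\text{for all }w^*\in\mathcal P^0_0(\mathcal T^*_\times),$$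 where the sum runs over the interior nodes and $\mathbf n$ is the outer unit normal of $V_i$. With the residual $R|_T:=f-\operatorname{div}(-\mathbf A\nabla u_\times+\mathbf b u_\times)-c\,u_\times$ on $T\in\mathcal T_\times$, the normal jump $J|_F:=(\mathbf A\nabla u_\times|_T-\mathbf A\nabla u_\times|_{T'})\cdot\mathbf n$ on interior facets $F=T\cap T'$ (with $\mathbf n$ pointing from $T$ to $T'$), and the elementwise resp. facetwise integral mean operator $\Pi$, define the oscillations $$\mathrm{osc}_\times^2:=\sum_{T\in\mathcal T_\times}\Big(h_T^2\,\|(1-\Pi)R\|_{L^2(T)}^2+h_T\,\|(1-\Pi)J\|_{L^2(\partial T\setminus\Gamma)}^2\Big).$$ Then $$|\mathcal A(u-u_\times,v_\times)|\le C_{\rm osc}\,\|v_\times\|_{H^1(\Omega)}\,\mathrm{osc}_\times\qquad\text{for all }v_\times\in\mathcal S^1_0(\mathcal T_\times),$$ where the constant $C_{\rm osc}>0$ depends only on $\sigma$. -/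

import Mathlib

open MeasureTheory Set
open scoped ContDiff Matrix

noncomputable section

namespace FVM

/-- Euclidean space `ℝᵈ` with the Euclidean norm. -/
abbrev E (d : ℕ) : Type := EuclideanSpace ℝ (Fin d)

section Domains

variable {d : ℕ}

/-- `Ω` has a Lipschitz boundary: near every boundary point, in suitable orthonormal coordinates
with vertical direction `ν`, the set `Ω` is the region strictly above the graph of a Lipschitz
function of the horizontal component `y - ⟪ν, y⟫ ν`. -/
def HasLipschitzBoundary (Ω : Set (E d)) : Prop :=
  ∀ x ∈ frontier Ω, ∃ ν : E d, ‖ν‖ = 1 ∧ ∃ (ψ : E d → ℝ) (K : NNReal) (r : ℝ),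
    LipschitzWith K ψ ∧ 0 < r ∧
      ∀ y ∈ Metric.ball x r, (y ∈ Ω ↔ ψ (y - inner ℝ ν y • ν) < inner ℝ ν y)

/-- A bounded Lipschitz domain. (That its boundary is polygonal is a consequence of the existence
of a triangulation, see `Triangulation`.) -/
structure IsBoundedLipschitzDomain (Ω : Set (E d)) : Prop where
  isOpen : IsOpen Ω
  isConnected : IsConnected Ω
  isBounded : Bornology.IsBounded Ω
  lipschitz : HasLipschitzBoundary Ω

end Domains

section Sobolev

variable {d : ℕ}

/-- `φ ∈ C_c^∞(U)`. -/
def IsTestFun (U : Set (E d)) (φ : E d → ℝ) : Prop :=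
  ContDiff ℝ ∞ φ ∧ HasCompactSupport φ ∧ tsupport φ ⊆ U

/-- `G` is the weak gradient of `u` on the open set `U`. -/
def HasWeakGrad (U : Set (E d)) (u : E d → ℝ) (G : E d → E d) : Prop :=
  LocallyIntegrableOn u U ∧ LocallyIntegrableOn G U ∧
    ∀ φ, IsTestFun U φ → ∫ x in U, u x • gradient φ x = -∫ x in U, φ x • G x

/-- `D` is the weak divergence of the vector field `g` on the open set `U`. -/
def HasWeakDiv (U : Set (E d)) (g : E d → E d) (D : E d → ℝ) : Prop :=
  LocallyIntegrableOn g U ∧ LocallyIntegrableOn D U ∧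
    ∀ φ, IsTestFun U φ → ∫ x in U, inner ℝ (g x) (gradient φ x) = -∫ x in U, φ x * D x

open Classical in
/-- The weak gradient (unique up to null sets if it exists, else `0`). -/
def weakGrad (U : Set (E d)) (u : E d → ℝ) : E d → E d :=
  if h : ∃ G, HasWeakGrad U u G then h.choose else 0

open Classical in
/-- The weak divergence (unique up to null sets if it exists, else `0`). -/
def weakDiv (U : Set (E d)) (g : E d → E d) : E d → ℝ :=
  if h : ∃ D, HasWeakDiv U g D then h.choose else 0

/-- `u ∈ H¹(U)`. -/
def MemH1 (U : Set (E d)) (u : E d → ℝ) : Prop :=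
  MemLp u 2 (volume.restrict U) ∧
    ∃ G, HasWeakGrad U u G ∧ MemLp G 2 (volume.restrict U)

/-- `‖u‖_{H¹(U)}`. -/
def H1norm (U : Set (E d)) (u : E d → ℝ) : ℝ :=
  Real.sqrt ((∫ x in U, u x ^ 2) + ∫ x in U, ‖weakGrad U u x‖ ^ 2)

/-- `u ∈ H¹₀(U)`, the closure of `C_c^∞(U)` in `H¹(U)`. -/
def MemH10 (U : Set (E d)) (u : E d → ℝ) : Prop :=
  MemH1 U u ∧ ∀ ε : ℝ, 0 < ε → ∃ φ, IsTestFun U φ ∧ H1norm U (u - φ) < ε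

/-- `g ∈ W^{1,∞}(U)`. -/
def MemW1inf (U : Set (E d)) (g : E d → ℝ) : Prop :=
  MemLp g ⊤ (volume.restrict U) ∧
    ∃ G, HasWeakGrad U g G ∧ MemLp G ⊤ (volume.restrict U)

end Sobolev

section Traces

variable {d : ℕ}

open Classical in
/-- The trace on the closed set `K` of a vector field that is defined almost everywhere on `K`: its
representative that is continuous on `K`. For a simplex `K` it is unique on `K`; fields of class
`W^{1,∞}` on the interior of `K` have one. -/
def trace (K : Set (E d)) (g : E d → E d) : E d → E d :=
  if h : ∃ g' : E d → E d, ContinuousOn g' K ∧ g' =ᵐ[volume.restrict K] g then h.choose else g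

/-- `n` is the outer unit normal of `V` at `x`: near `x`, the set `V` is, up to points of the
hyperplane through `x` orthogonal to `n`, the half-space opposite to `n`. -/
def IsOuterNormal (V : Set (E d)) (x n : E d) : Prop :=
  ‖n‖ = 1 ∧ ∃ r : ℝ, 0 < r ∧ ∀ y ∈ Metric.ball x r,
    (inner ℝ (y - x) n < 0 → y ∈ V) ∧ (0 < inner ℝ (y - x) n → y ∉ V)

open Classical in
/-- The outer unit normal of a polytope (or polygonal set) `V`; it exists and is unique at almost
every boundary point with respect to surface measure. -/
def outerNormal (V : Set (E d)) (x : E d) : E d :=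
  if h : ∃ n, IsOuterNormal V x n then h.choose else 0

end Traces

/-- A regular (conforming) triangulation of `Ω ⊆ ℝᵈ` into non-degenerate closed simplices. An
element is given by the finite set `T` of its `d + 1` vertices; as a point set it is the convex
hull of `T`. Two elements meet exactly in the convex hull of their common vertices. -/
structure Triangulation {d : ℕ} (Ω : Set (E d)) where
  elems : Finset (Finset (E d))
  card_eq : ∀ T ∈ elems, T.card = d + 1
  indep : ∀ T ∈ elems, AffineIndependent ℝ ((↑) : T → E d)
  regular : ∀ S ∈ elems, ∀ T ∈ elems,
    convexHull ℝ (S : Set (E d)) ∩ convexHull ℝ (T : Set (E d))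
      = convexHull ℝ ((S : Set (E d)) ∩ (T : Set (E d)))
  cover : ⋃ T ∈ elems, convexHull ℝ (T : Set (E d)) = closure Ω

/-- The closed simplex with vertex set `T` (also used for facets). -/
def hull {d : ℕ} (T : Finset (E d)) : Set (E d) := convexHull ℝ (T : Set (E d))

/-- Local mesh-size `h_T = |T|^{1/d}`. -/
def meshSize {d : ℕ} (T : Finset (E d)) : ℝ := volume.real (hull T) ^ (1 / (d : ℝ))

namespace Triangulation

variable {d : ℕ} {Ω : Set (E d)} (M : Triangulation Ω)

open Classical in
/-- All nodes. -/
def nodes : Finset (E d) := M.elems.biUnion id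

open Classical in
/-- All interior nodes. -/
def intNodes : Finset (E d) := M.nodes.filter fun a => a ∉ frontier Ω

open Classical in
/-- The facets of the element `T` that do not lie on `Γ = ∂Ω`; up to a null set, their union is
`∂T \ Γ`. -/
def intFacets (_M : Triangulation Ω) (T : Finset (E d)) : Finset (Finset (E d)) :=
  (T.powersetCard d).filter fun F => ¬ hull F ⊆ frontier Ω

/-- `σ`-shape regularity. -/
def ShapeRegular (σ : ℝ) : Prop :=
  ∀ T ∈ M.elems, Metric.diam (hull T) / meshSize T ≤ σ

/-- The part in the element `T` of the dual volume of the vertex `a` of `T`: the polygon or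
polyhedron spanned by the centers of gravity of all faces of `T` that contain `a` (the node `a`,
the midpoints of the edges, the centers of the two-dimensional faces, and that of `T` itself). -/
def dualPart (T : Finset (E d)) (a : E d) : Set (E d) :=
  convexHull ℝ {x | ∃ S : Finset (E d), S ⊆ T ∧ a ∈ S ∧ x = S.centroid ℝ id}

/-- The volume `V_a` of the dual mesh that is associated with the node `a`. -/
def dualVol (a : E d) : Set (E d) := ⋃ T ∈ M.elems, ⋃ _ : a ∈ T, dualPart T a

/-- `v ∈ S¹(𝒯)`: `v` is continuous on `closure Ω` and affine on each element. -/
def MemS1 (v : E d → ℝ) : Prop :=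
  ContinuousOn v (closure Ω) ∧ ∀ T ∈ M.elems, ∃ l : E d →ᵃ[ℝ] ℝ, EqOn v l (hull T)

/-- `v ∈ S¹₀(𝒯)`. -/
def MemS10 (v : E d → ℝ) : Prop := M.MemS1 v ∧ ∀ x ∈ frontier Ω, v x = 0

/-- The dual-mesh piecewise constant function with the value `α a` on the dual volume `V_a`
(dual volumes of different nodes overlap in null sets only). -/
def dualFun (α : E d → ℝ) (x : E d) : ℝ := ∑ a ∈ M.nodes, (M.dualVol a).indicator (fun _ => α a) x

/-- The function `dualFun α` belongs to `P⁰₀(𝒯*)`: its value is zero on all dual volumes whose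
boundary meets `Γ`. -/
def MemP00 (α : E d → ℝ) : Prop :=
  ∀ a ∈ M.nodes, (frontier (M.dualVol a) ∩ frontier Ω).Nonempty → α a = 0

end Triangulation

/-- Coefficients and right-hand side of `div(-A ∇u + b u) + c u = f`. -/
structure ModelData (d : ℕ) where
  A : E d → Matrix (Fin d) (Fin d) ℝ
  b : E d → E d
  c : E d → ℝ
  f : E d → ℝ

namespace ModelData

variable {d : ℕ} (D : ModelData d)

/-- The standing assumptions on the data: `f ∈ L²(Ω)`; `A` is symmetric, bounded and uniformly
positive definite, and of class `W^{1,∞}` on each element of the triangulation;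
`b ∈ W^{1,∞}(Ω)^d`, `c ∈ L^∞(Ω)` and `½ div b + c ≥ 0`. -/
structure Admissible (Ω : Set (E d)) (M : Triangulation Ω) : Prop where
  f_mem : MemLp D.f 2 (volume.restrict Ω)
  A_symm : ∀ᵐ x ∂(volume.restrict Ω), (D.A x).IsSymm
  A_bounds : ∃ lmin lmax : ℝ, 0 < lmin ∧ 0 < lmax ∧ ∀ᵐ x ∂(volume.restrict Ω), ∀ v : E d,
    lmin * ‖v‖ ^ 2 ≤ inner ℝ v (Matrix.toEuclideanCLM (𝕜 := ℝ) (D.A x) v) ∧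
      inner ℝ v (Matrix.toEuclideanCLM (𝕜 := ℝ) (D.A x) v) ≤ lmax * ‖v‖ ^ 2
  A_lip : ∀ T ∈ M.elems, ∀ i j, MemW1inf (interior (hull T)) fun x => D.A x i j
  b_lip : ∀ i, MemW1inf Ω fun x => D.b x i
  c_mem : MemLp D.c ⊤ (volume.restrict Ω)
  div_b_c : ∀ᵐ x ∂(volume.restrict Ω), 0 ≤ 1 / 2 * weakDiv Ω D.b x + D.c x

/-- The bilinear form `𝒜(v, w) = (A ∇v - b v, ∇w)_Ω + (c v, w)_Ω` on `H¹(Ω)`. -/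
def bilin (Ω : Set (E d)) (v w : E d → ℝ) : ℝ :=
  (∫ x in Ω, inner ℝ
      (Matrix.toEuclideanCLM (𝕜 := ℝ) (D.A x) (weakGrad Ω v x) - v x • D.b x) (weakGrad Ω w x))
    + ∫ x in Ω, D.c x * v x * w x

/-- `u ∈ H¹₀(Ω)` is the weak solution of the model problem. -/
def IsWeakSolution (Ω : Set (E d)) (u : E d → ℝ) : Prop :=
  MemH10 Ω u ∧ ∀ w, MemH10 Ω w → D.bilin Ω u w = ∫ x in Ω, D.f x * w x

/-- The field `A ∇v` for a piecewise affine `v`, with the classical gradient (which exists in the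
interior of each element, hence almost everywhere). -/
def diffFlux (v : E d → ℝ) (x : E d) : E d :=
  Matrix.toEuclideanCLM (𝕜 := ℝ) (D.A x) (gradient v x)

/-- The field `-A ∇v + b v` for a piecewise affine `v`. -/
def flux (v : E d → ℝ) (x : E d) : E d := -D.diffFlux v x + v x • D.b x

variable {Ω : Set (E d)} (M : Triangulation Ω)

/-- `∫_{∂V_a} (-A ∇v + b v) · n ds` for an interior node `a`, where `n` is the outer unit normal
of the dual volume `V_a`. On the part of `∂V_a` in an element `T` the integrand is the trace
from `T`; `∂V_a` meets the boundaries of the elements only in a null set of surface measure. -/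
def boundaryFlux (v : E d → ℝ) (a : E d) : ℝ :=
  ∑ T ∈ M.elems, ∫ x in frontier (M.dualVol a) ∩ hull T,
    inner ℝ (trace (hull T) (D.flux v) x) (outerNormal (M.dualVol a) x)
      ∂(Measure.euclideanHausdorffMeasure (d - 1))

/-- The finite volume bilinear form `𝒜_×(v, v*)` with `v*` equal to `α a` on `V_a`. -/
def fvmForm (v α : E d → ℝ) : ℝ :=
  ∑ a ∈ M.intNodes, α a * (D.boundaryFlux M v a + ∫ x in M.dualVol a, D.c x * v x)

/-- `v ∈ S¹₀(𝒯)` solves the finite volume system. -/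
def IsFVMSolution (v : E d → ℝ) : Prop :=
  M.MemS10 v ∧ ∀ α, M.MemP00 α → D.fvmForm M v α = ∫ x in Ω, D.f x * M.dualFun α x

/-- The volume residual on the element `T`: `f - div(-A ∇v + b v) - c v`. -/
def residual (v : E d → ℝ) (T : Finset (E d)) (x : E d) : ℝ :=
  D.f x - weakDiv (interior (hull T)) (D.flux v) x - D.c x * v x

/-- The normal jump `(g|_T - g|_{T'}) · n` of `g = A ∇v` across the interior facet `F = T ∩ T'`,
with `n` pointing from `T` to `T'`. As `-n` is the outer normal of `T'`, it is the sum over the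
(two) elements with facet `F` of the normal component of the trace in outer direction. -/
def jump (v : E d → ℝ) (F : Finset (E d)) (x : E d) : ℝ :=
  ∑ T ∈ M.elems with F ⊆ T,
    inner ℝ (trace (hull T) (D.diffFlux v) x) (outerNormal (hull T) x)

/-- The squared local oscillations
`h_T² ‖(1 - Π) R‖²_{L²(T)} + h_T ‖(1 - Π) J‖²_{L²(∂T \ Γ)}`, with `Π` the integral mean over the
element and over each facet, respectively. -/
def oscLocalSq (v : E d → ℝ) (T : Finset (E d)) : ℝ :=
  meshSize T ^ 2 *
      (∫ x in hull T, (D.residual v T x - ⨍ y in hull T, D.residual v T y) ^ 2)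
    + meshSize T * ∑ F ∈ M.intFacets T,
      ∫ x in hull F, (D.jump M v F x
          - ⨍ y in hull F, D.jump M v F y ∂(Measure.euclideanHausdorffMeasure (d - 1))) ^ 2
        ∂(Measure.euclideanHausdorffMeasure (d - 1))

/-- The oscillations `osc_×(v)`. -/
def osc (v : E d → ℝ) : ℝ := Real.sqrt (∑ T ∈ M.elems, D.oscLocalSq M v T)

end ModelData

end FVM

end

/-!
The error identity. Let `w = v - v*`, where `v*` is the dual-mesh piecewise constant function with
the nodal values of `v`, and let `g = -A ∇uₕ + b uₕ`. As `v` belongs to `H¹₀(Ω)`, elementwise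
integration by parts turns the defect `𝒜(u - uₕ, v)` into the sum over the elements `T` of
`∫_T R v + ∫_∂T v g·n`. The finite volume scheme, tested with `v*`, states that the same sum with
`v*` in place of `v` vanishes, by the divergence theorem on the polytopes `V_a ∩ T`
(`Triangulation.sum_boundaryFlux`). Hence the defect is the sum of `∫_T R w + ∫_∂T w g·n`
(`ModelData.Admissible.bilin_error_eq`). Over an interior facet, the contributions of the two
elements add up to minus the normal jump of `A ∇uₕ`, since `b uₕ` has no jump; over a boundary
facet, `w` vanishes (`ModelData.Admissible.sum_facets_eq_jump`).

The estimate. On each element and on each facet `w` has mean zero, because an affine map which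
exchanges two vertices preserves the measure and exchanges the corresponding dual volumes
(`integral_bary_eq`); so means can be subtracted from the residual and from the jumps. Moreover
`|w| ≤ |∇v| diam T`. The Cauchy-Schwarz inequality, shape regularity and the bound
`|F| ≤ C (diam T) ^ (d - 1)` for a facet `F` of `T` conclude the proof.

Analytic ingredients. The divergence theorem on a polytope for a continuous field with weak
divergence (`divergence_polytope`) follows by testing with products of smooth cutoffs of the affine
functions that define the polytope, where each layer near a facet converges to the surface integral
over the facet by Fubini's theorem. A function in `W^{1,∞}` of a convex set has a Lipschitz
representative (`MemW1inf.exists_lipschitz`, by mollification), which makes the traces continuous.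
Functions in `S¹₀(𝒯)` are limits in `H¹` of mollified truncations, so that they belong to `H¹₀(Ω)`
(`Triangulation.MemS10.memH10`).

All statements about the mesh are expressed in barycentric coordinates: the part of the dual volume
of `a` in an element consists of the points at which the coordinate of `a` is maximal
(`mem_dualPart_iff`), and the coordinates of a point do not depend on the element
(`Triangulation.bary_eq_bary`). That an interior facet belongs to two elements with opposite
normals is `Triangulation.sum_facetN_eq_zero`.
-/

noncomputable section

namespace FVM

/-! ### Affine functions and their gradients -/

section Affine

variable {d : ℕ}

/-- The gradient of an affine function on `ℝᵈ`. -/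
def affGrad (l : E d →ᵃ[ℝ] ℝ) : E d :=
  (InnerProductSpace.toDual ℝ (E d)).symm (LinearMap.toContinuousLinearMap l.linear)

lemma inner_affGrad (l : E d →ᵃ[ℝ] ℝ) (x : E d) : inner ℝ (affGrad l) x = l.linear x := by
  simp [affGrad]

lemma affine_sub_eq (l : E d →ᵃ[ℝ] ℝ) (x y : E d) : l x - l y = inner ℝ (affGrad l) (x - y) := by
  rw [inner_affGrad, ← vsub_eq_sub x y, AffineMap.linearMap_vsub, vsub_eq_sub]

lemma affine_add_apply (l : E d →ᵃ[ℝ] ℝ) (x y : E d) :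
    l (x + y) = l x + inner ℝ (affGrad l) y := by
  have := affine_sub_eq l (x + y) x
  rw [add_sub_cancel_left] at this
  linarith

lemma affine_apply (l : E d →ᵃ[ℝ] ℝ) (x : E d) : l x = l.linear x + l 0 := by
  rw [AffineMap.decomp' l]; simp

lemma affGrad_sub (l m : E d →ᵃ[ℝ] ℝ) : affGrad (l - m) = affGrad l - affGrad m := by
  refine ext_inner_right ℝ fun y => ?_
  simp [inner_sub_left, inner_affGrad]

lemma affGrad_smul (c : ℝ) (l : E d →ᵃ[ℝ] ℝ) : affGrad (c • l) = c • affGrad l := by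
  refine ext_inner_right ℝ fun y => ?_
  simp [inner_smul_left, inner_affGrad]

lemma affGrad_ne_zero {l : E d →ᵃ[ℝ] ℝ} {x y : E d} (h : l x ≠ l y) : affGrad l ≠ 0 := by
  intro h0
  have := affine_sub_eq l x y
  rw [h0, inner_zero_left] at this
  exact h (by linarith)

lemma continuous_affine (l : E d →ᵃ[ℝ] ℝ) : Continuous l := l.continuous_of_finiteDimensional

lemma contDiff_affine (l : E d →ᵃ[ℝ] ℝ) {n : WithTop ℕ∞} : ContDiff ℝ n l := by
  have : (l : E d → ℝ) = fun x => inner ℝ (affGrad l) x + l 0 := by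
    funext x
    have := affine_add_apply l 0 x
    rw [zero_add] at this
    rw [this]; ring
  rw [this]
  exact (contDiff_const.inner ℝ contDiff_id).add contDiff_const

lemma hasGradientAt_affine (l : E d →ᵃ[ℝ] ℝ) (x : E d) : HasGradientAt l (affGrad l) x := by
  have : (l : E d → ℝ) = fun x => inner ℝ (affGrad l) x + l 0 := by
    funext x
    have := affine_add_apply l 0 x
    rw [zero_add] at this
    rw [this]; ring
  rw [this, hasGradientAt_iff_hasFDerivAt]
  exact ((InnerProductSpace.toDual ℝ (E d) (affGrad l)).hasFDerivAt).add_const _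

end Affine

/-! ### Barycentric coordinates -/

section Bary

variable {d : ℕ}

/-- `T` is the vertex set of a non-degenerate simplex of full dimension. -/
structure IsSimplex (T : Finset (E d)) : Prop where
  card_eq : T.card = d + 1
  indep : AffineIndependent ℝ ((↑) : T → E d)

/-- The vertices of a simplex as an affine basis. -/
def IsSimplex.basis {T : Finset (E d)} (h : IsSimplex T) : AffineBasis T ℝ (E d) where
  toFun := (↑)
  ind' := h.indep
  tot' := by
    rw [h.indep.affineSpan_eq_top_iff_card_eq_finrank_add_one]
    simp [h.card_eq]

open Classical in
/-- The barycentric coordinate of the vertex `a` of the simplex `T`. It is set to `0` if `T` is not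
a simplex or if `a` is not a vertex. -/
def bary (T : Finset (E d)) (a : E d) : E d →ᵃ[ℝ] ℝ :=
  if h : IsSimplex T ∧ a ∈ T then h.1.basis.coord ⟨a, h.2⟩ else 0

variable {T : Finset (E d)} (hT : IsSimplex T)

include hT

lemma bary_eq {a : E d} (ha : a ∈ T) : bary T a = hT.basis.coord ⟨a, ha⟩ := by
  rw [bary, dif_pos ⟨hT, ha⟩]

lemma bary_self {a : E d} (ha : a ∈ T) : bary T a a = 1 := by
  rw [bary_eq hT ha]
  exact hT.basis.coord_apply_eq ⟨a, ha⟩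

lemma bary_of_ne {a b : E d} (hb : b ∈ T) (hab : a ≠ b) : bary T a b = 0 := by
  by_cases ha : a ∈ T
  · rw [bary_eq hT ha]
    exact hT.basis.coord_apply_ne (i := ⟨a, ha⟩) (j := ⟨b, hb⟩) (by simpa using hab)
  · rw [bary, dif_neg (by simp [ha])]; rfl

lemma sum_bary (x : E d) : ∑ a ∈ T, bary T a x = 1 := by
  rw [← Finset.sum_coe_sort, ← hT.basis.sum_coord_apply_eq_one x]
  exact Finset.sum_congr rfl fun a _ => by rw [bary_eq hT a.2]

lemma sum_bary_smul (x : E d) : ∑ a ∈ T, bary T a x • a = x := by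
  conv_rhs => rw [← hT.basis.linear_combination_coord_eq_self x]
  rw [← Finset.sum_coe_sort]
  exact Finset.sum_congr rfl fun a _ => by rw [bary_eq hT a.2]; rfl

lemma affine_eq_sum_bary (l : E d →ᵃ[ℝ] ℝ) (x : E d) : l x = ∑ a ∈ T, bary T a x * l a := by
  have h := sum_bary_smul hT x
  have h1 := sum_bary hT x
  have key := affine_apply l
  rw [key x]
  conv_lhs => rw [← h]
  rw [map_sum, ← one_mul (l 0), ← h1, Finset.sum_mul, ← Finset.sum_add_distrib]
  refine Finset.sum_congr rfl fun a _ => ?_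
  rw [key a, map_smul, smul_eq_mul]; ring

lemma mem_hull_iff {x : E d} : x ∈ hull T ↔ ∀ a ∈ T, 0 ≤ bary T a x := by
  have h := hT.basis.convexHull_eq_nonneg_coord
  have hr : range hT.basis = (T : Set (E d)) := by
    change range ((↑) : T → E d) = _
    simp
  rw [hr] at h
  rw [hull, h]
  constructor
  · intro hx a ha
    rw [bary_eq hT ha]; exact hx ⟨a, ha⟩
  · intro hx a
    have := hx a a.2
    rwa [bary_eq hT a.2] at this

lemma mem_interior_hull_iff {x : E d} : x ∈ interior (hull T) ↔ ∀ a ∈ T, 0 < bary T a x := by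
  have h := hT.basis.interior_convexHull
  have hr : range hT.basis = (T : Set (E d)) := by
    change range ((↑) : T → E d) = _
    simp
  rw [hr] at h
  rw [hull, h]
  constructor
  · intro hx a ha
    rw [bary_eq hT ha]; exact hx ⟨a, ha⟩
  · intro hx a
    have := hx a a.2
    rwa [bary_eq hT a.2] at this

lemma bary_combination {w : E d → ℝ} (hw : ∑ a ∈ T, w a = 1) {a : E d} (ha : a ∈ T) :
    bary T a (∑ b ∈ T, w b • b) = w a := by
  have key := affine_apply (bary T a)
  rw [key, map_sum, ← one_mul (bary T a 0), ← hw, Finset.sum_mul, ← Finset.sum_add_distrib,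
    Finset.sum_eq_single a]
  · have := key a
    rw [bary_self hT ha] at this
    rw [map_smul, smul_eq_mul, ← mul_add, ← this, mul_one]
  · intro b hb hba
    have := key b
    rw [bary_of_ne hT hb hba.symm] at this
    rw [map_smul, smul_eq_mul, ← mul_add, ← this, mul_zero]
  · exact fun h => absurd ha h

lemma mem_hull_subset_iff {S : Finset (E d)} (hS : S ⊆ T) {x : E d} :
    x ∈ hull S ↔ x ∈ hull T ∧ ∀ a ∈ T, a ∉ S → bary T a x = 0 := by
  constructor
  · intro hx
    refine ⟨convexHull_mono (by exact_mod_cast hS) hx, fun a ha haS => ?_⟩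
    obtain ⟨w, -, h1, h2⟩ := Finset.mem_convexHull'.1 hx
    classical
    have e1 : ∑ b ∈ T, (if b ∈ S then w b else 0) = 1 := by
      rw [← h1, ← Finset.sum_filter, Finset.filter_mem_eq_inter, Finset.inter_eq_right.2 hS]
    have e2 : ∑ b ∈ T, (if b ∈ S then w b else 0) • b = x := by
      rw [← h2]
      simp only [ite_smul, zero_smul]
      rw [← Finset.sum_filter, Finset.filter_mem_eq_inter, Finset.inter_eq_right.2 hS]
    have := bary_combination hT e1 ha
    rw [e2, if_neg haS] at this
    exact this
  · rintro ⟨hx, h0⟩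
    rw [mem_hull_iff hT] at hx
    refine Finset.mem_convexHull'.2 ⟨fun a => bary T a x, fun a ha => hx a (hS ha), ?_, ?_⟩
    · rw [← sum_bary hT x]
      exact Finset.sum_subset hS fun a ha haS => h0 a ha haS
    · conv_rhs => rw [← sum_bary_smul hT x]
      exact Finset.sum_subset hS fun a ha haS => by simp only [h0 a ha haS, zero_smul]

omit hT in
lemma vertex_mem_hull {a : E d} (ha : a ∈ T) : a ∈ hull T := subset_convexHull ℝ _ ha

omit hT in
lemma isCompact_hull (T : Finset (E d)) : IsCompact (hull T) :=
  T.finite_toSet.isCompact_convexHull ℝ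

omit hT in
lemma convex_hull (T : Finset (E d)) : Convex ℝ (hull T) := convex_convexHull ℝ _

omit hT in
lemma convex_dualPart (T : Finset (E d)) (a : E d) : Convex ℝ (Triangulation.dualPart T a) :=
  convex_convexHull ℝ _

lemma interior_hull_nonempty : (interior (hull T)).Nonempty := by
  refine ⟨∑ b ∈ T, (1 / (d + 1 : ℝ)) • b, ?_⟩
  rw [mem_interior_hull_iff hT]
  intro a ha
  rw [bary_combination hT (w := fun _ => 1 / (d + 1 : ℝ)) _ ha]
  · positivity
  · rw [Finset.sum_const, hT.card_eq, nsmul_eq_mul]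
    push_cast
    field_simp

lemma closure_interior_hull : closure (interior (hull T)) = hull T := by
  have h := Convex.closure_interior_eq_closure_of_nonempty_interior (𝕜 := ℝ) (convex_hull T)
    (interior_hull_nonempty hT)
  rw [h]
  exact (isCompact_hull T).isClosed.closure_eq

lemma exists_ne_mem (hd : 1 ≤ d) (a : E d) : ∃ b ∈ T, b ≠ a := by
  by_contra! h
  have : T ⊆ {a} := fun b hb => by simpa using h b hb
  have := Finset.card_le_card this
  rw [hT.card_eq, Finset.card_singleton] at this
  omega

lemma affGrad_bary_ne_zero (hd : 1 ≤ d) {a : E d} (ha : a ∈ T) : affGrad (bary T a) ≠ 0 := by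
  obtain ⟨b, hb, hba⟩ := exists_ne_mem hT hd a
  refine affGrad_ne_zero (x := a) (y := b) ?_
  rw [bary_self hT ha, bary_of_ne hT hb hba.symm]
  norm_num

lemma bary_centroid {S : Finset (E d)} (hS : S ⊆ T) (hne : S.Nonempty) {a : E d} (ha : a ∈ T) :
    bary T a (S.centroid ℝ id) = (S.card : ℝ)⁻¹ * (if a ∈ S then 1 else 0) := by
  classical
  have hc : (S.card : ℝ) ≠ 0 := by simpa using hne.ne_empty
  have e : S.centroid ℝ id = ∑ b ∈ T, ((S.card : ℝ)⁻¹ * (if b ∈ S then 1 else 0)) • b := by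
    rw [Finset.centroid_eq_centerMass S hne id, Finset.centerMass]
    have : ∑ i ∈ S, Finset.centroidWeights ℝ S i = 1 :=
      Finset.sum_centroidWeights_eq_one_of_nonempty ℝ _ hne
    rw [this, inv_one, one_smul]
    symm
    rw [← Finset.sum_subset hS]
    · exact Finset.sum_congr rfl fun b hb => by simp [hb]
    · intro b _ hb; simp [hb]
  rw [e, bary_combination hT _ ha]
  rw [← Finset.mul_sum, ← Finset.sum_filter, Finset.filter_mem_eq_inter,
    Finset.inter_eq_right.2 hS]
  simp [hc]

omit hT in
open Pointwise in
/-- A combination of the vertices whose weights are largest at `a` lies in the cone over the dual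
part of `a`: subtract the smallest positive weight on the support of the weights, which splits off a
multiple of the centroid of the support, and repeat. -/
lemma sum_smul_mem_smul_dualPart {a : E d} (n : ℕ) : ∀ w : E d → ℝ, (∀ b ∈ T, 0 ≤ w b) →
    (∀ b ∈ T, w b ≤ w a) → a ∈ T → (T.filter fun b => 0 < w b).card ≤ n →
    ∑ b ∈ T, w b • b ∈ (∑ b ∈ T, w b) • Triangulation.dualPart T a := by
  classical
  have hne : a ∈ T → (Triangulation.dualPart T a).Nonempty := fun ha =>
    ⟨_, subset_convexHull ℝ _ ⟨{a}, by simpa using ha, by simp, rfl⟩⟩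
  have hzero : ∀ w : E d → ℝ, (∀ b ∈ T, 0 ≤ w b) → a ∈ T → (T.filter fun b => 0 < w b) = ∅ →
      ∑ b ∈ T, w b • b ∈ (∑ b ∈ T, w b) • Triangulation.dualPart T a := by
    intro w h0 ha he
    have hw : ∀ b ∈ T, w b = 0 := fun b hb => by
      by_contra hne
      have : b ∈ T.filter fun b => 0 < w b :=
        Finset.mem_filter.2 ⟨hb, lt_of_le_of_ne (h0 b hb) (Ne.symm hne)⟩
      rw [he] at this; simp at this
    rw [Finset.sum_eq_zero hw, Finset.sum_eq_zero fun b hb => by rw [hw b hb, zero_smul],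
      Set.zero_smul_set (hne ha)]
    exact Set.mem_zero.2 rfl
  induction n with
  | zero =>
    intro w h0 _ ha hc
    exact hzero w h0 ha (by simpa using hc)
  | succ n ih =>
    intro w h0 hmax ha hc
    set S := T.filter fun b => 0 < w b with hS
    by_cases he : S = ∅
    · exact hzero w h0 ha he
    have hSne : S.Nonempty := Finset.nonempty_iff_ne_empty.2 he
    obtain ⟨m, hmS, hm⟩ := S.exists_min_image w hSne
    have hm0 : 0 < w m := (Finset.mem_filter.1 hmS).2
    have haS : a ∈ S :=
      Finset.mem_filter.2 ⟨ha, lt_of_lt_of_le hm0 (hmax m (Finset.mem_filter.1 hmS).1)⟩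
    have hST : S ⊆ T := Finset.filter_subset _ _
    set w' : E d → ℝ := fun b => w b - if b ∈ S then w m else 0 with hw'
    have h0' : ∀ b ∈ T, 0 ≤ w' b := by
      intro b hb
      by_cases hbS : b ∈ S
      · simp [hw', hbS, hm b hbS]
      · simp [hw', hbS, h0 b hb]
    have hmax' : ∀ b ∈ T, w' b ≤ w' a := by
      intro b hb
      by_cases hbS : b ∈ S
      · simp [hw', hbS, haS, hmax b hb]
      · have : w b = 0 := by
          by_contra hne
          exact hbS (Finset.mem_filter.2 ⟨hb, lt_of_le_of_ne (h0 b hb) (Ne.symm hne)⟩)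
        simp [hw', hbS, haS, hm a haS, this]
    have hc' : (T.filter fun b => 0 < w' b).card ≤ n := by
      have : (T.filter fun b => 0 < w' b) ⊆ S.erase m := by
        intro b hb
        obtain ⟨hbT, hb0⟩ := Finset.mem_filter.1 hb
        have hbS : b ∈ S := by
          by_contra hbS
          refine hbS (Finset.mem_filter.2 ⟨hbT, ?_⟩)
          simpa [hw', hbS] using hb0
        refine Finset.mem_erase.2 ⟨?_, hbS⟩
        rintro rfl
        simp [hw', hbS] at hb0
      have h1 := Finset.card_le_card this
      rw [Finset.card_erase_of_mem hmS] at h1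
      omega
    have hih := ih w' h0' hmax' ha hc'
    have hcpos : (0 : ℝ) < S.card := by exact_mod_cast hSne.card_pos
    have hcent : (S.card * w m) • S.centroid ℝ id ∈
        ((S.card : ℝ) * w m) • Triangulation.dualPart T a :=
      Set.smul_mem_smul_set (subset_convexHull ℝ _ ⟨S, hST, haS, rfl⟩)
    have e1 : ∑ b ∈ T, w b = ∑ b ∈ T, w' b + S.card * w m := by
      simp only [hw', Finset.sum_sub_distrib]
      rw [← Finset.sum_filter, Finset.filter_mem_eq_inter, Finset.inter_eq_right.2 hST]
      simp
    have e3 : (S.card * w m) • S.centroid ℝ id = ∑ b ∈ S, w m • b := by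
      rw [Finset.centroid_eq_centerMass S hSne id, Finset.centerMass]
      have : ∑ i ∈ S, Finset.centroidWeights ℝ S i = 1 :=
        Finset.sum_centroidWeights_eq_one_of_nonempty ℝ _ hSne
      rw [this, inv_one, one_smul, Finset.smul_sum]
      refine Finset.sum_congr rfl fun b _ => ?_
      rw [Finset.centroidWeights_apply, id, smul_smul]
      congr 1
      field_simp
    have e2 : ∑ b ∈ T, w b • b = ∑ b ∈ T, w' b • b + (S.card * w m) • S.centroid ℝ id := by
      rw [e3]
      simp only [hw', sub_smul, Finset.sum_sub_distrib, ite_smul, zero_smul]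
      rw [← Finset.sum_filter, Finset.filter_mem_eq_inter, Finset.inter_eq_right.2 hST]
      simp
    rw [e1, e2, (convex_dualPart T a).add_smul
      (Finset.sum_nonneg h0') (by positivity)]
    exact Set.add_mem_add hih hcent

open Pointwise in
/-- The dual part of a vertex consists of the points of the simplex at which the barycentric
coordinate of that vertex is maximal. -/
lemma mem_dualPart_iff {a : E d} (ha : a ∈ T) {x : E d} :
    x ∈ Triangulation.dualPart T a ↔ x ∈ hull T ∧ ∀ b ∈ T, bary T b x ≤ bary T a x := by
  constructor
  · intro hx
    have hconv : Convex ℝ {x | x ∈ hull T ∧ ∀ b ∈ T, bary T b x ≤ bary T a x} := by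
      intro x hx y hy s t hs ht hst
      refine ⟨convex_hull T hx.1 hy.1 hs ht hst, fun b hb => ?_⟩
      rw [Convex.combo_affine_apply hst, Convex.combo_affine_apply hst]
      have h1 := hx.2 b hb
      have h2 := hy.2 b hb
      simp only [smul_eq_mul]
      gcongr
    refine (convexHull_min ?_ hconv) hx
    rintro _ ⟨S, hS, haS, rfl⟩
    refine ⟨?_, fun b hb => ?_⟩
    · exact convexHull_mono (by exact_mod_cast hS) (S.centroid_mem_convexHull ⟨a, haS⟩)
    · rw [bary_centroid hT hS ⟨a, haS⟩ hb, bary_centroid hT hS ⟨a, haS⟩ ha]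
      refine mul_le_mul_of_nonneg_left ?_ (by positivity)
      split_ifs <;> simp_all
  · rintro ⟨hx, hmax⟩
    have := sum_smul_mem_smul_dualPart (T := T) (a := a) _ (fun b => bary T b x)
      ((mem_hull_iff hT).1 hx) hmax ha le_rfl
    rwa [sum_bary hT, sum_bary_smul hT, one_smul] at this

end Bary

/-! ### Surface measure on hyperplanes -/

section Hyperplane

open Filter Topology

variable {d : ℕ}

lemma measure_affine_eq_zero {V : Type*} [NormedAddCommGroup V] [NormedSpace ℝ V]
    [MeasurableSpace V] [BorelSpace V] [FiniteDimensional ℝ V] (μ : Measure V)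
    [μ.IsAddHaarMeasure] (l : V →ᵃ[ℝ] ℝ) (h : ∃ v, l v ≠ 0) : μ {v | l v = 0} = 0 := by
  have hs : {v | l v = 0} = ((AffineSubspace.mk' (0 : ℝ) ⊥).comap l : Set V) := by
    ext v; simp
  rw [hs]
  refine Measure.addHaar_affineSubspace μ _ fun htop => ?_
  obtain ⟨v, hv⟩ := h
  have : v ∈ ((AffineSubspace.mk' (0 : ℝ) ⊥).comap l) := by rw [htop]; trivial
  exact hv (by simpa using this)

/-- The points at height `t` above the hyperplane through `p` with unit normal `n`: coordinates
`(t, y)` with `y` orthogonal to `n`. -/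
def layerEquiv (n : E d) (hn : ‖n‖ = 1) (p : E d) : ℝ × (ℝ ∙ n)ᗮ ≃ᵐ E d :=
  (MeasurableEquiv.prodCongr
    (LinearIsometryEquiv.toSpanUnitSingleton n hn).toHomeomorph.toMeasurableEquiv
    (MeasurableEquiv.refl _)).trans ((ℝ ∙ n).measurableEquivProd p).symm

lemma layerEquiv_apply (n : E d) (hn : ‖n‖ = 1) (p : E d) (z : ℝ × (ℝ ∙ n)ᗮ) :
    layerEquiv n hn p z = z.2 + p + z.1 • n := by
  change (((ℝ ∙ n).measurableEquivProd p).symm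
    (LinearIsometryEquiv.toSpanUnitSingleton n hn z.1, z.2)) = _
  rw [Submodule.measurableEquivProd_symm_apply]
  simp only [LinearIsometryEquiv.toSpanUnitSingleton_apply, vadd_eq_add]
  abel

lemma measurePreserving_layerEquiv (n : E d) (hn : ‖n‖ = 1) (p : E d) :
    MeasurePreserving (layerEquiv n hn p) (volume.prod volume) volume := by
  have h1 := ((ℝ ∙ n).measurePreserving_measurableEquivProd p).symm
  rw [InnerProductSpace.euclideanHausdorffMeasure_eq_volume] at h1
  exact ((LinearIsometryEquiv.toSpanUnitSingleton n hn).measurePreserving.prod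
    (MeasurePreserving.id volume)).trans h1

lemma inner_coe_orthogonal (n : E d) (y : (ℝ ∙ n)ᗮ) : inner ℝ n (y : E d) = 0 :=
  Submodule.mem_orthogonal_singleton_iff_inner_right.1 y.2

lemma finrank_orthogonal_unit (n : E d) (hn : ‖n‖ = 1) :
    Module.finrank ℝ (ℝ ∙ n)ᗮ = d - 1 := by
  have h := (ℝ ∙ n).finrank_add_finrank_orthogonal
  rw [finrank_span_singleton (by rintro rfl; simp at hn), finrank_euclideanSpace_fin] at h
  omega

/-- The isometric parametrisation of a hyperplane by its direction. -/
lemma map_add_eq_restrict (n : E d) (hn : ‖n‖ = 1) (p : E d) :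
    (volume : Measure (ℝ ∙ n)ᗮ).map (fun y : (ℝ ∙ n)ᗮ => (y : E d) + p) =
      (μHE[d - 1]).restrict {x | inner ℝ n (x - p) = 0} := by
  have hiso : Isometry (fun y : (ℝ ∙ n)ᗮ => (y : E d) + p) :=
    Isometry.of_dist_eq fun x y => by rw [dist_add_right]; rfl
  have hr : range (fun y : (ℝ ∙ n)ᗮ => (y : E d) + p) = {x | inner ℝ n (x - p) = 0} := by
    ext x
    constructor
    · rintro ⟨y, rfl⟩
      simp [inner_coe_orthogonal]
    · intro hx
      exact ⟨⟨x - p, Submodule.mem_orthogonal_singleton_iff_inner_right.2 hx⟩, by simp⟩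
  rw [← hr, ← hiso.map_euclideanHausdorffMeasure, ← finrank_orthogonal_unit n hn,
    InnerProductSpace.euclideanHausdorffMeasure_eq_volume]

lemma measurableEmbedding_add (n : E d) (p : E d) :
    MeasurableEmbedding (fun y : (ℝ ∙ n)ᗮ => (y : E d) + p) := by
  have hiso : Isometry (fun y : (ℝ ∙ n)ᗮ => (y : E d) + p) :=
    Isometry.of_dist_eq fun x y => by rw [dist_add_right]; rfl
  exact hiso.isClosedEmbedding.measurableEmbedding

lemma setIntegral_hyperplane (n : E d) (hn : ‖n‖ = 1) (p : E d) (φ : E d → ℝ) :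
    ∫ x in {x | inner ℝ n (x - p) = 0}, φ x ∂μHE[d - 1] = ∫ y : (ℝ ∙ n)ᗮ, φ (y + p) := by
  rw [← map_add_eq_restrict n hn p, (measurableEmbedding_add n p).integral_map]

lemma ae_hyperplane_iff (n : E d) (hn : ‖n‖ = 1) (p : E d) {q : E d → Prop} :
    (∀ᵐ x ∂(μHE[d - 1]).restrict {x | inner ℝ n (x - p) = 0}, q x) ↔
      ∀ᵐ y : (ℝ ∙ n)ᗮ, q (y + p) := by
  rw [← map_add_eq_restrict n hn p, (measurableEmbedding_add n p).ae_map_iff]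

/-- An affine function restricted to a hyperplane. -/
def restrictAffine (l : E d →ᵃ[ℝ] ℝ) (n p : E d) : (ℝ ∙ n)ᗮ →ᵃ[ℝ] ℝ :=
  l.comp ((ℝ ∙ n)ᗮ.subtype.toAffineMap + AffineMap.const ℝ _ p)

lemma restrictAffine_apply (l : E d →ᵃ[ℝ] ℝ) (n p : E d) (y : (ℝ ∙ n)ᗮ) :
    restrictAffine l n p y = l (y + p) := rfl

lemma ae_ne_zero_of_exists (n : E d) (p : E d) (l : E d →ᵃ[ℝ] ℝ)
    (h : ∃ q, inner ℝ n (q - p) = 0 ∧ l q ≠ 0) : ∀ᵐ y : (ℝ ∙ n)ᗮ, l (y + p) ≠ 0 := by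
  obtain ⟨q, hq, hl⟩ := h
  have := measure_affine_eq_zero (volume : Measure (ℝ ∙ n)ᗮ) (restrictAffine l n p)
    ⟨⟨q - p, Submodule.mem_orthogonal_singleton_iff_inner_right.2 hq⟩, by
      rw [restrictAffine_apply]; simpa using hl⟩
  rw [ae_iff]
  simpa [restrictAffine_apply] using this

/-- Integrals over thin layers above a hyperplane converge to the surface integral: the weight
`ε⁻¹ η(·/ε)` of the height has mass one and concentrates on height zero. -/
lemma tendsto_layer (n : E d) (hn : ‖n‖ = 1) (p : E d) {η : ℝ → ℝ} (hηc : Continuous η)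
    (hη0 : ∀ t, t ∉ Icc (1 : ℝ) 2 → η t = 0) (hη1 : ∫ t, η t = 1)
    {K : ℝ → E d → ℝ} {k : E d → ℝ} {C R : ℝ} (hKm : ∀ ε, 0 < ε → Measurable (K ε))
    (hKC : ∀ ε, 0 < ε → ∀ x, |K ε x| ≤ C)
    (hKR : ∀ ε, 0 < ε → ∀ x, R < ‖x - p‖ → K ε x = 0)
    (hlim : ∀ᵐ y : (ℝ ∙ n)ᗮ, ∀ τ, 0 < τ →
      Tendsto (fun ε => K ε (y + p + (ε * τ) • n)) (𝓝[>] 0) (𝓝 (k (y + p)))) :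
    Tendsto (fun ε => ∫ x, ε⁻¹ * η (inner ℝ n (x - p) / ε) * K ε x) (𝓝[>] 0)
      (𝓝 (∫ y : (ℝ ∙ n)ᗮ, k (y + p))) := by
  have hC : 0 ≤ C := (abs_nonneg _).trans (hKC 1 one_pos 0)
  obtain ⟨Cη, hCη⟩ : ∃ Cη, ∀ t, |η t| ≤ Cη := by
    have hcs : HasCompactSupport η :=
      HasCompactSupport.intro isCompact_Icc fun t ht => hη0 t ht
    obtain ⟨c, hc⟩ := hcs.exists_bound_of_continuous hηc
    exact ⟨c, fun t => by simpa using hc t⟩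
  have hCη0 : 0 ≤ Cη := (abs_nonneg _).trans (hCη 0)
  have hinn : ∀ (y : (ℝ ∙ n)ᗮ) (t : ℝ), inner ℝ n ((y : E d) + p + t • n - p) = t := by
    intro y t
    rw [show (y : E d) + p + t • n - p = y + t • n by abel, inner_add_right,
      inner_coe_orthogonal, inner_smul_right, real_inner_self_eq_norm_sq, hn]
    ring
  have hnorm : ∀ (y : (ℝ ∙ n)ᗮ) (t : ℝ), ‖y‖ ≤ ‖(y : E d) + p + t • n - p‖ := by
    intro y t
    rw [show (y : E d) + p + t • n - p = y + t • n by abel]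
    have h : ‖(y : E d) + t • n‖ * ‖(y : E d) + t • n‖ =
        ‖(y : E d)‖ * ‖(y : E d)‖ + ‖t • n‖ * ‖t • n‖ := by
      apply norm_add_sq_eq_norm_sq_add_norm_sq_real
      rw [inner_smul_right, real_inner_comm, inner_coe_orthogonal, mul_zero]
    rw [Submodule.norm_coe] at h
    nlinarith [norm_nonneg ((y : E d) + t • n), norm_nonneg y, mul_self_nonneg ‖t • n‖]
  have hmeasF : ∀ ε, 0 < ε → Measurable fun x => ε⁻¹ * η (inner ℝ n (x - p) / ε) * K ε x := by
    intro ε hε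
    have : Measurable fun x : E d => η (inner ℝ n (x - p) / ε) := by
      refine (hηc.comp ?_).measurable
      fun_prop
    exact (this.const_mul _).mul (hKm ε hε)
  have hint : ∀ ε, 0 < ε → Integrable fun x => ε⁻¹ * η (inner ℝ n (x - p) / ε) * K ε x := by
    intro ε hε
    refine Measure.integrableOn_of_bounded (s := Metric.closedBall p R) (M := ε⁻¹ * Cη * C)
      measure_closedBall_lt_top.ne (hmeasF ε hε).aestronglyMeasurable ?_ |>.integrable_of_forall_notMem_eq_zero ?_
    · refine Eventually.of_forall fun x => ?_
      rw [Real.norm_eq_abs, abs_mul, abs_mul, abs_of_pos (inv_pos.2 hε)]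
      gcongr
      · exact hCη _
      · exact hKC ε hε x
    · intro x hx
      rw [hKR ε hε x (by simpa [dist_eq_norm] using hx), mul_zero]
  -- the mean over the slice at height `t`
  set Mn : ℝ → ℝ → ℝ := fun (ε t : ℝ) => ∫ y : (ℝ ∙ n)ᗮ, K ε (y + p + t • n) with hMn
  have hslice : ∀ ε t : ℝ, 0 < ε →
      AEStronglyMeasurable (fun y : (ℝ ∙ n)ᗮ => K ε (y + p + t • n)) volume := by
    intro ε t hε
    refine ((hKm ε hε).comp ?_).aestronglyMeasurable
    fun_prop
  have hbd : Integrable (fun y : (ℝ ∙ n)ᗮ => (Metric.closedBall (0 : (ℝ ∙ n)ᗮ) R).indicator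
      (fun _ => C) y) := by
    rw [integrable_indicator_iff Metric.isClosed_closedBall.measurableSet]
    exact integrableOn_const measure_closedBall_lt_top.ne
  have hle : ∀ ε t : ℝ, 0 < ε → ∀ y : (ℝ ∙ n)ᗮ, ‖K ε (y + p + t • n)‖ ≤
      (Metric.closedBall (0 : (ℝ ∙ n)ᗮ) R).indicator (fun _ => C) y := by
    intro ε t hε y
    by_cases hy : y ∈ Metric.closedBall (0 : (ℝ ∙ n)ᗮ) R
    · rw [indicator_of_mem hy]; exact hKC ε hε _
    · rw [indicator_of_notMem hy, hKR ε hε, norm_zero]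
      refine lt_of_lt_of_le ?_ (hnorm y t)
      simpa using hy
  have hMbd : ∀ ε t, 0 < ε →
      |Mn ε t| ≤ ∫ y : (ℝ ∙ n)ᗮ, (Metric.closedBall (0 : (ℝ ∙ n)ᗮ) R).indicator (fun _ => C) y :=
    fun ε t hε => norm_integral_le_of_norm_le hbd (Eventually.of_forall (hle ε t hε))
  have hMlim : ∀ τ, 0 < τ →
      Tendsto (fun ε => Mn ε (ε * τ)) (𝓝[>] 0) (𝓝 (∫ y : (ℝ ∙ n)ᗮ, k (y + p))) := by
    intro τ hτ
    refine tendsto_integral_filter_of_dominated_convergence _ ?_ ?_ hbd ?_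
    · filter_upwards [self_mem_nhdsWithin] with ε hε using hslice ε _ hε
    · filter_upwards [self_mem_nhdsWithin] with ε hε
      exact Eventually.of_forall (hle ε _ hε)
    · filter_upwards [hlim] with y hy using hy τ hτ
  have hMmeas : ∀ ε, 0 < ε → StronglyMeasurable (Mn ε) := by
    intro ε hε
    have : StronglyMeasurable (Function.uncurry fun (t : ℝ) (y : (ℝ ∙ n)ᗮ) =>
        K ε (y + p + t • n)) := by
      refine ((hKm ε hε).comp ?_).stronglyMeasurable
      fun_prop
    exact this.integral_prod_right
  have hre : ∀ ε, 0 < ε → ∫ x, ε⁻¹ * η (inner ℝ n (x - p) / ε) * K ε x =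
      ∫ τ, η τ * Mn ε (ε * τ) := by
    intro ε hε
    have hi := hint ε hε
    rw [← (measurePreserving_layerEquiv n hn p).integrable_comp_emb
      (layerEquiv n hn p).measurableEmbedding] at hi
    rw [← (measurePreserving_layerEquiv n hn p).integral_comp
      (layerEquiv n hn p).measurableEmbedding]
    have := integral_prod _ hi
    simp only [Function.comp_apply] at this
    rw [this]
    simp only [layerEquiv_apply, hinn, integral_const_mul]
    have h2 := Measure.integral_comp_mul_left (fun t => ε⁻¹ * η (t / ε) * Mn ε t) ε
    rw [abs_of_pos (inv_pos.2 hε), smul_eq_mul, eq_inv_mul_iff_mul_eq₀ hε.ne'] at h2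
    rw [← h2, ← integral_const_mul]
    refine integral_congr_ae (Eventually.of_forall fun τ => ?_)
    simp only
    rw [mul_div_cancel_left₀ _ hε.ne']
    field_simp
  have hfin : Tendsto (fun ε => ∫ τ, η τ * Mn ε (ε * τ)) (𝓝[>] 0)
      (𝓝 (∫ τ, η τ * ∫ y : (ℝ ∙ n)ᗮ, k (y + p))) := by
    have hηi : Integrable η :=
      hηc.integrable_of_hasCompactSupport
        (HasCompactSupport.intro isCompact_Icc fun t ht => hη0 t ht)
    refine tendsto_integral_filter_of_dominated_convergence (fun τ => |η τ| *
      ∫ y : (ℝ ∙ n)ᗮ, (Metric.closedBall (0 : (ℝ ∙ n)ᗮ) R).indicator (fun _ => C) y)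
      ?_ ?_ (hηi.abs.mul_const _) ?_
    · filter_upwards [self_mem_nhdsWithin] with ε hε
      exact hηc.aestronglyMeasurable.mul
        ((hMmeas ε hε).comp_measurable (measurable_const_mul ε)).aestronglyMeasurable
    · filter_upwards [self_mem_nhdsWithin] with ε hε
      refine Eventually.of_forall fun τ => ?_
      rw [norm_mul, Real.norm_eq_abs]
      exact mul_le_mul_of_nonneg_left (hMbd ε _ hε) (abs_nonneg _)
    · refine Eventually.of_forall fun τ => ?_
      by_cases hτ : 0 < τ
      · exact (hMlim τ hτ).const_mul _
      · rw [hη0 τ fun h => hτ (one_pos.trans_le h.1)]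
        simp
  rw [integral_mul_const, hη1, one_mul] at hfin
  refine hfin.congr' ?_
  filter_upwards [self_mem_nhdsWithin] with ε hε using (hre ε hε).symm

end Hyperplane

/-! ### The divergence theorem on polytopes -/

section Divergence

open Filter Topology

variable {d : ℕ}

lemma inner_gradient (φ : E d → ℝ) (x v : E d) : inner ℝ v (gradient φ x) = fderiv ℝ φ x v := by
  rw [real_inner_comm, gradient, InnerProductSpace.toDual_symm_apply]

/-- A smooth function of the height which vanishes below `1` and equals `1` above `2`. -/
def cutoff (t : ℝ) : ℝ := Real.smoothTransition (t - 1)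

lemma contDiff_cutoff : ContDiff ℝ ∞ cutoff :=
  Real.smoothTransition.contDiff.comp (contDiff_id.sub contDiff_const)

lemma cutoff_of_le {t : ℝ} (ht : t ≤ 1) : cutoff t = 0 :=
  Real.smoothTransition.zero_of_nonpos (by linarith)

lemma cutoff_of_ge {t : ℝ} (ht : 2 ≤ t) : cutoff t = 1 :=
  Real.smoothTransition.one_of_one_le (by linarith)

lemma cutoff_nonneg (t : ℝ) : 0 ≤ cutoff t := Real.smoothTransition.nonneg _

lemma cutoff_le_one (t : ℝ) : cutoff t ≤ 1 := Real.smoothTransition.le_one _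

lemma continuous_deriv_cutoff : Continuous (deriv cutoff) :=
  contDiff_cutoff.continuous_deriv (by simp)

lemma deriv_cutoff_eq_zero (t : ℝ) (ht : t ∉ Icc (1 : ℝ) 2) : deriv cutoff t = 0 := by
  rw [mem_Icc, not_and_or, not_le, not_le] at ht
  rcases ht with h | h
  · have : cutoff =ᶠ[𝓝 t] fun _ => 0 := by
      filter_upwards [Iio_mem_nhds h] with s hs using cutoff_of_le (le_of_lt hs)
    rw [this.deriv_eq, deriv_const]
  · have : cutoff =ᶠ[𝓝 t] fun _ => 1 := by
      filter_upwards [Ioi_mem_nhds h] with s hs using cutoff_of_ge (le_of_lt hs)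
    rw [this.deriv_eq, deriv_const]

lemma integral_deriv_cutoff : ∫ t, deriv cutoff t = 1 := by
  have h : ∫ t in (1 : ℝ)..2, deriv cutoff t = cutoff 2 - cutoff 1 :=
    intervalIntegral.integral_deriv_eq_sub
      (fun t _ => (contDiff_cutoff.differentiable (by simp)).differentiableAt)
      (continuous_deriv_cutoff.intervalIntegrable _ _)
  rw [cutoff_of_ge le_rfl, cutoff_of_le le_rfl, sub_zero,
    intervalIntegral.integral_of_le (by norm_num), ← integral_Icc_eq_integral_Ioc] at h
  rw [← h]
  exact (setIntegral_eq_integral_of_forall_compl_eq_zero deriv_cutoff_eq_zero).symm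

/-- The outer unit normal on the facet `l = 0` of a polytope which lies in `0 ≤ l`. -/
def outN (l : E d →ᵃ[ℝ] ℝ) : E d := -(‖affGrad l‖⁻¹ • affGrad l)

/-- The divergence theorem on a bounded polytope, for defining functions with unit gradients. The
weak divergence is tested with the product of cutoffs of the heights over the facets. -/
lemma divergence_polytope_unit {ι : Type*} [DecidableEq ι] (s : Finset ι)
    (ℓ : ι → E d →ᵃ[ℝ] ℝ)
    (hunit : ∀ i ∈ s, ‖affGrad (ℓ i)‖ = 1)
    (hdist : ∀ i ∈ s, ∀ j ∈ s, i ≠ j → ∃ q, ℓ i q = 0 ∧ ℓ j q ≠ 0)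
    {P U : Set (E d)} (hP : P = {x | ∀ i ∈ s, 0 ≤ ℓ i x}) (hU : U = {x | ∀ i ∈ s, 0 < ℓ i x})
    (hPc : IsCompact P) {g : E d → E d} (hg : ContinuousOn g P) {D : E d → ℝ}
    (hD : HasWeakDiv U g D) (hDi : IntegrableOn D U) :
    ∫ x in U, D x =
      -∑ i ∈ s, ∫ x in P ∩ {x | ℓ i x = 0}, inner ℝ (g x) (affGrad (ℓ i)) ∂μHE[d - 1] := by
  have hUo : IsOpen U := by
    have : U = ⋂ i ∈ s, {x | 0 < ℓ i x} := by ext x; simp [hU]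
    rw [this]
    exact isOpen_biInter_finset fun i _ => isOpen_lt continuous_const (continuous_affine _)
  have hUP : U ⊆ P := by
    rw [hP, hU]; exact fun x hx i hi => (hx i hi).le
  have hPm : MeasurableSet P := hPc.isClosed.measurableSet
  obtain ⟨C, hC⟩ := hPc.exists_bound_of_continuousOn hg
  set g0 : E d → E d := P.indicator g with hg0
  have hg0m : Measurable g0 := by
    classical
    have := hg.measurable_piecewise (g := 0) continuousOn_const hPm
    rwa [Set.piecewise_eq_indicator] at this
  have hg0C : ∀ x, ‖g0 x‖ ≤ max C 0 := by
    intro x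
    by_cases hx : x ∈ P
    · rw [hg0, indicator_of_mem hx]; exact (hC x hx).trans (le_max_left _ _)
    · rw [hg0, indicator_of_notMem hx, norm_zero]; exact le_max_right _ _
  -- the cutoff of the polytope
  set χ : ℝ → E d → ℝ := fun ε x => ∏ i ∈ s, cutoff (ℓ i x / ε) with hχ
  have hcc : ∀ ε i, ContDiff ℝ ∞ fun x => cutoff (ℓ i x / ε) := fun ε i =>
    contDiff_cutoff.comp ((contDiff_affine _).div_const _)
  have hχt : ∀ ε, 0 < ε → IsTestFun U (χ ε) := by
    intro ε hε
    have hcl : IsClosed {x | ∀ i ∈ s, ε ≤ ℓ i x} := by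
      have : {x | ∀ i ∈ s, ε ≤ ℓ i x} = ⋂ i ∈ s, {x | ε ≤ ℓ i x} := by ext x; simp
      rw [this]
      exact isClosed_biInter fun i _ => isClosed_le continuous_const (continuous_affine _)
    have hsub : {x | ∀ i ∈ s, ε ≤ ℓ i x} ⊆ U := by
      rw [hU]; exact fun x hx i hi => hε.trans_le (hx i hi)
    have hsupp : tsupport (χ ε) ⊆ {x | ∀ i ∈ s, ε ≤ ℓ i x} := by
      refine closure_minimal (fun x hx i hi => ?_) hcl
      by_contra! h
      refine hx (Finset.prod_eq_zero hi (cutoff_of_le ?_))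
      rw [div_le_one hε]; exact h.le
    exact ⟨contDiff_prod fun i _ => hcc ε i,
      hPc.of_isClosed_subset (isClosed_tsupport _) (hsupp.trans (hsub.trans hUP)),
      hsupp.trans hsub⟩
  have hfd : ∀ ε x, 0 < ε → fderiv ℝ (χ ε) x (g x) =
      ∑ i ∈ s, ε⁻¹ * deriv cutoff (ℓ i x / ε) *
        ((∏ j ∈ s.erase i, cutoff (ℓ j x / ε)) * inner ℝ (g x) (affGrad (ℓ i))) := by
    intro ε x hε
    have h1 : ∀ i ∈ s, HasFDerivAt (fun x => cutoff (ℓ i x / ε))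
        ((deriv cutoff (ℓ i x / ε) * ε⁻¹) •
          InnerProductSpace.toDual ℝ (E d) (affGrad (ℓ i))) x := by
      intro i _
      have h := (hasGradientAt_affine (ℓ i) x).hasFDerivAt.mul_const ε⁻¹
      have h2 := ((contDiff_cutoff.differentiable (by simp)).differentiableAt
        (x := ℓ i x / ε)).hasDerivAt.comp_hasFDerivAt x (f := fun x => ℓ i x / ε)
        (by simpa only [div_eq_mul_inv] using h)
      rw [smul_smul] at h2
      exact h2
    have h2 := HasFDerivAt.finsetProd h1
    rw [h2.fderiv]
    simp only [FunLike.coe_sum, Finset.sum_apply, smul_apply,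
      InnerProductSpace.toDual_apply_apply, smul_eq_mul]
    refine Finset.sum_congr rfl fun i _ => ?_
    rw [real_inner_comm (g x)]
    ring
  -- a term vanishes outside the polytope
  have hterm : ∀ ε x i, 0 < ε → i ∈ s → x ∉ U → deriv cutoff (ℓ i x / ε) *
        (∏ j ∈ s.erase i, cutoff (ℓ j x / ε)) = 0 := by
    intro ε x i hε hi hx
    rw [hU] at hx
    simp only [mem_ofPred_eq, not_forall, not_lt] at hx
    obtain ⟨j, hj, hjx⟩ := hx
    have hle : ℓ j x / ε ≤ 0 := div_nonpos_of_nonpos_of_nonneg hjx hε.le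
    by_cases hji : j = i
    · subst hji
      rw [deriv_cutoff_eq_zero _ fun h => by linarith [h.1], zero_mul]
    · rw [Finset.prod_eq_zero (Finset.mem_erase.2 ⟨hji, hj⟩) (cutoff_of_le (by linarith)), mul_zero]
  set K : ι → ℝ → E d → ℝ := fun i ε x =>
    (∏ j ∈ s.erase i, cutoff (ℓ j x / ε)) * inner ℝ (g0 x) (affGrad (ℓ i)) with hK
  have hprod01 : ∀ i ε x, |∏ j ∈ s.erase i, cutoff (ℓ j x / ε)| ≤ 1 := by
    intro i ε x
    rw [abs_of_nonneg (Finset.prod_nonneg fun j _ => cutoff_nonneg _)]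
    exact Finset.prod_le_one (fun j _ => cutoff_nonneg _) fun j _ => cutoff_le_one _
  have hKbd : ∀ i ∈ s, ∀ ε x, |K i ε x| ≤ max C 0 := by
    intro i hi ε x
    rw [hK]
    simp only [abs_mul]
    calc _ ≤ 1 * (‖g0 x‖ * ‖affGrad (ℓ i)‖) := by
          gcongr
          · exact hprod01 i ε x
          · exact abs_real_inner_le_norm _ _
      _ ≤ max C 0 := by rw [hunit i hi, one_mul, mul_one]; exact hg0C x
  have hKm : ∀ i ε, Measurable (K i ε) := by
    intro i ε
    refine Measurable.mul ?_ (hg0m.inner measurable_const)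
    exact Finset.measurable_prod _ fun j _ => (hcc ε j).continuous.measurable
  have hzero : ∀ i ∈ s, ∃ p, ℓ i p = 0 := by
    intro i hi
    refine ⟨-(ℓ i 0) • affGrad (ℓ i), ?_⟩
    have := affine_add_apply (ℓ i) 0 (-(ℓ i 0) • affGrad (ℓ i))
    rw [zero_add] at this
    rw [this, inner_smul_right, real_inner_self_eq_norm_sq, hunit i hi]
    ring
  have hPb : ∀ p, ∃ R, ∀ x ∈ P, ‖x - p‖ ≤ R := by
    intro p
    obtain ⟨R, hR⟩ := hPc.isBounded.subset_closedBall p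
    exact ⟨R, fun x hx => by simpa [dist_eq_norm] using hR hx⟩
  have hlim : ∀ i ∈ s, Tendsto
      (fun ε => ∫ x, ε⁻¹ * deriv cutoff (ℓ i x / ε) * K i ε x) (𝓝[>] 0)
      (𝓝 (∫ x in P ∩ {x | ℓ i x = 0}, inner ℝ (g x) (affGrad (ℓ i)) ∂μHE[d - 1])) := by
    intro i hi
    obtain ⟨p, hp⟩ := hzero i hi
    obtain ⟨R, hR⟩ := hPb p
    set n := affGrad (ℓ i) with hn
    have hℓ : ∀ x, inner ℝ n (x - p) = ℓ i x := fun x => by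
      rw [← affine_sub_eq, hp, sub_zero]
    have key := tendsto_layer n (hunit i hi) p continuous_deriv_cutoff deriv_cutoff_eq_zero
      integral_deriv_cutoff (K := K i) (k := fun x => inner ℝ (g0 x) n) (R := R)
      (fun ε _ => hKm i ε) (fun ε _ => hKbd i hi ε) ?_ ?_
    · simp only [hℓ] at key
      convert key using 2
      rw [← setIntegral_hyperplane n (hunit i hi) p (fun x => inner ℝ (g0 x) n), inter_comm]
      simp only [hℓ]
      rw [← setIntegral_indicator hPm]
      refine integral_congr_ae (Eventually.of_forall fun x => ?_)
      by_cases hx : x ∈ P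
      · simp [hg0, hx]
      · simp [hg0, hx]
    · intro ε _ x hx
      have : x ∉ P := fun h => not_lt.2 (hR x h) hx
      simp [hK, hg0, this]
    · have hne : ∀ᵐ y : (ℝ ∙ n)ᗮ, ∀ j ∈ s, j ≠ i → ℓ j (y + p) ≠ 0 := by
        rw [Finset.eventually_all]
        intro j hj
        by_cases hji : j = i
        · simp [hji]
        obtain ⟨q, hq1, hq2⟩ := hdist i hi j hj (Ne.symm hji)
        filter_upwards [ae_ne_zero_of_exists n p (ℓ j) ⟨q, by rw [hℓ, hq1], hq2⟩] with y hy _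
          using hy
      filter_upwards [hne] with y hy τ hτ
      have hiy : ∀ t : ℝ, ℓ i (y + p + t • n) = t := by
        intro t
        rw [← hℓ, show (y : E d) + p + t • n - p = y + t • n by abel, inner_add_right,
          inner_coe_orthogonal, inner_smul_right, real_inner_self_eq_norm_sq, hunit i hi]
        ring
      have hx : Tendsto (fun ε : ℝ => (y : E d) + p + (ε * τ) • n) (𝓝[>] 0) (𝓝 (y + p)) := by
        have : Continuous fun ε : ℝ => (y : E d) + p + (ε * τ) • n := by fun_prop
        have h := this.tendsto 0
        simp only [zero_mul, zero_smul, add_zero] at h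
        exact h.mono_left nhdsWithin_le_nhds
      have hiy0 : ℓ i (y + p) = 0 := by simpa using hiy 0
      by_cases hpos : ∀ j ∈ s, j ≠ i → 0 < ℓ j (y + p)
      · have hyP : (y : E d) + p ∈ P := by
          rw [hP]
          intro j hj
          by_cases hji : j = i
          · rw [hji, hiy0]
          · exact (hpos j hj hji).le
        have hev : ∀ᶠ ε in 𝓝[>] (0 : ℝ), ∀ j ∈ s, j ≠ i →
            2 ≤ ℓ j (y + p + (ε * τ) • n) / ε := by
          rw [Finset.eventually_all]
          intro j hj
          by_cases hji : j = i
          · simp [hji]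
          have h1 := ((continuous_affine (ℓ j)).tendsto _).comp hx
          have h2 : Tendsto (fun ε : ℝ => 2 * ε) (𝓝[>] 0) (𝓝 0) := by
            have : Tendsto (fun ε : ℝ => 2 * ε) (𝓝 0) (𝓝 (2 * 0)) :=
              (continuous_const_mul (2 : ℝ)).tendsto 0
            rw [mul_zero] at this
            exact this.mono_left nhdsWithin_le_nhds
          filter_upwards [h2.eventually_lt h1 (hpos j hj hji), self_mem_nhdsWithin]
            with ε hε hε0 _
          rw [le_div_iff₀ hε0]
          exact hε.le
        have hin : ∀ᶠ ε in 𝓝[>] (0 : ℝ), (y : E d) + p + (ε * τ) • n ∈ P := by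
          filter_upwards [hev, self_mem_nhdsWithin] with ε hε hε0
          rw [hP]
          intro j hj
          by_cases hji : j = i
          · rw [hji, hiy]; exact (mul_pos hε0 hτ).le
          · have := hε j hj hji
            rw [le_div_iff₀ hε0] at this
            exact le_trans (mul_nonneg zero_le_two (le_of_lt hε0)) this
        have hgl : Tendsto (fun ε : ℝ => inner ℝ (g (y + p + (ε * τ) • n)) n) (𝓝[>] 0)
            (𝓝 (inner ℝ (g (y + p)) n)) := by
          refine Tendsto.inner ?_ tendsto_const_nhds
          exact (hg _ hyP).tendsto.comp (tendsto_nhdsWithin_iff.2 ⟨hx, hin⟩)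
        rw [show g0 (y + p) = g (y + p) by rw [hg0, indicator_of_mem hyP]]
        refine hgl.congr' ?_
        filter_upwards [hev, hin] with ε hε hεP
        rw [hK]
        simp only
        rw [Finset.prod_eq_one fun j hj => cutoff_of_ge
          (hε j (Finset.mem_of_mem_erase hj) (Finset.ne_of_mem_erase hj)), one_mul,
          show g0 (y + p + (ε * τ) • n) = _ from indicator_of_mem hεP g]
      · push Not at hpos
        obtain ⟨j, hj, hji, hle⟩ := hpos
        have hlt : ℓ j (y + p) < 0 := lt_of_le_of_ne hle (hy j hj hji)
        have hyP : (y : E d) + p ∉ P := by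
          rw [hP]; exact fun h => absurd (h j hj) (not_le.2 hlt)
        rw [show g0 (y + p) = 0 from indicator_of_notMem hyP g, inner_zero_left]
        refine tendsto_const_nhds.congr' ?_
        have h1 := ((continuous_affine (ℓ j)).tendsto _).comp hx
        filter_upwards [h1.eventually_lt_const hlt, self_mem_nhdsWithin] with ε hε hε0
        rw [hK]
        simp only
        have hle1 := (div_nonpos_of_nonpos_of_nonneg (le_of_lt hε) (le_of_lt hε0)).trans zero_le_one
        rw [Finset.prod_eq_zero (Finset.mem_erase.2 ⟨hji, hj⟩) (cutoff_of_le hle1), zero_mul]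
  have hL : Tendsto (fun ε => ∫ x in U, inner ℝ (g x) (gradient (χ ε) x)) (𝓝[>] 0)
      (𝓝 (∑ i ∈ s, ∫ x in P ∩ {x | ℓ i x = 0}, inner ℝ (g x) (affGrad (ℓ i)) ∂μHE[d - 1])) := by
    refine (tendsto_finsetSum s hlim).congr' ?_
    filter_upwards [self_mem_nhdsWithin] with ε hε
    have hε : 0 < ε := hε
    have hdc : ∀ i, Continuous fun x => deriv cutoff (ℓ i x / ε) := fun i =>
      continuous_deriv_cutoff.comp ((continuous_affine _).div_const _)
    obtain ⟨Cη, hCη⟩ : ∃ Cη, ∀ t, |deriv cutoff t| ≤ Cη := by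
      have hcs : HasCompactSupport (deriv cutoff) :=
        HasCompactSupport.intro isCompact_Icc fun t ht => deriv_cutoff_eq_zero t ht
      obtain ⟨c, hc⟩ := hcs.exists_bound_of_continuous continuous_deriv_cutoff
      exact ⟨c, fun t => by simpa using hc t⟩
    have hint : ∀ i ∈ s, IntegrableOn (fun x => ε⁻¹ * deriv cutoff (ℓ i x / ε) * K i ε x) P := by
      intro i hi
      refine Measure.integrableOn_of_bounded (M := ε⁻¹ * Cη * max C 0) hPc.measure_lt_top.ne
        ((((hdc i).measurable.const_mul _).mul (hKm i ε)).aestronglyMeasurable) ?_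
      refine Eventually.of_forall fun x => ?_
      rw [Real.norm_eq_abs, abs_mul, abs_mul, abs_of_pos (inv_pos.2 hε)]
      gcongr
      · exact mul_nonneg (inv_nonneg.2 hε.le) ((abs_nonneg _).trans (hCη 0))
      · exact hCη _
      · exact hKbd i hi ε x
    have hz : ∀ i ∈ s, ∀ x, x ∉ U → ε⁻¹ * deriv cutoff (ℓ i x / ε) * K i ε x = 0 := by
      intro i hi x hx
      rw [hK]
      simp only
      rw [mul_assoc, ← mul_assoc (deriv cutoff _), hterm ε x i hε hi hx]
      ring
    have : ∀ i ∈ s, ∫ x, ε⁻¹ * deriv cutoff (ℓ i x / ε) * K i ε x =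
        ∫ x in U, ε⁻¹ * deriv cutoff (ℓ i x / ε) * K i ε x := fun i hi =>
      (setIntegral_eq_integral_of_forall_compl_eq_zero (hz i hi)).symm
    rw [Finset.sum_congr rfl this, ← integral_finsetSum]
    · refine setIntegral_congr_fun hUo.measurableSet fun x hx => ?_
      rw [inner_gradient, hfd ε x hε]
      refine Finset.sum_congr rfl fun i _ => ?_
      rw [hK]
      simp only
      rw [show g0 x = g x from indicator_of_mem (hUP hx) g]
    · exact fun i hi => (hint i hi).mono_set hUP
  have hR : Tendsto (fun ε => -∫ x in U, χ ε x * D x) (𝓝[>] 0) (𝓝 (-∫ x in U, D x)) := by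
    refine Tendsto.neg ?_
    refine tendsto_integral_filter_of_dominated_convergence (fun x => |D x|) ?_ ?_ hDi.abs ?_
    · filter_upwards with ε
      exact (contDiff_prod fun i _ => hcc ε i).continuous.aestronglyMeasurable.mul
        hDi.aestronglyMeasurable
    · filter_upwards with ε
      refine Eventually.of_forall fun x => ?_
      rw [norm_mul, Real.norm_eq_abs, Real.norm_eq_abs]
      refine mul_le_of_le_one_left (abs_nonneg _) ?_
      rw [hχ]
      simp only
      rw [abs_of_nonneg (Finset.prod_nonneg fun j _ => cutoff_nonneg _)]
      exact Finset.prod_le_one (fun j _ => cutoff_nonneg _) fun j _ => cutoff_le_one _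
    · filter_upwards [ae_restrict_mem hUo.measurableSet] with x hx
      refine tendsto_const_nhds.congr' ?_
      rw [hU] at hx
      have hev : ∀ᶠ ε in 𝓝[>] (0 : ℝ), ∀ j ∈ s, 2 ≤ ℓ j x / ε := by
        rw [Finset.eventually_all]
        intro j hj
        have : Iio (ℓ j x / 2) ∈ 𝓝[>] (0 : ℝ) :=
          mem_nhdsWithin_of_mem_nhds (Iio_mem_nhds (half_pos (hx j hj)))
        filter_upwards [this, self_mem_nhdsWithin] with ε hε hε0
        rw [le_div_iff₀ hε0]
        have : ε < ℓ j x / 2 := hε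
        linarith
      filter_upwards [hev] with ε hε
      rw [hχ]
      simp only
      rw [Finset.prod_eq_one fun j hj => cutoff_of_ge (hε j hj), one_mul]
  have heq : (fun ε => ∫ x in U, inner ℝ (g x) (gradient (χ ε) x)) =ᶠ[𝓝[>] 0]
      fun ε => -∫ x in U, χ ε x * D x := by
    filter_upwards [self_mem_nhdsWithin] with ε hε using hD.2.2 _ (hχt ε hε)
  have := tendsto_nhds_unique (hL.congr' heq) hR
  rw [this, neg_neg]

/-- The divergence theorem on a bounded polytope: the polytope is given by finitely many affine
inequalities whose boundary hyperplanes are distinct. -/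
theorem divergence_polytope {ι : Type*} (s : Finset ι) (ℓ : ι → E d →ᵃ[ℝ] ℝ)
    (hne : ∀ i ∈ s, affGrad (ℓ i) ≠ 0)
    (hdist : ∀ i ∈ s, ∀ j ∈ s, i ≠ j → ∃ q, ℓ i q = 0 ∧ ℓ j q ≠ 0)
    {P U : Set (E d)} (hP : P = {x | ∀ i ∈ s, 0 ≤ ℓ i x}) (hU : U = {x | ∀ i ∈ s, 0 < ℓ i x})
    (hPc : IsCompact P) {g : E d → E d} (hg : ContinuousOn g P) {D : E d → ℝ}
    (hD : HasWeakDiv U g D) (hDi : IntegrableOn D U) :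
    ∫ x in U, D x =
      ∑ i ∈ s, ∫ x in P ∩ {x | ℓ i x = 0}, inner ℝ (g x) (outN (ℓ i)) ∂μHE[d - 1] := by
  classical
  have hpos : ∀ i ∈ s, 0 < ‖affGrad (ℓ i)‖⁻¹ := fun i hi =>
    inv_pos.2 (norm_pos_iff.2 (hne i hi))
  have h := divergence_polytope_unit s (fun i => ‖affGrad (ℓ i)‖⁻¹ • ℓ i)
    (fun i hi => by
      rw [affGrad_smul, norm_smul, norm_inv, norm_norm]
      exact inv_mul_cancel₀ (norm_ne_zero_iff.2 (hne i hi)))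
    (fun i hi j hj hij => by
      obtain ⟨q, h1, h2⟩ := hdist i hi j hj hij
      refine ⟨q, ?_, ?_⟩
      · simp [h1]
      · simpa [h2] using hne j hj)
    (P := P) (U := U)
    (by
      rw [hP]; ext x
      refine forall₂_congr fun i hi => ?_
      simp [mul_nonneg_iff_of_pos_left (hpos i hi)])
    (by
      rw [hU]; ext x
      refine forall₂_congr fun i hi => ?_
      simp only [AffineMap.coe_smul, Pi.smul_apply, smul_eq_mul]
      exact (mul_pos_iff_of_pos_left (hpos i hi)).symm)
    hPc hg hD hDi
  rw [h, ← Finset.sum_neg_distrib]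
  refine Finset.sum_congr rfl fun i hi => ?_
  rw [← integral_neg]
  have e : {x | (‖affGrad (ℓ i)‖⁻¹ • ℓ i) x = 0} = {x | ℓ i x = 0} := by
    ext x
    simp [hne i hi]
  rw [e]
  refine integral_congr_ae (Eventually.of_forall fun x => ?_)
  simp only [outN, affGrad_smul, inner_neg_right]

end Divergence

/-! ### Calculus of weak derivatives -/

section WeakCalculus

open Filter Topology

variable {d : ℕ} {U V : Set (E d)}

lemma gradient_apply_eq_zero {φ : E d → ℝ} {x : E d} (hx : x ∉ tsupport φ) :
    gradient φ x = 0 := by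
  have : fderiv ℝ φ x = 0 := by
    by_contra h
    exact hx (support_fderiv_subset ℝ h)
  rw [gradient, this, map_zero]

lemma continuous_gradient {φ : E d → ℝ} (hφ : ContDiff ℝ ∞ φ) : Continuous (gradient φ) :=
  (InnerProductSpace.toDual ℝ (E d)).symm.continuous.comp (hφ.continuous_fderiv (by simp))

lemma gradient_mul {φ ψ : E d → ℝ} (hφ : ContDiff ℝ ∞ φ) (hψ : ContDiff ℝ ∞ ψ) (x : E d) :
    gradient (fun x => φ x * ψ x) x = φ x • gradient ψ x + ψ x • gradient φ x := by
  have h1 := (hφ.differentiable (by simp)).differentiableAt (x := x)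
  have h2 := (hψ.differentiable (by simp)).differentiableAt (x := x)
  simp only [gradient]
  rw [fderiv_fun_mul h1 h2]
  simp

lemma IsTestFun.mono {φ : E d → ℝ} (h : IsTestFun V φ) (hVU : V ⊆ U) : IsTestFun U φ :=
  ⟨h.1, h.2.1, h.2.2.trans hVU⟩

lemma IsTestFun.mul_smooth {φ ψ : E d → ℝ} (h : IsTestFun U φ) (hψ : ContDiff ℝ ∞ ψ) :
    IsTestFun U fun x => φ x * ψ x :=
  ⟨h.1.mul hψ, h.2.1.mul_right, (tsupport_mul_subset_left).trans h.2.2⟩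

/-- A locally integrable function is integrable against continuous functions with compact
support. -/
lemma integrable_smul_of_tsupport {F : Type*} [NormedAddCommGroup F] [NormedSpace ℝ F]
    {f : E d → F} (hf : LocallyIntegrableOn f U) {φ : E d → ℝ} (hφ : Continuous φ)
    (hc : HasCompactSupport φ) (hs : tsupport φ ⊆ U) : Integrable fun x => φ x • f x := by
  have h1 : IntegrableOn f (tsupport φ) := hf.integrableOn_compact_subset hs hc
  have h2 : IntegrableOn (fun x => φ x • f x) (tsupport φ) :=
    h1.continuousOn_smul hφ.continuousOn hc
  refine h2.integrable_of_forall_notMem_eq_zero fun x hx => ?_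
  rw [image_eq_zero_of_notMem_tsupport hx, zero_smul]

lemma integrable_smul_gradient {f : E d → ℝ} (hf : LocallyIntegrableOn f U) {φ : E d → ℝ}
    (h : IsTestFun U φ) : Integrable fun x => f x • gradient φ x := by
  have h1 : IntegrableOn f (tsupport φ) := hf.integrableOn_compact_subset h.2.2 h.2.1
  have h2 : IntegrableOn (fun x => f x • gradient φ x) (tsupport φ) :=
    h1.smul_continuousOn (continuous_gradient h.1).continuousOn h.2.1
  refine h2.integrable_of_forall_notMem_eq_zero fun x hx => ?_
  rw [gradient_apply_eq_zero hx, smul_zero]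

lemma integrable_inner_gradient {g : E d → E d} (hg : LocallyIntegrableOn g U) {φ : E d → ℝ}
    (h : IsTestFun U φ) : Integrable fun x => inner ℝ (g x) (gradient φ x) := by
  have h1 : IntegrableOn g (tsupport φ) := hg.integrableOn_compact_subset h.2.2 h.2.1
  obtain ⟨C, hC⟩ := IsCompact.exists_bound_of_continuousOn (s := tsupport φ) h.2.1
    (continuous_gradient h.1).continuousOn
  have h2 : IntegrableOn (fun x => inner ℝ (g x) (gradient φ x)) (tsupport φ) := by
    refine (h1.norm.mul_const C).mono'
      (h1.aestronglyMeasurable.inner (continuous_gradient h.1).aestronglyMeasurable) ?_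
    filter_upwards [ae_restrict_mem (isClosed_tsupport φ).measurableSet] with x hx
    exact (norm_inner_le_norm _ _).trans (mul_le_mul_of_nonneg_left (hC x hx) (norm_nonneg _))
  refine h2.integrable_of_forall_notMem_eq_zero fun x hx => ?_
  rw [gradient_apply_eq_zero hx, inner_zero_right]

lemma IsTestFun.setIntegral_gradient_eq {F : Type*} [NormedAddCommGroup F] [NormedSpace ℝ F]
    {φ : E d → ℝ} (h : IsTestFun U φ) {f : E d → F}
    (hf : ∀ x, x ∉ tsupport φ → f x = 0) : ∫ x in U, f x = ∫ x, f x :=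
  setIntegral_eq_integral_of_forall_compl_eq_zero fun x hx => hf x fun hx' => hx (h.2.2 hx')

lemma HasWeakGrad.mono {u : E d → ℝ} {G : E d → E d} (h : HasWeakGrad U u G) (hVU : V ⊆ U) :
    HasWeakGrad V u G := by
  refine ⟨h.1.mono_set hVU, h.2.1.mono_set hVU, fun φ hφ => ?_⟩
  have := h.2.2 φ (hφ.mono hVU)
  rw [(hφ.mono hVU).setIntegral_gradient_eq fun x hx => by rw [gradient_apply_eq_zero hx, smul_zero],
    (hφ.mono hVU).setIntegral_gradient_eq
      fun x hx => by rw [image_eq_zero_of_notMem_tsupport hx, zero_smul]] at this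
  rw [hφ.setIntegral_gradient_eq fun x hx => by rw [gradient_apply_eq_zero hx, smul_zero],
    hφ.setIntegral_gradient_eq
      fun x hx => by rw [image_eq_zero_of_notMem_tsupport hx, zero_smul], this]

lemma HasWeakDiv.mono {g : E d → E d} {D : E d → ℝ} (h : HasWeakDiv U g D) (hVU : V ⊆ U) :
    HasWeakDiv V g D := by
  refine ⟨h.1.mono_set hVU, h.2.1.mono_set hVU, fun φ hφ => ?_⟩
  have := h.2.2 φ (hφ.mono hVU)
  rw [(hφ.mono hVU).setIntegral_gradient_eq
      fun x hx => by rw [gradient_apply_eq_zero hx, inner_zero_right],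
    (hφ.mono hVU).setIntegral_gradient_eq
      fun x hx => by rw [image_eq_zero_of_notMem_tsupport hx, zero_mul]] at this
  rw [hφ.setIntegral_gradient_eq fun x hx => by rw [gradient_apply_eq_zero hx, inner_zero_right],
    hφ.setIntegral_gradient_eq
      fun x hx => by rw [image_eq_zero_of_notMem_tsupport hx, zero_mul], this]

lemma locallyIntegrableOn_congr_ae {F : Type*} [NormedAddCommGroup F] {f f' : E d → F}
    (hU : IsOpen U) (hf : LocallyIntegrableOn f U) (h : f =ᵐ[volume.restrict U] f') :
    LocallyIntegrableOn f' U := by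
  rw [locallyIntegrableOn_iff hU.isLocallyClosed] at hf ⊢
  intro k hk hkc
  exact (hf k hk hkc).congr_fun_ae (ae_restrict_of_ae_restrict_of_subset hk h)

lemma HasWeakGrad.congr (hU : IsOpen U) {u u' : E d → ℝ} {G G' : E d → E d}
    (h : HasWeakGrad U u G)
    (hu : u =ᵐ[volume.restrict U] u') (hG : G =ᵐ[volume.restrict U] G') :
    HasWeakGrad U u' G' := by
  refine ⟨locallyIntegrableOn_congr_ae hU h.1 hu, locallyIntegrableOn_congr_ae hU h.2.1 hG,
    fun φ hφ => ?_⟩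
  have e1 : ∫ x in U, u' x • gradient φ x = ∫ x in U, u x • gradient φ x :=
    integral_congr_ae (by filter_upwards [hu] with x hx; rw [hx])
  have e2 : ∫ x in U, φ x • G' x = ∫ x in U, φ x • G x :=
    integral_congr_ae (by filter_upwards [hG] with x hx; rw [hx])
  rw [e1, e2, h.2.2 φ hφ]

lemma HasWeakDiv.congr (hU : IsOpen U) {g g' : E d → E d} {D D' : E d → ℝ}
    (h : HasWeakDiv U g D)
    (hg : g =ᵐ[volume.restrict U] g') (hD : D =ᵐ[volume.restrict U] D') :
    HasWeakDiv U g' D' := by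
  refine ⟨locallyIntegrableOn_congr_ae hU h.1 hg, locallyIntegrableOn_congr_ae hU h.2.1 hD,
    fun φ hφ => ?_⟩
  have e1 : ∫ x in U, inner ℝ (g' x) (gradient φ x) = ∫ x in U, inner ℝ (g x) (gradient φ x) :=
    integral_congr_ae (by filter_upwards [hg] with x hx; rw [hx])
  have e2 : ∫ x in U, φ x * D' x = ∫ x in U, φ x * D x :=
    integral_congr_ae (by filter_upwards [hD] with x hx; rw [hx])
  rw [e1, e2, h.2.2 φ hφ]

/-- The fundamental lemma of the calculus of variations for two locally integrable functions. -/
lemma ae_eq_of_test {F : Type*} [NormedAddCommGroup F] [NormedSpace ℝ F] [CompleteSpace F]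
    (hU : IsOpen U) {f f' : E d → F} (hf : LocallyIntegrableOn f U)
    (hf' : LocallyIntegrableOn f' U)
    (h : ∀ φ, IsTestFun U φ → ∫ x in U, φ x • f x = ∫ x in U, φ x • f' x) :
    f =ᵐ[volume.restrict U] f' := by
  have key := hU.ae_eq_zero_of_integral_contDiff_smul_eq_zero (μ := volume) (hf.sub hf') ?_
  · rw [EventuallyEq, ae_restrict_iff' hU.measurableSet]
    filter_upwards [key] with x hx hxU
    exact sub_eq_zero.1 (hx hxU)
  · intro φ h1 h2 h3
    have hφ : IsTestFun U φ := ⟨h1, h2, h3⟩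
    have := h φ hφ
    rw [hφ.setIntegral_gradient_eq
        fun x hx => by rw [image_eq_zero_of_notMem_tsupport hx, zero_smul],
      hφ.setIntegral_gradient_eq
        fun x hx => by rw [image_eq_zero_of_notMem_tsupport hx, zero_smul]] at this
    simp only [Pi.sub_apply, smul_sub]
    rw [integral_sub (integrable_smul_of_tsupport hf h1.continuous h2 h3)
      (integrable_smul_of_tsupport hf' h1.continuous h2 h3), this, sub_self]

lemma HasWeakGrad.unique (hU : IsOpen U) {u : E d → ℝ} {G G' : E d → E d}
    (h : HasWeakGrad U u G) (h' : HasWeakGrad U u G') : G =ᵐ[volume.restrict U] G' :=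
  ae_eq_of_test hU h.2.1 h'.2.1 fun φ hφ => by
    rw [← neg_inj, ← h.2.2 φ hφ, ← h'.2.2 φ hφ]

lemma HasWeakDiv.unique (hU : IsOpen U) {g : E d → E d} {D D' : E d → ℝ}
    (h : HasWeakDiv U g D) (h' : HasWeakDiv U g D') : D =ᵐ[volume.restrict U] D' :=
  ae_eq_of_test hU h.2.1 h'.2.1 fun φ hφ => by
    simp only [smul_eq_mul]
    rw [← neg_inj, ← h.2.2 φ hφ, ← h'.2.2 φ hφ]

lemma HasWeakGrad.weakGrad_ae_eq (hU : IsOpen U) {u : E d → ℝ} {G : E d → E d}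
    (h : HasWeakGrad U u G) : weakGrad U u =ᵐ[volume.restrict U] G := by
  have hex : ∃ G, HasWeakGrad U u G := ⟨G, h⟩
  rw [weakGrad, dif_pos hex]
  exact hex.choose_spec.unique hU h

lemma HasWeakDiv.weakDiv_ae_eq (hU : IsOpen U) {g : E d → E d} {D : E d → ℝ}
    (h : HasWeakDiv U g D) : weakDiv U g =ᵐ[volume.restrict U] D := by
  have hex : ∃ D, HasWeakDiv U g D := ⟨D, h⟩
  rw [weakDiv, dif_pos hex]
  exact hex.choose_spec.unique hU h

lemma HasWeakGrad.add {u u' : E d → ℝ} {G G' : E d → E d} (h : HasWeakGrad U u G)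
    (h' : HasWeakGrad U u' G') :
    HasWeakGrad U (fun x => u x + u' x) (fun x => G x + G' x) := by
  refine ⟨h.1.add h'.1, h.2.1.add h'.2.1, fun φ hφ => ?_⟩
  simp only [add_smul, smul_add]
  rw [integral_add (integrable_smul_gradient h.1 hφ).integrableOn
      (integrable_smul_gradient h'.1 hφ).integrableOn,
    integral_add (integrable_smul_of_tsupport h.2.1 hφ.1.continuous hφ.2.1 hφ.2.2).integrableOn
      (integrable_smul_of_tsupport h'.2.1 hφ.1.continuous hφ.2.1 hφ.2.2).integrableOn,
    h.2.2 φ hφ, h'.2.2 φ hφ, neg_add]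

lemma LocallyIntegrableOn.const_smul' {F : Type*} [NormedAddCommGroup F] [NormedSpace ℝ F]
    {f : E d → F} (hf : LocallyIntegrableOn f U) (c : ℝ) :
    LocallyIntegrableOn (fun x => c • f x) U := fun x hx => by
  obtain ⟨s, hs, hi⟩ := hf x hx
  exact ⟨s, hs, hi.smul c⟩

lemma HasWeakGrad.const_mul {u : E d → ℝ} {G : E d → E d} (h : HasWeakGrad U u G) (c : ℝ) :
    HasWeakGrad U (fun x => c * u x) (fun x => c • G x) := by
  refine ⟨LocallyIntegrableOn.const_smul' h.1 c, LocallyIntegrableOn.const_smul' h.2.1 c,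
    fun φ hφ => ?_⟩
  simp only [mul_smul, smul_comm _ c]
  rw [integral_smul, integral_smul, h.2.2 φ hφ, smul_neg]

lemma HasWeakGrad.sub {u u' : E d → ℝ} {G G' : E d → E d} (h : HasWeakGrad U u G)
    (h' : HasWeakGrad U u' G') :
    HasWeakGrad U (fun x => u x - u' x) (fun x => G x - G' x) := by
  have := h.add (h'.const_mul (-1))
  simpa [sub_eq_add_neg] using this

lemma LocallyIntegrableOn.smooth_smul {F : Type*} [NormedAddCommGroup F] [NormedSpace ℝ F]
    (hU : IsOpen U) {f : E d → F} (hf : LocallyIntegrableOn f U) {ψ : E d → ℝ}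
    (hψ : Continuous ψ) : LocallyIntegrableOn (fun x => ψ x • f x) U := by
  rw [locallyIntegrableOn_iff hU.isLocallyClosed] at hf ⊢
  intro k hk hkc
  exact (hf k hk hkc).continuousOn_smul hψ.continuousOn hkc

lemma HasWeakGrad.smooth_mul (hU : IsOpen U) {u : E d → ℝ} {G : E d → E d}
    (h : HasWeakGrad U u G) {ψ : E d → ℝ} (hψ : ContDiff ℝ ∞ ψ) :
    HasWeakGrad U (fun x => ψ x * u x) (fun x => ψ x • G x + u x • gradient ψ x) := by
  have hl : LocallyIntegrableOn (fun x => u x • gradient ψ x) U := by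
    have h1 := h.1
    rw [locallyIntegrableOn_iff hU.isLocallyClosed] at h1 ⊢
    intro k hk hkc
    exact (h1 k hk hkc).smul_continuousOn (continuous_gradient hψ).continuousOn hkc
  have hl2 := LocallyIntegrableOn.smooth_smul hU h.2.1 hψ.continuous
  refine ⟨LocallyIntegrableOn.smooth_smul hU h.1 hψ.continuous, hl2.add hl, fun φ hφ => ?_⟩
  have key := h.2.2 _ (hφ.mul_smooth hψ)
  have i1 := integrable_smul_gradient h.1 (hφ.mul_smooth hψ)
  have i2 : Integrable fun x => φ x • (u x • gradient ψ x) :=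
    integrable_smul_of_tsupport hl hφ.1.continuous hφ.2.1 hφ.2.2
  have i3 : Integrable fun x => φ x • (ψ x • G x) :=
    integrable_smul_of_tsupport hl2 hφ.1.continuous hφ.2.1 hφ.2.2
  have e1 : ∀ x, (ψ x * u x) • gradient φ x =
      u x • gradient (fun x => φ x * ψ x) x - φ x • (u x • gradient ψ x) := by
    intro x
    rw [gradient_mul hφ.1 hψ, smul_add, smul_smul, smul_smul, smul_smul, mul_comm (u x) (φ x),
      add_sub_cancel_left, mul_comm]
  simp only [e1, smul_add]
  rw [integral_sub i1.integrableOn i2.integrableOn, key,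
    integral_add i3.integrableOn i2.integrableOn]
  simp only [mul_smul]
  abel

lemma HasWeakDiv.smooth_smul (hU : IsOpen U) {g : E d → E d} {D : E d → ℝ}
    (h : HasWeakDiv U g D) {ψ : E d → ℝ} (hψ : ContDiff ℝ ∞ ψ) :
    HasWeakDiv U (fun x => ψ x • g x) (fun x => ψ x * D x + inner ℝ (g x) (gradient ψ x)) := by
  have hl : LocallyIntegrableOn (fun x => inner ℝ (g x) (gradient ψ x)) U := by
    have h1 := h.1
    rw [locallyIntegrableOn_iff hU.isLocallyClosed] at h1 ⊢
    intro k hk hkc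
    obtain ⟨C, hC⟩ := hkc.exists_bound_of_continuousOn (continuous_gradient hψ).continuousOn
    refine ((h1 k hk hkc).norm.mul_const C).mono' ((h1 k hk hkc).aestronglyMeasurable.inner
      (continuous_gradient hψ).aestronglyMeasurable) ?_
    filter_upwards [ae_restrict_mem hkc.measurableSet] with x hx
    exact (norm_inner_le_norm _ _).trans (mul_le_mul_of_nonneg_left (hC x hx) (norm_nonneg _))
  have hl2 : LocallyIntegrableOn (fun x => ψ x * D x) U :=
    LocallyIntegrableOn.smooth_smul hU h.2.1 hψ.continuous
  refine ⟨LocallyIntegrableOn.smooth_smul hU h.1 hψ.continuous, hl2.add hl, fun φ hφ => ?_⟩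
  have key := h.2.2 _ (hφ.mul_smooth hψ)
  have i1 := integrable_inner_gradient h.1 (hφ.mul_smooth hψ)
  have i2 : Integrable fun x => φ x * inner ℝ (g x) (gradient ψ x) :=
    integrable_smul_of_tsupport hl hφ.1.continuous hφ.2.1 hφ.2.2
  have i3 : Integrable fun x => φ x * (ψ x * D x) :=
    integrable_smul_of_tsupport hl2 hφ.1.continuous hφ.2.1 hφ.2.2
  have e1 : ∀ x, inner ℝ (ψ x • g x) (gradient φ x) =
      inner ℝ (g x) (gradient (fun x => φ x * ψ x) x) - φ x * inner ℝ (g x) (gradient ψ x) := by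
    intro x
    rw [gradient_mul hφ.1 hψ, inner_add_right, inner_smul_right, inner_smul_right,
      real_inner_smul_left]
    ring
  simp only [e1, mul_add]
  rw [integral_sub i1.integrableOn i2.integrableOn, key,
    integral_add i3.integrableOn i2.integrableOn]
  simp only [mul_assoc]
  ring

lemma gradient_coord (φ : E d → ℝ) (x v : E d) :
    inner ℝ v (gradient φ x) = ∑ i, v i * gradient φ x i := by
  rw [PiLp.inner_apply]
  exact Finset.sum_congr rfl fun i _ => by simp [mul_comm]

/-- A field whose components have weak gradients has a weak divergence. -/
lemma hasWeakDiv_of_components {g : E d → E d} {G : Fin d → E d → E d}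
    (hg : LocallyIntegrableOn g U) (hD : LocallyIntegrableOn (fun x => ∑ i, G i x i) U)
    (h : ∀ i, HasWeakGrad U (fun x => g x i) (G i)) :
    HasWeakDiv U g (fun x => ∑ i, G i x i) := by
  refine ⟨hg, hD, fun φ hφ => ?_⟩
  have key : ∀ i, ∫ x in U, g x i * gradient φ x i = -∫ x in U, φ x * G i x i := by
    intro i
    have h1 := congrArg (EuclideanSpace.proj (𝕜 := ℝ) i) ((h i).2.2 φ hφ)
    rw [map_neg, ← ContinuousLinearMap.integral_comp_comm _
        (integrable_smul_gradient (h i).1 hφ).integrableOn,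
      ← ContinuousLinearMap.integral_comp_comm _ (integrable_smul_of_tsupport (h i).2.1
        hφ.1.continuous hφ.2.1 hφ.2.2).integrableOn] at h1
    simpa using h1
  have i1 : ∀ i, IntegrableOn (fun x => g x i * gradient φ x i) U := by
    intro i
    have := (EuclideanSpace.proj (𝕜 := ℝ) i).integrable_comp
      (integrable_smul_gradient (h i).1 hφ)
    simpa using this.integrableOn
  have i2 : ∀ i, IntegrableOn (fun x => φ x * G i x i) U := by
    intro i
    have := (EuclideanSpace.proj (𝕜 := ℝ) i).integrable_comp
      (integrable_smul_of_tsupport (h i).2.1 hφ.1.continuous hφ.2.1 hφ.2.2)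
    simpa using this.integrableOn
  simp only [gradient_coord, Finset.mul_sum]
  rw [integral_finsetSum _ fun i _ => i1 i, integral_finsetSum _ fun i _ => i2 i,
    ← Finset.sum_neg_distrib]
  exact Finset.sum_congr rfl fun i _ => key i

/-- Smooth functions have their classical gradient as weak gradient. -/
lemma hasWeakGrad_of_contDiff (U : Set (E d)) {u : E d → ℝ} (hu : ContDiff ℝ ∞ u) :
    HasWeakGrad U u (gradient u) := by
  refine ⟨hu.continuous.locallyIntegrable.locallyIntegrableOn _,
    (continuous_gradient hu).locallyIntegrable.locallyIntegrableOn _, fun φ hφ => ?_⟩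
  have hul : LocallyIntegrableOn u U := hu.continuous.locallyIntegrable.locallyIntegrableOn _
  have hgl : LocallyIntegrableOn (gradient u) U :=
    (continuous_gradient hu).locallyIntegrable.locallyIntegrableOn _
  rw [hφ.setIntegral_gradient_eq fun x hx => by rw [gradient_apply_eq_zero hx, smul_zero],
    hφ.setIntegral_gradient_eq
      fun x hx => by rw [image_eq_zero_of_notMem_tsupport hx, zero_smul]]
  have i1 := integrable_smul_gradient hul hφ
  have i2 := integrable_smul_of_tsupport hgl hφ.1.continuous hφ.2.1 hφ.2.2
  have i3 := integrable_smul_of_tsupport hul hφ.1.continuous hφ.2.1 hφ.2.2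
  refine ext_inner_left ℝ fun v => ?_
  rw [inner_neg_right, ← integral_inner i1, ← integral_inner i2]
  simp only [inner_smul_right, inner_gradient]
  rw [integral_mul_fderiv_eq_neg_fderiv_mul_of_integrable (μ := volume) (f := u) (g := φ) (v := v)]
  · simp only [mul_comm]
  · have := i2.inner_const (𝕜 := ℝ) v
    simp only [real_inner_comm v, inner_smul_right, inner_gradient] at this
    simpa only [mul_comm] using this
  · have := i1.inner_const (𝕜 := ℝ) v
    simpa only [real_inner_comm v, inner_smul_right, inner_gradient] using this
  · simpa only [smul_eq_mul, mul_comm] using i3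
  · exact fun x _ => hu.differentiable (by simp) x
  · exact fun x _ => hφ.1.differentiable (by simp) x

open scoped Convolution in
open ContinuousLinearMap in
/-- The gradient of a mollification is the mollification of the weak gradient. -/
lemma hasGradientAt_convolution {u : E d → ℝ} {G : E d → E d} (h : HasWeakGrad U u G)
    (hu : LocallyIntegrable (U.indicator u)) (hU : IsOpen U)
    {ρ : E d → ℝ} (hρ : ContDiff ℝ ∞ ρ)
    (hc : HasCompactSupport ρ) {z : E d} (hz : ∀ y, z - y ∈ tsupport ρ → y ∈ U) :
    HasGradientAt (ρ ⋆[lsmul ℝ ℝ, volume] (U.indicator u)) (∫ y in U, ρ (z - y) • G y) z := by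
  have h1 := hc.hasFDerivAt_convolution_left (lsmul ℝ ℝ) (hρ.of_le (by simp)) hu z
  have hts : tsupport (fun y => ρ (z - y)) ⊆ (fun y => z - y) ⁻¹' tsupport ρ := by
    refine closure_minimal (fun y hy => subset_tsupport ρ hy)
      ((isClosed_tsupport ρ).preimage (by fun_prop))
  have hct : HasCompactSupport fun y => ρ (z - y) :=
    hc.comp_homeomorph (Homeomorph.subLeft z)
  have htest : IsTestFun U fun y => ρ (z - y) :=
    ⟨hρ.comp (contDiff_const.sub contDiff_id), hct, fun y hy => hz y (hts hy)⟩
  suffices e : (fderiv ℝ ρ ⋆[precompL (E d) (lsmul ℝ ℝ), volume] U.indicator u) z =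
      InnerProductSpace.toDual ℝ (E d) (∫ y in U, ρ (z - y) • G y) by
    rw [hasGradientAt_iff_hasFDerivAt, ← e]; exact h1
  symm
  rw [convolution_eq_swap]
  have key := h.2.2 _ htest
  rw [eq_neg_iff_add_eq_zero, add_comm, ← eq_neg_iff_add_eq_zero] at key
  rw [key]
  have hgr : ∀ y, gradient (fun y => ρ (z - y)) y =
      -((InnerProductSpace.toDual ℝ (E d)).symm (fderiv ℝ ρ (z - y))) := by
    intro y
    have h2 := ((hρ.differentiable (by simp)).differentiableAt (x := z - y)).hasFDerivAt.comp y
      ((hasFDerivAt_id (𝕜 := ℝ) y).const_sub z)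
    have h3 : fderiv ℝ (fun y => ρ (z - y)) y = _ := h2.fderiv
    rw [gradient, h3, ← map_neg]
    congr 1
    ext v
    simp
  rw [← integral_neg, ← integral_indicator hU.measurableSet,
    ← LinearIsometryEquiv.coe_toContinuousLinearEquiv,
    ← ContinuousLinearEquiv.integral_comp_comm]
  refine integral_congr_ae (Eventually.of_forall fun y => ?_)
  by_cases hy : y ∈ U
  · simp only [indicator_of_mem hy, hgr]
    ext v
    simp [mul_comm]
  · simp only [indicator_of_notMem hy]
    ext v
    simp

end WeakCalculus

/-! ### Lipschitz representatives and traces -/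

section Lipschitz

open Filter Topology

variable {d : ℕ} {U V : Set (E d)}

lemma norm_setIntegral_bump_le {F : Type*} [NormedAddCommGroup F] [NormedSpace ℝ F]
    (φ : ContDiffBump (0 : E d)) {G : E d → F} {C : ℝ} (hC0 : 0 ≤ C)
    (hG : ∀ᵐ x ∂volume.restrict U, ‖G x‖ ≤ C) (z : E d) :
    ‖∫ y in U, φ.normed volume (z - y) • G y‖ ≤ C := by
  have hint : Integrable (fun y => φ.normed volume (z - y)) :=
    (φ.integrable_normed (μ := volume)).comp_sub_left z
  have h1 : ‖∫ y in U, φ.normed volume (z - y) • G y‖ ≤ ∫ y in U, φ.normed volume (z - y) * C := by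
    refine norm_integral_le_of_norm_le (hint.mul_const C).integrableOn ?_
    filter_upwards [hG] with y hy
    rw [norm_smul, Real.norm_of_nonneg (φ.nonneg_normed _)]
    exact mul_le_mul_of_nonneg_left hy (φ.nonneg_normed _)
  refine h1.trans ?_
  calc ∫ y in U, φ.normed volume (z - y) * C ≤ ∫ y, φ.normed volume (z - y) * C :=
        setIntegral_le_integral (hint.mul_const C)
          (Eventually.of_forall fun y => mul_nonneg (φ.nonneg_normed _) hC0)
    _ = C := by
        rw [integral_mul_const, integral_sub_left_eq_self (fun y => φ.normed volume y),
          φ.integral_normed, one_mul]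

lemma ae_norm_le_of_memLp_top {F : Type*} [NormedAddCommGroup F] {G : E d → F}
    {μ : Measure (E d)} (h : MemLp G ⊤ μ) : ∃ C, 0 ≤ C ∧ ∀ᵐ x ∂μ, ‖G x‖ ≤ C := by
  refine ⟨(eLpNorm G ⊤ μ).toReal, ENNReal.toReal_nonneg, ?_⟩
  have := h.2
  rw [eLpNorm_exponent_top] at *
  filter_upwards [ae_le_eLpNormEssSup (f := G) (μ := μ)] with x hx
  rw [← toReal_enorm]
  exact ENNReal.toReal_mono this.ne hx

/-- The mollifiers of radius `2 / (n + 1)`. -/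
def mollifier (d : ℕ) (n : ℕ) : ContDiffBump (0 : E d) where
  rIn := 1 / (n + 1)
  rOut := 2 / (n + 1)
  rIn_pos := by positivity
  rIn_lt_rOut := by gcongr; norm_num

lemma tendsto_mollifier_rOut : Tendsto (fun n => (mollifier d n).rOut) atTop (𝓝 0) := by
  have h := (tendsto_one_div_add_atTop_nhds_zero_nat (𝕜 := ℝ)).const_mul 2
  rw [mul_zero] at h
  refine h.congr fun n => ?_
  change 2 * (1 / ((n : ℝ) + 1)) = 2 / (n + 1)
  ring

/-- A function of class `W^{1,∞}` on a convex open set has a Lipschitz representative: its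
mollifications satisfy the mean value inequality with the bound of the weak gradient. -/
lemma MemW1inf.exists_lipschitz (hU : IsOpen U) (hc : Convex ℝ U) {u : E d → ℝ}
    (h : MemW1inf U u) : ∃ (u' : E d → ℝ) (K : NNReal),
      LipschitzWith K u' ∧ u =ᵐ[volume.restrict U] u' := by
  obtain ⟨hu, G, hG, hGb⟩ := h
  obtain ⟨C, hC0, hC⟩ := ae_norm_le_of_memLp_top hGb
  obtain ⟨B, hB0, hB⟩ := ae_norm_le_of_memLp_top hu
  have hul : LocallyIntegrable (U.indicator u) := by
    have hm : AEStronglyMeasurable (U.indicator u) volume :=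
      (aestronglyMeasurable_indicator_iff hU.measurableSet).2 hu.1
    refine (locallyIntegrable_const B).mono hm ?_
    rw [ae_restrict_iff' hU.measurableSet] at hB
    filter_upwards [hB] with x hx
    by_cases hxU : x ∈ U
    · rw [indicator_of_mem hxU]; exact (hx hxU).trans (le_abs_self B)
    · rw [indicator_of_notMem hxU, norm_zero]; positivity
  have hconv := ContDiffBump.ae_convolution_tendsto_right_of_locallyIntegrable (μ := volume)
    (φ := mollifier d) (l := atTop) (K := 2) tendsto_mollifier_rOut
    (Eventually.of_forall fun n => by
      change 2 / ((n : ℝ) + 1) ≤ 2 * (1 / (n + 1)); rw [mul_one_div]) hul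
  obtain ⟨S, hS⟩ : ∃ S : Set (E d), S = {x ∈ U | Tendsto (fun n =>
    (convolution ((mollifier d n).normed volume) (U.indicator u)
      (ContinuousLinearMap.lsmul ℝ ℝ) volume) x) atTop (𝓝 (U.indicator u x))} := ⟨_, rfl⟩
  have hlip : LipschitzOnWith C.toNNReal u S := by
    refine LipschitzOnWith.of_dist_le_mul fun x hx y hy => ?_
    rw [hS] at hx hy
    obtain ⟨hxU, hx⟩ := hx
    obtain ⟨hyU, hy⟩ := hy
    rw [indicator_of_mem hxU] at hx
    rw [indicator_of_mem hyU] at hy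
    rw [Real.coe_toNNReal C hC0]
    have hseg : IsCompact (segment ℝ x y) := by
      rw [← convexHull_pair]
      exact (Set.toFinite {x, y}).isCompact_convexHull ℝ
    obtain ⟨δ, hδ, hδU⟩ := hseg.exists_thickening_subset_open hU (hc.segment_subset hxU hyU)
    refine le_of_tendsto (hx.dist hy) ?_
    filter_upwards [tendsto_mollifier_rOut.eventually_lt_const hδ] with n hn
    have hgr : ∀ z ∈ segment ℝ x y, HasGradientAt (convolution ((mollifier d n).normed volume)
        (U.indicator u) (ContinuousLinearMap.lsmul ℝ ℝ) volume)
        (∫ y in U, (mollifier d n).normed volume (z - y) • G y) z := by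
      intro z hz
      refine hasGradientAt_convolution hG hul hU (mollifier d n).contDiff_normed
        (mollifier d n).hasCompactSupport_normed fun w hw => hδU ?_
      rw [(mollifier d n).tsupport_normed_eq, mem_closedBall_zero_iff] at hw
      rw [Metric.mem_thickening_iff]
      exact ⟨z, hz, by rw [dist_comm, dist_eq_norm]; exact lt_of_le_of_lt hw hn⟩
    rw [dist_comm (convolution _ _ _ _ x), dist_comm x, dist_eq_norm, dist_eq_norm]
    refine (convex_segment x y).norm_image_sub_le_of_norm_hasFDerivWithin_le
      (fun z hz => (hgr z hz).hasFDerivAt.hasFDerivWithinAt) (fun z _ => ?_)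
      (left_mem_segment ℝ x y) (right_mem_segment ℝ x y)
    rw [LinearIsometryEquiv.norm_map]
    exact norm_setIntegral_bump_le _ hC0 hC z
  obtain ⟨u', hu', heq⟩ := hlip.extend_real
  refine ⟨u', _, hu', ?_⟩
  rw [EventuallyEq, ae_restrict_iff' hU.measurableSet]
  filter_upwards [hconv] with x hx hxU
  exact heq (by rw [hS]; exact ⟨hxU, hx⟩)

lemma MemW1inf.mono {u : E d → ℝ} (h : MemW1inf U u) (hVU : V ⊆ U) : MemW1inf V u := by
  obtain ⟨hu, G, hG, hGb⟩ := h
  exact ⟨hu.mono_measure (Measure.restrict_mono hVU le_rfl), G, hG.mono hVU,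
    hGb.mono_measure (Measure.restrict_mono hVU le_rfl)⟩

lemma MemW1inf.congr (hU : IsOpen U) {u u' : E d → ℝ} (h : MemW1inf U u)
    (huu : u =ᵐ[volume.restrict U] u') : MemW1inf U u' := by
  obtain ⟨hu, G, hG, hGb⟩ := h
  exact ⟨hu.ae_eq huu, G, hG.congr hU huu (Eventually.of_forall fun _ => rfl), hGb⟩

lemma MemW1inf.add {u u' : E d → ℝ} (h : MemW1inf U u) (h' : MemW1inf U u') :
    MemW1inf U fun x => u x + u' x := by
  obtain ⟨hu, G, hG, hGb⟩ := h
  obtain ⟨hu', G', hG', hGb'⟩ := h'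
  exact ⟨hu.add hu', _, hG.add hG', hGb.add hGb'⟩

lemma MemW1inf.const_mul {u : E d → ℝ} (h : MemW1inf U u) (c : ℝ) :
    MemW1inf U fun x => c * u x := by
  obtain ⟨hu, G, hG, hGb⟩ := h
  exact ⟨hu.const_mul c, _, hG.const_mul c, hGb.const_smul c⟩

lemma MemW1inf.zero (U : Set (E d)) : MemW1inf U fun _ => 0 := by
  refine ⟨MemLp.zero', fun _ => 0, ⟨?_, ?_, fun φ _ => by simp⟩, MemLp.zero'⟩
  · exact (locallyIntegrable_const 0).locallyIntegrableOn _
  · exact (locallyIntegrable_const 0).locallyIntegrableOn _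

lemma MemW1inf.sum {ι : Type*} (s : Finset ι) {u : ι → E d → ℝ} (h : ∀ i ∈ s, MemW1inf U (u i)) :
    MemW1inf U fun x => ∑ i ∈ s, u i x := by
  classical
  induction s using Finset.induction_on with
  | empty => simpa using MemW1inf.zero U
  | insert i s hi ih =>
    simp only [Finset.sum_insert hi]
    exact (h i (by simp)).add (ih fun j hj => h j (by simp [hj]))

lemma memLp_top_of_continuous {F : Type*} [NormedAddCommGroup F] [SecondCountableTopology F]
    (hU : IsOpen U) (hb : Bornology.IsBounded U)
    {ψ : E d → F} (hψ : Continuous ψ) : MemLp ψ ⊤ (volume.restrict U) := by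
  obtain ⟨C, hC⟩ := hb.isCompact_closure.exists_bound_of_continuousOn hψ.continuousOn
  refine memLp_top_of_bound hψ.aestronglyMeasurable C ?_
  filter_upwards [ae_restrict_mem hU.measurableSet] with x hx using hC x (subset_closure hx)

lemma MemW1inf.smooth_mul (hU : IsOpen U) (hb : Bornology.IsBounded U) {u : E d → ℝ}
    (h : MemW1inf U u) {ψ : E d → ℝ} (hψ : ContDiff ℝ ∞ ψ) : MemW1inf U fun x => ψ x * u x := by
  obtain ⟨hu, G, hG, hGb⟩ := h
  have h1 := memLp_top_of_continuous hU hb hψ.continuous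
  have h2 := memLp_top_of_continuous hU hb (continuous_gradient hψ)
  exact ⟨hu.mul' h1, _, hG.smooth_mul hU hψ, (hGb.smul h1).add (h2.smul hu)⟩

lemma memLp_top_of_components {g : E d → E d} {μ : Measure (E d)}
    (h : ∀ i, MemLp (fun x => g x i) ⊤ μ) : MemLp g ⊤ μ := by
  have e : g = fun x => ∑ i, g x i • EuclideanSpace.single i (1 : ℝ) := by
    funext x
    conv_lhs => rw [← (EuclideanSpace.basisFun (Fin d) ℝ).sum_repr (g x)]
    simp
  rw [e]
  refine memLp_finsetSum _ fun i _ => ?_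
  exact (memLp_top_const (EuclideanSpace.single i (1 : ℝ) : E d)).smul (h i)

lemma locallyIntegrableOn_of_memLp_top {F : Type*} [NormedAddCommGroup F] {g : E d → F}
    (hU : IsOpen U) (h : MemLp g ⊤ (volume.restrict U)) : LocallyIntegrableOn g U := by
  rw [locallyIntegrableOn_iff hU.isLocallyClosed]
  intro k hk hkc
  have h1 : MemLp g ⊤ (volume.restrict k) := h.mono_measure (Measure.restrict_mono hk le_rfl)
  have : IsFiniteMeasure (volume.restrict k) :=
    isFiniteMeasure_restrict.2 hkc.measure_lt_top.ne
  exact h1.integrable le_top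

/-- A field with components in `W^{1,∞}` has a bounded weak divergence. -/
lemma exists_hasWeakDiv_memLp_top (hU : IsOpen U) {g : E d → E d}
    (h : ∀ i, MemW1inf U fun x => g x i) :
    ∃ D, HasWeakDiv U g D ∧ MemLp D ⊤ (volume.restrict U) := by
  choose hg G hG hGb using h
  have hD : MemLp (fun x => ∑ i, G i x i) ⊤ (volume.restrict U) := by
    refine memLp_finsetSum _ fun i _ => ?_
    exact (EuclideanSpace.proj (𝕜 := ℝ) i).comp_memLp' (hGb i)
  exact ⟨_, hasWeakDiv_of_components
    (locallyIntegrableOn_of_memLp_top hU (memLp_top_of_components hg))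
    (locallyIntegrableOn_of_memLp_top hU hD) hG, hD⟩

/-- A field with components in `W^{1,∞}` on a convex open set has a continuous representative. -/
lemma exists_continuous_of_memW1inf (hU : IsOpen U) (hc : Convex ℝ U) {g : E d → E d}
    (h : ∀ i, MemW1inf U fun x => g x i) :
    ∃ g' : E d → E d, Continuous g' ∧ g' =ᵐ[volume.restrict U] g := by
  choose u' K hu' he using fun i => (h i).exists_lipschitz hU hc
  refine ⟨fun x => WithLp.toLp 2 fun i => u' i x, ?_, ?_⟩
  · exact (PiLp.continuous_toLp 2 _).comp (continuous_pi fun i => (hu' i).continuous)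
  · have := (eventually_all (ι := Fin d)).2 he
    filter_upwards [this] with x hx
    ext i
    exact (hx i).symm

end Lipschitz

section TraceLemmas

open Filter Topology

variable {d : ℕ}

lemma volume_frontier_hull (T : Finset (E d)) : volume (frontier (hull T)) = 0 :=
  (convex_hull T).addHaar_frontier volume

lemma restrict_interior_hull (T : Finset (E d)) :
    volume.restrict (interior (hull T)) = volume.restrict (hull T) :=
  Measure.restrict_congr_set (interior_ae_eq_of_null_frontier (volume_frontier_hull T))

/-- Two fields which are continuous on a simplex and agree almost everywhere near a point of it
agree at that point. -/
lemma eq_of_ae_eq_near {T : Finset (E d)} (hT : IsSimplex T) {F : Type*} [TopologicalSpace F]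
    [T2Space F] {g g' : E d → F} {O : Set (E d)} (hO : IsOpen O)
    (hg : ContinuousOn g (hull T ∩ O)) (hg' : ContinuousOn g' (hull T ∩ O))
    (h : ∀ᵐ x ∂volume.restrict (hull T ∩ O), g x = g' x) {x : E d} (hx : x ∈ hull T)
    (hxO : x ∈ O) : g x = g' x := by
  have hsub : interior (hull T) ∩ O ⊆ hull T ∩ O := inter_subset_inter_left _ interior_subset
  have hopen : IsOpen (interior (hull T) ∩ O) := isOpen_interior.inter hO
  have h1 : EqOn g g' (interior (hull T) ∩ O) :=
    Measure.eqOn_open_of_ae_eq (ae_restrict_of_ae_restrict_of_subset hsub h) hopen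
      (hg.mono hsub) (hg'.mono hsub)
  have hcl : x ∈ closure (interior (hull T) ∩ O) := by
    have : x ∈ closure (interior (hull T)) := by rwa [closure_interior_hull hT]
    rw [inter_comm]
    exact hO.inter_closure ⟨hxO, this⟩
  have hne : (𝓝[interior (hull T) ∩ O] x).NeBot := mem_closure_iff_nhdsWithin_neBot.1 hcl
  refine tendsto_nhds_unique_of_eventuallyEq (l := 𝓝[interior (hull T) ∩ O] x) (f := g) (g := g')
    ((hg x ⟨hx, hxO⟩).mono hsub) ((hg' x ⟨hx, hxO⟩).mono hsub) ?_
  filter_upwards [self_mem_nhdsWithin] with y hy using h1 hy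

lemma eqOn_hull_of_ae_eq {T : Finset (E d)} (hT : IsSimplex T) {F : Type*} [TopologicalSpace F]
    [T2Space F] {g g' : E d → F} (hg : ContinuousOn g (hull T)) (hg' : ContinuousOn g' (hull T))
    (h : g =ᵐ[volume.restrict (hull T)] g') : EqOn g g' (hull T) := fun x hx =>
  eq_of_ae_eq_near hT isOpen_univ (by rwa [inter_univ]) (by rwa [inter_univ])
    (by rwa [inter_univ]) hx (mem_univ x)

/-- The trace of a field of class `W^{1,∞}` on a simplex is continuous and represents the field. -/
lemma trace_spec (T : Finset (E d)) {g : E d → E d}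
    (h : ∀ i, MemW1inf (interior (hull T)) fun x => g x i) :
    ContinuousOn (trace (hull T) g) (hull T) ∧
      trace (hull T) g =ᵐ[volume.restrict (hull T)] g := by
  obtain ⟨g', hg', he⟩ := exists_continuous_of_memW1inf isOpen_interior
    (convex_hull T).interior h
  have hex : ∃ g' : E d → E d, ContinuousOn g' (hull T) ∧ g' =ᵐ[volume.restrict (hull T)] g :=
    ⟨g', hg'.continuousOn, by rwa [restrict_interior_hull] at he⟩
  rw [trace, dif_pos hex]
  exact hex.choose_spec

end TraceLemmas

/-! ### Outer normals and facets of simplices -/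

section Normals

open Filter Topology

variable {d : ℕ}

lemma exists_zero_of_affGrad_ne {l : E d →ᵃ[ℝ] ℝ} (hl : affGrad l ≠ 0) : ∃ p, l p = 0 := by
  refine ⟨-(l 0 / ‖affGrad l‖ ^ 2) • affGrad l, ?_⟩
  have := affine_add_apply l 0 (-(l 0 / ‖affGrad l‖ ^ 2) • affGrad l)
  rw [zero_add] at this
  rw [this, inner_smul_right, real_inner_self_eq_norm_sq]
  have : ‖affGrad l‖ ^ 2 ≠ 0 := by simpa using hl
  field_simp
  ring

lemma norm_outN {l : E d →ᵃ[ℝ] ℝ} (hl : affGrad l ≠ 0) : ‖outN l‖ = 1 := by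
  rw [outN, norm_neg, norm_smul, norm_inv, norm_norm]
  exact inv_mul_cancel₀ (norm_ne_zero_iff.2 hl)

/-- The zero set of an affine function as a hyperplane with unit normal. -/
lemma setOf_affine_eq_zero {l : E d →ᵃ[ℝ] ℝ} (hl : affGrad l ≠ 0) {p : E d} (hp : l p = 0) :
    {x | l x = 0} = {x | inner ℝ (outN l) (x - p) = 0} := by
  ext x
  have := affine_sub_eq l x p
  rw [hp, sub_zero] at this
  simp only [mem_ofPred_eq, this, outN, inner_neg_left, real_inner_smul_left, neg_eq_zero,
    mul_eq_zero, inv_eq_zero, norm_eq_zero, hl, false_or]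

lemma ae_hyperplane_ne {l m : E d →ᵃ[ℝ] ℝ} (hl : affGrad l ≠ 0)
    (h : ∃ q, l q = 0 ∧ m q ≠ 0) :
    ∀ᵐ x ∂(μHE[d - 1]).restrict {x | l x = 0}, m x ≠ 0 := by
  obtain ⟨p, hp⟩ := exists_zero_of_affGrad_ne hl
  have e := setOf_affine_eq_zero hl hp
  rw [e, ae_hyperplane_iff _ (norm_outN hl)]
  refine ae_ne_zero_of_exists _ _ _ ?_
  obtain ⟨q, hq, hm⟩ := h
  refine ⟨q, ?_, hm⟩
  have : q ∈ {x | l x = 0} := hq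
  rwa [e] at this

lemma measure_hyperplane_inter_compact {l : E d →ᵃ[ℝ] ℝ} (hl : affGrad l ≠ 0) {K : Set (E d)}
    (hK : IsCompact K) : μHE[d - 1] (K ∩ {x | l x = 0}) < ⊤ := by
  obtain ⟨p, hp⟩ := exists_zero_of_affGrad_ne hl
  have e := setOf_affine_eq_zero hl hp
  rw [e, ← Measure.restrict_apply hK.isClosed.measurableSet,
    ← map_add_eq_restrict _ (norm_outN hl), (measurableEmbedding_add _ _).map_apply]
  have hiso : Isometry (fun y : (ℝ ∙ outN l)ᗮ => (y : E d) + p) :=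
    Isometry.of_dist_eq fun x y => by rw [dist_add_right]; rfl
  exact (hiso.isClosedEmbedding.isCompact_preimage hK).measure_lt_top

lemma IsOuterNormal.unique {V : Set (E d)} {x n m : E d} (hn : IsOuterNormal V x n)
    (hm : IsOuterNormal V x m) : n = m := by
  obtain ⟨hn1, r, hr, hnr⟩ := hn
  obtain ⟨hm1, r', hr', hmr⟩ := hm
  by_contra hne
  have hlt : inner ℝ n m < 1 := by
    have := norm_sub_sq_real n m
    have h0 : 0 < ‖n - m‖ ^ 2 := by
      have := norm_pos_iff.2 (sub_ne_zero.2 hne)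
      positivity
    rw [hn1, hm1] at this
    linarith
  have hpos : 0 < ‖m - n‖ := norm_pos_iff.2 (sub_ne_zero.2 (Ne.symm hne))
  set t := min r r' / (2 * ‖m - n‖) with ht
  have ht0 : 0 < t := by positivity
  have hball : x + t • (m - n) ∈ Metric.ball x (min r r') := by
    rw [mem_ball_iff_norm, add_sub_cancel_left, norm_smul, Real.norm_of_nonneg ht0.le, ht]
    field_simp
    linarith [lt_min hr hr']
  have h1 := (hnr _ (Metric.ball_subset_ball (min_le_left _ _) hball)).1
  have h2 := (hmr _ (Metric.ball_subset_ball (min_le_right _ _) hball)).2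
  rw [add_sub_cancel_left, real_inner_smul_left, inner_sub_left, real_inner_self_eq_norm_sq] at h1 h2
  rw [hn1, real_inner_comm] at h1
  rw [hm1] at h2
  exact h2 (by nlinarith) (h1 (by nlinarith))

/-- If a set coincides near `x` with the half-space `0 ≤ l`, then its outer normal at `x` is the
negative normalised gradient of `l`. -/
lemma outerNormal_eq {V : Set (E d)} {x : E d} {l : E d →ᵃ[ℝ] ℝ} (hl : affGrad l ≠ 0)
    (hx : l x = 0) (h : ∀ᶠ y in 𝓝 x, (0 < l y → y ∈ V) ∧ (l y < 0 → y ∉ V)) :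
    outerNormal V x = outN l := by
  have key : IsOuterNormal V x (outN l) := by
    refine ⟨norm_outN hl, ?_⟩
    obtain ⟨r, hr, hb⟩ := Metric.eventually_nhds_iff_ball.1 h
    refine ⟨r, hr, fun y hy => ?_⟩
    have hn : 0 < ‖affGrad l‖⁻¹ := inv_pos.2 (norm_pos_iff.2 hl)
    have e : inner ℝ (y - x) (outN l) = -(‖affGrad l‖⁻¹ * l y) := by
      have := affine_sub_eq l y x
      rw [hx, sub_zero] at this
      rw [this, outN, inner_neg_right, inner_smul_right, real_inner_comm]
    rw [e]
    refine ⟨fun h0 => (hb y hy).1 ?_, fun h0 => (hb y hy).2 ?_⟩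
    · rw [neg_lt_zero] at h0
      exact pos_of_mul_pos_right h0 hn.le
    · by_contra! h1
      have := mul_nonneg hn.le h1
      linarith
  have hex : ∃ n, IsOuterNormal V x n := ⟨_, key⟩
  rw [outerNormal, dif_pos hex]
  exact hex.choose_spec.unique key

variable {T : Finset (E d)} (hT : IsSimplex T)

include hT

lemma hull_erase_eq [DecidableEq (E d)] {c : E d} (hc : c ∈ T) :
    hull (T.erase c) = hull T ∩ {x | bary T c x = 0} := by
  ext x
  rw [mem_hull_subset_iff hT (T.erase_subset c)]
  refine and_congr_right fun _ => ⟨fun h => h c hc (T.notMem_erase c), fun h a ha hac => ?_⟩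
  have : a = c := by
    by_contra hne
    exact hac (Finset.mem_erase.2 ⟨hne, ha⟩)
  rw [this]; exact h

/-- Almost every point of a facet lies in its relative interior. -/
lemma ae_facet [DecidableEq (E d)] (hd : 1 ≤ d) {c : E d} (hc : c ∈ T) :
    ∀ᵐ x ∂(μHE[d - 1]).restrict (hull (T.erase c)), bary T c x = 0 ∧ x ∈ hull T ∧
      ∀ a ∈ T, a ≠ c → 0 < bary T a x := by
  have hl := affGrad_bary_ne_zero hT hd hc
  have h1 : ∀ᵐ x ∂(μHE[d - 1]).restrict {x | bary T c x = 0}, ∀ a ∈ T, a ≠ c →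
      bary T a x ≠ 0 := by
    rw [Finset.eventually_all]
    intro a ha
    by_cases hac : a = c
    · simp [hac]
    · filter_upwards [ae_hyperplane_ne (m := bary T a) hl
        ⟨a, bary_of_ne hT ha (Ne.symm hac), by rw [bary_self hT ha]; norm_num⟩] with x hx _ using hx
  rw [hull_erase_eq hT hc]
  have hm : MeasurableSet (hull T ∩ {x | bary T c x = 0}) :=
    (isCompact_hull T).isClosed.measurableSet.inter
      (isClosed_eq (continuous_affine _) continuous_const).measurableSet
  filter_upwards [ae_restrict_of_ae_restrict_of_subset inter_subset_right h1,
    ae_restrict_mem hm] with x hx hxm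
  exact ⟨hxm.2, hxm.1, fun a ha hac =>
    lt_of_le_of_ne ((mem_hull_iff hT).1 hxm.1 a ha) (hx a ha hac).symm⟩

lemma outerNormal_hull (hd : 1 ≤ d) {c : E d} (hc : c ∈ T) {x : E d} (hx : bary T c x = 0)
    (hpos : ∀ a ∈ T, a ≠ c → 0 < bary T a x) : outerNormal (hull T) x = outN (bary T c) := by
  refine outerNormal_eq (affGrad_bary_ne_zero hT hd hc) hx ?_
  have : ∀ᶠ y in 𝓝 x, ∀ a ∈ T, a ≠ c → 0 < bary T a y := by
    rw [Finset.eventually_all]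
    intro a ha
    by_cases hac : a = c
    · simp [hac]
    · filter_upwards [(continuous_affine (bary T a)).continuousAt.eventually_const_lt
        (hpos a ha hac)] with y hy _ using hy
  filter_upwards [this] with y hy
  refine ⟨fun h0 => (mem_hull_iff hT).2 fun a ha => ?_, fun h0 hy' =>
    absurd ((mem_hull_iff hT).1 hy' c hc) (not_le.2 h0)⟩
  by_cases hac : a = c
  · rw [hac]; exact h0.le
  · exact (hy a ha hac).le

end Normals

/-! ### Geometry of triangulations -/

section Mesh

open Filter Topology

variable {d : ℕ} {Ω : Set (E d)} (M : Triangulation Ω)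

lemma Triangulation.isSimplex {T : Finset (E d)} (hT : T ∈ M.elems) : IsSimplex T :=
  ⟨M.card_eq T hT, M.indep T hT⟩

lemma Triangulation.hull_subset {T : Finset (E d)} (hT : T ∈ M.elems) : hull T ⊆ closure Ω := by
  rw [← M.cover]
  exact subset_biUnion_of_mem (u := fun T : Finset (E d) => convexHull ℝ (T : Set (E d))) hT

lemma Triangulation.exists_mem_hull {x : E d} (hx : x ∈ closure Ω) :
    ∃ T ∈ M.elems, x ∈ hull T := by
  rw [← M.cover] at hx
  simpa [hull] using hx

/-- Barycentric coordinates of different elements agree at common points. -/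
lemma Triangulation.bary_eq_bary {S T : Finset (E d)} (hS : S ∈ M.elems) (hT : T ∈ M.elems)
    {x : E d} (hxS : x ∈ hull S) (hxT : x ∈ hull T) (a : E d) : bary S a x = bary T a x := by
  classical
  have hx : x ∈ hull (S ∩ T) := by
    have : x ∈ hull S ∩ hull T := ⟨hxS, hxT⟩
    rw [hull, hull, M.regular S hS T hT] at this
    rwa [hull, Finset.coe_inter]
  have hS' := M.isSimplex hS
  have hT' := M.isSimplex hT
  have hzero : ∀ {R : Finset (E d)}, a ∉ R → bary R a x = 0 := fun h => by
    rw [bary, dif_neg (by simp [h])]; rfl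
  have h1 := ((mem_hull_subset_iff hS' Finset.inter_subset_left).1 hx).2
  have h2 := ((mem_hull_subset_iff hT' Finset.inter_subset_right).1 hx).2
  by_cases haS : a ∈ S
  · by_cases haT : a ∈ T
    · set w : E d → ℝ := fun b => if b ∈ S ∩ T then bary S b x else 0 with hw
      have e1 : ∑ b ∈ T, w b = 1 := by
        rw [hw, ← Finset.sum_filter, Finset.filter_mem_eq_inter,
          Finset.inter_eq_right.2 Finset.inter_subset_right, ← sum_bary hS' x]
        exact Finset.sum_subset Finset.inter_subset_left h1
      have e2 : ∑ b ∈ T, w b • b = x := by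
        conv_rhs => rw [← sum_bary_smul hS' x]
        simp only [hw, ite_smul, zero_smul]
        rw [← Finset.sum_filter, Finset.filter_mem_eq_inter,
          Finset.inter_eq_right.2 Finset.inter_subset_right]
        exact Finset.sum_subset Finset.inter_subset_left fun b hb hb' => by
          rw [h1 b hb hb', zero_smul]
      have := bary_combination hT' e1 haT
      rw [e2] at this
      rw [this, hw]
      simp [haS, haT]
    · rw [hzero haT, h1 a haS (by simp [haT])]
  · by_cases haT : a ∈ T
    · rw [hzero haS, h2 a haT (by simp [haS])]
    · rw [hzero haS, hzero haT]

lemma bary_of_notMem {T : Finset (E d)} {a : E d} (h : a ∉ T) (x : E d) : bary T a x = 0 := by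
  rw [bary, dif_neg (by simp [h])]; rfl

lemma Triangulation.mem_of_bary_ne {S T : Finset (E d)} (hS : S ∈ M.elems) (hT : T ∈ M.elems)
    {x : E d} (hxS : x ∈ hull S) (hxT : x ∈ hull T) {a : E d} (h : bary S a x ≠ 0) : a ∈ T := by
  by_contra ha
  exact h (by rw [M.bary_eq_bary hS hT hxS hxT, bary_of_notMem ha])

/-- Near `x`, only the elements that contain `x` matter. -/
lemma Triangulation.eventually_mem_hull (x : E d) :
    ∀ᶠ z in 𝓝 x, ∀ T ∈ M.elems, z ∈ hull T → x ∈ hull T := by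
  rw [Finset.eventually_all]
  intro T _
  by_cases hx : x ∈ hull T
  · simp [hx]
  · filter_upwards [(isCompact_hull T).isClosed.isOpen_compl.mem_nhds hx] with z hz hz'
    exact absurd hz' hz

variable {M}

lemma IsBoundedLipschitzDomain.notMem_interior_closure (hΩ : IsBoundedLipschitzDomain Ω) {x : E d}
    (hx : x ∈ frontier Ω) : x ∉ interior (closure Ω) := by
  intro hxi
  obtain ⟨ν, hν, ψ, K, r, hψ, hr, hball⟩ := hΩ.lipschitz x hx
  set F : E d → ℝ := fun y => inner ℝ ν y - ψ (y - inner ℝ ν y • ν) with hF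
  have hFc : Continuous F := by
    have := hψ.continuous
    fun_prop
  have hxΩ : x ∉ Ω := by
    rw [hΩ.isOpen.frontier_eq] at hx; exact hx.2
  have hFx : F x ≤ 0 := by
    by_contra! h
    exact hxΩ ((hball x (Metric.mem_ball_self hr)).2 (by simp only [hF] at h; linarith))
  have hFt : ∀ t : ℝ, F (x - t • ν) = F x - t := by
    intro t
    simp only [hF, inner_sub_right, inner_smul_right, real_inner_self_eq_norm_sq, hν]
    have : x - t • ν - (inner ℝ ν x - t * 1 ^ 2) • ν = x - inner ℝ ν x • ν := by
      module
    rw [this]; ring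
  have hcont : Tendsto (fun t : ℝ => x - t • ν) (𝓝[>] 0) (𝓝 x) := by
    have : Continuous fun t : ℝ => x - t • ν := by fun_prop
    have h := this.tendsto 0
    simp only [zero_smul, sub_zero] at h
    exact h.mono_left nhdsWithin_le_nhds
  have hev := (hcont.eventually (mem_interior_iff_mem_nhds.1 hxi)).and
    ((hcont.eventually (Metric.ball_mem_nhds x hr)).and self_mem_nhdsWithin)
  obtain ⟨t, h1, h2, h3⟩ := hev.exists
  have ht : F (x - t • ν) < 0 := by
    rw [hFt]
    have : 0 < t := h3
    linarith
  have h1 : x - t • ν ∈ closure Ω := h1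
  rw [mem_closure_iff_nhds] at h1
  obtain ⟨y, ⟨hy1, hy2⟩, hyΩ⟩ := h1 _ (inter_mem (Metric.isOpen_ball.mem_nhds h2)
    (hFc.continuousAt.eventually_lt_const ht))
  have := (hball y hy1).1 hyΩ
  have hy2 : F y < 0 := hy2
  simp only [hF] at hy2
  linarith

/-- A Lipschitz domain has no slits: it lies on one side of its boundary. -/
lemma IsBoundedLipschitzDomain.interior_closure_subset (hΩ : IsBoundedLipschitzDomain Ω) :
    interior (closure Ω) ⊆ Ω := by
  intro x hx
  by_contra h
  refine hΩ.notMem_interior_closure (x := x) ?_ hx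
  rw [hΩ.isOpen.frontier_eq]
  exact ⟨interior_subset hx, h⟩

lemma IsBoundedLipschitzDomain.mem_of_notMem_frontier (hΩ : IsBoundedLipschitzDomain Ω) {x : E d}
    (hx : x ∈ closure Ω) (h : x ∉ frontier Ω) : x ∈ Ω := by
  rw [hΩ.isOpen.frontier_eq] at h
  by_contra h'
  exact h ⟨hx, h'⟩

lemma Triangulation.interior_hull_subset (hΩ : IsBoundedLipschitzDomain Ω) {T : Finset (E d)}
    (hT : T ∈ M.elems) : interior (hull T) ⊆ Ω :=
  (interior_mono (M.hull_subset hT)).trans hΩ.interior_closure_subset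

/-- If `x` and `y` lie in an element, `y` is in `Ω`, and `x` lies in the relative interior of a face
that contains `y`, then `x` is in `Ω`: near `x` the mesh looks like near a point of the segment
close to `y`. -/
lemma Triangulation.mem_of_support_subset (M : Triangulation Ω) (hΩ : IsBoundedLipschitzDomain Ω)
    {T : Finset (E d)}
    (hT : T ∈ M.elems) {x y : E d} (hx : x ∈ hull T) (hy : y ∈ hull T) (hyΩ : y ∈ Ω)
    (hsupp : ∀ a ∈ T, bary T a y ≠ 0 → bary T a x ≠ 0) : x ∈ Ω := by
  classical
  have hT' := M.isSimplex hT
  -- a point of the segment inside `Ω`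
  obtain ⟨t, ht0, ht1, htΩ⟩ : ∃ t : ℝ, 0 < t ∧ t < 1 ∧ (1 - t) • y + t • x ∈ Ω := by
    have hcont : Tendsto (fun t : ℝ => (1 - t) • y + t • x) (𝓝[>] 0) (𝓝 y) := by
      have : Continuous fun t : ℝ => (1 - t) • y + t • x := by fun_prop
      have h := this.tendsto 0
      simp only [sub_zero, one_smul, zero_smul, add_zero] at h
      exact h.mono_left nhdsWithin_le_nhds
    have h1 : ∀ᶠ t : ℝ in 𝓝[>] (0 : ℝ), t < 1 := mem_nhdsWithin_of_mem_nhds (Iio_mem_nhds one_pos)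
    obtain ⟨t, h1, h2, h3⟩ := ((hcont.eventually (hΩ.isOpen.mem_nhds hyΩ)).and
      (h1.and self_mem_nhdsWithin)).exists
    exact ⟨t, h3, h2, h1⟩
  set X : E d → E d := fun z => (1 - t) • y + t • z with hX
  have hXc : Continuous X := by fun_prop
  have hbX : ∀ (S : Finset (E d)) (a z : E d),
      bary S a (X z) = (1 - t) * bary S a y + t * bary S a z := by
    intro S a z
    rw [hX]
    exact Convex.combo_affine_apply (by ring)
  refine hΩ.interior_closure_subset (mem_interior_iff_mem_nhds.2 ?_)
  have hev1 : ∀ᶠ z in 𝓝 x, X z ∈ Ω := hXc.continuousAt.eventually (hΩ.isOpen.mem_nhds htΩ)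
  have hev2 : ∀ᶠ z in 𝓝 x, ∀ S ∈ M.elems, X z ∈ hull S → X x ∈ hull S :=
    hXc.continuousAt.eventually (M.eventually_mem_hull (X x))
  have hev3 : ∀ᶠ z in 𝓝 x, ∀ S ∈ M.elems, ∀ b ∈ S, 0 < bary S b x → 0 < bary S b z := by
    rw [Finset.eventually_all]
    intro S _
    rw [Finset.eventually_all]
    intro b _
    by_cases hb : 0 < bary S b x
    · filter_upwards [(continuous_affine (bary S b)).continuousAt.eventually_const_lt hb]
        with z hz _ using hz
    · simp [hb]
  filter_upwards [hev1, hev2, hev3] with z h1 h2 h3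
  obtain ⟨S, hS, hzS⟩ := M.exists_mem_hull (subset_closure h1)
  have hS' := M.isSimplex hS
  have hXS := h2 S hS hzS
  have hXT : X x ∈ hull T := convex_hull T hy hx (by linarith) ht0.le (by ring)
  have hxn := (mem_hull_iff hT').1 hx
  have hyn := (mem_hull_iff hT').1 hy
  have hmem : ∀ a ∈ T, bary T a x ≠ 0 → a ∈ S := by
    intro a ha hax
    refine M.mem_of_bary_ne hT hS hXT hXS (a := a) (ne_of_gt ?_)
    rw [hbX]
    have h0 := hyn a ha
    have h0' : 0 < bary T a x := lt_of_le_of_ne (hxn a ha) (Ne.symm hax)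
    have : 0 ≤ (1 - t) * bary T a y := mul_nonneg (by linarith) h0
    have : 0 < t * bary T a x := mul_pos ht0 h0'
    linarith
  have hsub : ∀ w ∈ hull T, (∀ a ∈ T, a ∉ S → bary T a w = 0) → w ∈ hull S := by
    intro w hw h0
    have : w ∈ hull (T ∩ S) :=
      (mem_hull_subset_iff hT' Finset.inter_subset_left).2
        ⟨hw, fun a ha has => h0 a ha fun h => has (Finset.mem_inter.2 ⟨ha, h⟩)⟩
    exact convexHull_mono (by simp) this
  have hxS : x ∈ hull S := hsub x hx fun a ha haS => by
    by_contra h; exact haS (hmem a ha h)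
  have hyS : y ∈ hull S := hsub y hy fun a ha haS => by
    by_contra h; exact haS (hmem a ha (hsupp a ha h))
  refine M.hull_subset hS ((mem_hull_iff hS').2 fun b hb => ?_)
  have hbx := (mem_hull_iff hS').1 hxS b hb
  rcases hbx.lt_or_eq with hpos | h0
  · exact (h3 S hS b hb hpos).le
  · have hby : bary S b y = 0 := by
      by_contra hne
      have hbT : b ∈ T := M.mem_of_bary_ne hS hT hyS hy hne
      rw [M.bary_eq_bary hS hT hyS hy] at hne
      refine hsupp b hbT hne ?_
      rw [M.bary_eq_bary hT hS hx hxS, h0]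
    have := (mem_hull_iff hS').1 hzS b hb
    rw [hbX, hby, mul_zero, zero_add] at this
    exact nonneg_of_mul_nonneg_right this ht0

/-- The open star of an interior node lies in `Ω`. -/
lemma Triangulation.mem_of_bary_pos (M : Triangulation Ω) (hΩ : IsBoundedLipschitzDomain Ω)
    {T : Finset (E d)} (hT : T ∈ M.elems) {a : E d} (ha : a ∈ T) (haΓ : a ∉ frontier Ω) {x : E d}
    (hx : x ∈ hull T) (hpos : 0 < bary T a x) : x ∈ Ω := by
  refine M.mem_of_support_subset hΩ hT hx (vertex_mem_hull ha)
    (hΩ.mem_of_notMem_frontier (M.hull_subset hT (vertex_mem_hull ha)) haΓ) fun b hb hne => ?_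
  have : b = a := by
    by_contra h
    exact hne (bary_of_ne (M.isSimplex hT) ha h)
  rw [this]; exact hpos.ne'

lemma Triangulation.volume_frontier (M : Triangulation Ω) (hΩ : IsBoundedLipschitzDomain Ω) :
    volume (frontier Ω) = 0 := by
  have hsub : frontier Ω ⊆ ⋃ T ∈ M.elems, frontier (hull T) := by
    intro x hx
    obtain ⟨T, hT, hxT⟩ := M.exists_mem_hull (frontier_subset_closure hx)
    refine mem_iUnion₂.2 ⟨T, hT, ?_⟩
    rw [(isCompact_hull T).isClosed.frontier_eq]
    refine ⟨hxT, fun h => ?_⟩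
    have := M.interior_hull_subset hΩ hT h
    rw [hΩ.isOpen.frontier_eq] at hx
    exact hx.2 this
  refine measure_mono_null hsub ((measure_biUnion_null_iff M.elems.countable_toSet).2 fun T _ => ?_)
  exact volume_frontier_hull T

lemma Triangulation.volume_inter_hull (M : Triangulation Ω) {S T : Finset (E d)}
    (hS : S ∈ M.elems) (hT : T ∈ M.elems) (hne : S ≠ T) : volume (hull S ∩ hull T) = 0 := by
  have hS' := M.isSimplex hS
  obtain ⟨a, haS, haT⟩ : ∃ a ∈ S, a ∉ T := by
    by_contra! h
    exact hne (Finset.eq_of_subset_of_card_le h (by rw [M.card_eq S hS, M.card_eq T hT]))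
  refine measure_mono_null (t := {x | bary S a x = 0}) (fun x hx => ?_)
    (measure_affine_eq_zero volume (bary S a) ⟨a, by rw [bary_self hS' haS]; norm_num⟩)
  change bary S a x = 0
  rw [M.bary_eq_bary hS hT hx.1 hx.2, bary_of_notMem haT]

/-- Integrals over `Ω` are sums of integrals over the elements. -/
lemma Triangulation.setIntegral_eq_sum (M : Triangulation Ω) (hΩ : IsBoundedLipschitzDomain Ω)
    {F : Type*} [NormedAddCommGroup F] [NormedSpace ℝ F] {f : E d → F}
    (hf : IntegrableOn f Ω) :
    ∫ x in Ω, f x = ∑ T ∈ M.elems, ∫ x in hull T, f x := by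
  classical
  have hae : Ω =ᵐ[volume] closure Ω := by
    refine (subset_closure.eventuallyLE).antisymm ?_
    have h0 := M.volume_frontier hΩ
    rw [hΩ.isOpen.frontier_eq, ← ae_le_set] at h0
    exact h0
  have hcl : closure Ω = ⋃ T : M.elems, hull T.1 := by
    rw [← M.cover]
    exact biUnion_eq_iUnion _ fun T _ => hull T
  rw [setIntegral_congr_set hae, hcl, integral_iUnion_ae, tsum_fintype]
  · exact Finset.sum_coe_sort M.elems fun T => ∫ x in hull T, f x
  · exact fun T => (isCompact_hull T.1).isClosed.measurableSet.nullMeasurableSet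
  · exact fun S T hST => M.volume_inter_hull S.2 T.2 fun h => hST (Subtype.ext h)
  · rw [← hcl]
    exact hf.congr_set_ae hae.symm

lemma Triangulation.integrableOn_hull (M : Triangulation Ω) (hΩ : IsBoundedLipschitzDomain Ω)
    {F : Type*} [NormedAddCommGroup F] {f : E d → F} (hf : IntegrableOn f Ω) {T : Finset (E d)}
    (hT : T ∈ M.elems) : IntegrableOn f (hull T) := by
  rw [IntegrableOn, ← restrict_interior_hull]
  exact hf.mono_set (M.interior_hull_subset hΩ hT)

lemma Triangulation.restrict_hull_le (M : Triangulation Ω) (hΩ : IsBoundedLipschitzDomain Ω)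
    {T : Finset (E d)} (hT : T ∈ M.elems) : volume.restrict (hull T) ≤ volume.restrict Ω := by
  rw [← restrict_interior_hull]
  exact Measure.restrict_mono (M.interior_hull_subset hΩ hT) le_rfl

end Mesh

/-! ### Interior facets and cancellation of surface integrals -/

section Facets

open Filter Topology

variable {d : ℕ} {Ω : Set (E d)} {M : Triangulation Ω}

open Classical in
/-- The outer unit normal of the simplex `T` on its facet `F`. The sum has one term, for the vertex
opposite to `F`. -/
def facetN (T F : Finset (E d)) : E d := outN (∑ a ∈ T.filter fun a => a ∉ F, bary T a)

lemma facetN_erase [DecidableEq (E d)] {T : Finset (E d)} {c : E d} (hc : c ∈ T) :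
    facetN T (T.erase c) = outN (bary T c) := by
  have : (T.filter fun a => a ∉ T.erase c) = {c} := by
    ext a
    simp only [Finset.mem_filter, Finset.mem_erase, Finset.mem_singleton]
    constructor
    · rintro ⟨h1, h2⟩
      by_contra h
      exact h2 ⟨h, h1⟩
    · rintro rfl
      exact ⟨hc, by simp⟩
  rw [facetN]
  congr 1
  convert Finset.sum_singleton (fun a => bary T a) c using 2
  convert this

lemma exists_eq_erase [DecidableEq (E d)] {T F : Finset (E d)} (hT : T.card = d + 1)
    (hF : F ∈ T.powersetCard d) :
    ∃ c ∈ T, F = T.erase c := by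
  obtain ⟨hFT, hFc⟩ := Finset.mem_powersetCard.1 hF
  obtain ⟨c, hcF, hc⟩ := Finset.exists_eq_insert_iff.2 ⟨hFT, by rw [hFc, hT]⟩
  exact ⟨c, by rw [← hc]; simp, by rw [← hc, Finset.erase_insert hcF]⟩

lemma erase_mem_powersetCard [DecidableEq (E d)] {T : Finset (E d)} (hT : T.card = d + 1)
    {c : E d} (hc : c ∈ T) : T.erase c ∈ T.powersetCard d :=
  Finset.mem_powersetCard.2 ⟨T.erase_subset c, by rw [Finset.card_erase_of_mem hc, hT]; rfl⟩

lemma sum_powersetCard_eq [DecidableEq (E d)] {T : Finset (E d)} (hT : T.card = d + 1)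
    {A : Type*} [AddCommMonoid A] (φ : Finset (E d) → A) :
    ∑ F ∈ T.powersetCard d, φ F = ∑ c ∈ T, φ (T.erase c) := by
  symm
  refine Finset.sum_bij (fun c _ => T.erase c) (fun c hc => erase_mem_powersetCard hT hc) ?_ ?_ ?_
  · intro a ha b hb hab
    by_contra hne
    have : a ∈ T.erase b := Finset.mem_erase.2 ⟨hne, ha⟩
    rw [← hab] at this
    simp at this
  · intro F hF
    obtain ⟨c, hc, rfl⟩ := exists_eq_erase hT hF
    exact ⟨c, hc, rfl⟩
  · exact fun _ _ => rfl

lemma hull_facet_finite [DecidableEq (E d)] (hd : 1 ≤ d) {T : Finset (E d)} (hT : IsSimplex T)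
    {F : Finset (E d)} (hF : F ∈ T.powersetCard d) : μHE[d - 1] (hull F) < ⊤ := by
  obtain ⟨c, hc, rfl⟩ := exists_eq_erase hT.card_eq hF
  rw [hull_erase_eq hT hc]
  exact measure_hyperplane_inter_compact (affGrad_bary_ne_zero hT hd hc) (isCompact_hull T)

lemma integrableOn_facet (hd : 1 ≤ d) {T : Finset (E d)} (hT : IsSimplex T)
    {F : Finset (E d)} (hF : F ∈ T.powersetCard d) {f : E d → ℝ} (hf : ContinuousOn f (hull F)) :
    IntegrableOn f (hull F) μHE[d - 1] := by
  classical
  obtain ⟨C, hC⟩ := (isCompact_hull F).exists_bound_of_continuousOn hf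
  have hm : MeasurableSet (hull F) := (isCompact_hull F).isClosed.measurableSet
  refine IntegrableOn.of_bound (hull_facet_finite hd hT hF) (hf.aestronglyMeasurable hm) C ?_
  · filter_upwards [ae_restrict_mem hm] with x hx using hC x hx

lemma outN_smul_neg {l : E d →ᵃ[ℝ] ℝ} {κ : ℝ} (hκ : κ < 0) : outN (κ • l) = -outN l := by
  rw [outN, outN, affGrad_smul, norm_smul, Real.norm_of_nonpos hκ.le, smul_smul, mul_inv]
  have : (-κ)⁻¹ * ‖affGrad l‖⁻¹ * κ = -‖affGrad l‖⁻¹ := by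
    have := hκ.ne
    rw [inv_neg]
    field_simp
  rw [this, neg_smul]

/-- Two barycentric coordinates which vanish on the same facet are proportional. -/
lemma bary_eq_smul_of_erase_eq [DecidableEq (E d)] {S T : Finset (E d)} (hS : IsSimplex S)
    (hT : IsSimplex T) {b c : E d} (hc : c ∈ T) (h : S.erase b = T.erase c) :
    bary S b = bary S b c • bary T c := by
  ext x
  rw [affine_eq_sum_bary hT (bary S b) x, Finset.sum_eq_single c]
  · simp [mul_comm]
  · intro a ha hac
    have : a ∈ S.erase b := by rw [h]; exact Finset.mem_erase.2 ⟨hac, ha⟩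
    obtain ⟨hab, haS⟩ := Finset.mem_erase.1 this
    rw [bary_of_ne hS haS (Ne.symm hab), mul_zero]
  · exact fun h => absurd hc h

/-- Two elements with a common facet on the same side of it coincide. -/
lemma Triangulation.eq_of_same_side [DecidableEq (E d)] (M : Triangulation Ω) (hd : 1 ≤ d)
    {S T : Finset (E d)}
    (hS : S ∈ M.elems) (hT : T ∈ M.elems) {b c : E d} (hc : c ∈ T)
    (h : S.erase b = T.erase c) (hpos : 0 < bary S b c) : S = T := by
  have hS' := M.isSimplex hS
  have hT' := M.isSimplex hT
  have hprop := bary_eq_smul_of_erase_eq hS' hT' hc h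
  obtain ⟨w, hw⟩ := interior_hull_nonempty hT'
  rw [mem_interior_hull_iff hT'] at hw
  -- the centroid of the common facet
  have hne : (T.erase c).Nonempty := by
    obtain ⟨a, ha, hac⟩ := exists_ne_mem hT' hd c
    exact ⟨a, Finset.mem_erase.2 ⟨hac, ha⟩⟩
  set x := (T.erase c).centroid ℝ id with hx
  have hxT : ∀ a ∈ T, a ≠ c → 0 < bary T a x := by
    intro a ha hac
    rw [hx, bary_centroid hT' (T.erase_subset c) hne ha,
      if_pos (Finset.mem_erase.2 ⟨hac, ha⟩), mul_one]
    exact inv_pos.2 (by exact_mod_cast hne.card_pos)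
  have hxS : ∀ a ∈ S, a ≠ b → 0 < bary S a x := by
    intro a ha hab
    have hmem : a ∈ S.erase b := Finset.mem_erase.2 ⟨hab, ha⟩
    have hne' : (S.erase b).Nonempty := ⟨a, hmem⟩
    rw [hx, ← h, bary_centroid hS' (S.erase_subset b) hne' ha, if_pos hmem, mul_one]
    exact inv_pos.2 (by exact_mod_cast hne'.card_pos)
  have hxc : bary T c x = 0 := by
    rw [hx, bary_centroid hT' (T.erase_subset c) hne hc, if_neg (by simp), mul_zero]
  set X : ℝ → E d := fun t => (1 - t) • x + t • w with hX
  have hbX : ∀ (R : Finset (E d)) (a : E d) (t : ℝ),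
      bary R a (X t) = (1 - t) * bary R a x + t * bary R a w := fun R a t =>
    Convex.combo_affine_apply (by ring)
  have hev : ∀ R : Finset (E d), ∀ e : E d, (∀ a ∈ R, a ≠ e → 0 < bary R a x) →
      ∀ᶠ t in 𝓝[>] (0 : ℝ), ∀ a ∈ R, a ≠ e → 0 < bary R a (X t) := by
    intro R e hR
    rw [Finset.eventually_all]
    intro a ha
    by_cases hae : a = e
    · simp [hae]
    have hc : Continuous fun t => bary R a (X t) :=
      (continuous_affine _).comp (by fun_prop)
    have h0 : (0 : ℝ) < bary R a (X 0) := by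
      rw [hbX]; simpa using hR a ha hae
    filter_upwards [(hc.continuousAt.eventually_const_lt h0).filter_mono nhdsWithin_le_nhds]
      with t ht _ using ht
  obtain ⟨t, h1, h2, h3⟩ := ((hev T c hxT).and ((hev S b hxS).and self_mem_nhdsWithin)).exists
  have ht : 0 < t := h3
  have hcX : 0 < bary T c (X t) := by
    rw [hbX, hxc, mul_zero, zero_add]
    exact mul_pos ht (hw c hc)
  have hbXp : 0 < bary S b (X t) := by
    rw [hprop]
    simpa using mul_pos hpos hcX
  have hXT : X t ∈ hull T := (mem_hull_iff hT').2 fun a ha => by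
    by_cases hac : a = c
    · rw [hac]; exact hcX.le
    · exact (h1 a ha hac).le
  have hXS : X t ∈ hull S := (mem_hull_iff hS').2 fun a ha => by
    by_cases hab : a = b
    · rw [hab]; exact hbXp.le
    · exact (h2 a ha hab).le
  refine Finset.eq_of_subset_of_card_le (fun a ha => ?_)
    (by rw [hS'.card_eq, hT'.card_eq])
  refine M.mem_of_bary_ne hS hT hXS hXT (a := a) (ne_of_gt ?_)
  by_cases hab : a = b
  · rw [hab]; exact hbXp
  · exact h2 a ha hab

/-- The relative interior of a facet that is not part of the boundary lies in `Ω`. -/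
lemma Triangulation.mem_of_relint_facet [DecidableEq (E d)] (M : Triangulation Ω)
    (hΩ : IsBoundedLipschitzDomain Ω) {T : Finset (E d)} (hT : T ∈ M.elems) {c : E d} (hc : c ∈ T)
    (hF : ¬ hull (T.erase c) ⊆ frontier Ω) {x : E d} (hx : x ∈ hull T)
    (hpos : ∀ a ∈ T, a ≠ c → 0 < bary T a x) : x ∈ Ω := by
  obtain ⟨p, hp, hpΓ⟩ := not_subset.1 hF
  rw [hull_erase_eq (M.isSimplex hT) hc] at hp
  refine M.mem_of_support_subset hΩ hT hx hp.1
    (hΩ.mem_of_notMem_frontier (M.hull_subset hT hp.1) hpΓ) fun a ha hne => ?_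
  by_cases hac : a = c
  · rw [hac] at hne; exact absurd hp.2 hne
  · exact (hpos a ha hac).ne'

/-- An interior facet belongs to exactly two elements, on opposite sides; hence the outer normals
of the elements cancel on it. -/
lemma Triangulation.sum_facetN_eq_zero [DecidableEq (E d)] (M : Triangulation Ω)
    (hΩ : IsBoundedLipschitzDomain Ω) (hd : 1 ≤ d) {T : Finset (E d)} (hT : T ∈ M.elems)
    {F : Finset (E d)} (hF : F ∈ T.powersetCard d) (hFΓ : ¬ hull F ⊆ frontier Ω) :
    ∑ S ∈ M.elems with F ⊆ S, facetN S F = 0 := by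
  have hT' := M.isSimplex hT
  obtain ⟨c, hc, rfl⟩ := exists_eq_erase hT'.card_eq hF
  have hne : (T.erase c).Nonempty := by
    obtain ⟨a, ha, hac⟩ := exists_ne_mem hT' hd c
    exact ⟨a, Finset.mem_erase.2 ⟨hac, ha⟩⟩
  set x := (T.erase c).centroid ℝ id with hx
  have hxT : ∀ a ∈ T, a ≠ c → 0 < bary T a x := by
    intro a ha hac
    rw [hx, bary_centroid hT' (T.erase_subset c) hne ha,
      if_pos (Finset.mem_erase.2 ⟨hac, ha⟩), mul_one]
    exact inv_pos.2 (by exact_mod_cast hne.card_pos)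
  have hxc : bary T c x = 0 := by
    rw [hx, bary_centroid hT' (T.erase_subset c) hne hc, if_neg (by simp), mul_zero]
  have hxm : x ∈ hull T := (mem_hull_iff hT').2 fun a ha => by
    by_cases hac : a = c
    · rw [hac, hxc]
    · exact (hxT a ha hac).le
  have hxΩ := M.mem_of_relint_facet hΩ hT hc hFΓ hxm hxT
  -- an element on the other side of the facet
  set n := affGrad (bary T c) with hn
  have hn0 : n ≠ 0 := affGrad_bary_ne_zero hT' hd hc
  have hcont : Tendsto (fun t : ℝ => x - t • n) (𝓝[>] 0) (𝓝 x) := by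
    have : Continuous fun t : ℝ => x - t • n := by fun_prop
    have h := this.tendsto 0
    simp only [zero_smul, sub_zero] at h
    exact h.mono_left nhdsWithin_le_nhds
  obtain ⟨t, h1, h2, h3⟩ := ((hcont.eventually (hΩ.isOpen.mem_nhds hxΩ)).and
    ((hcont.eventually (M.eventually_mem_hull x)).and self_mem_nhdsWithin)).exists
  have ht : 0 < t := h3
  obtain ⟨S, hS, hzS⟩ := M.exists_mem_hull (subset_closure h1)
  have hS' := M.isSimplex hS
  have hxS := h2 S hS hzS
  have hneg : bary T c (x - t • n) < 0 := by
    have := affine_sub_eq (bary T c) (x - t • n) x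
    rw [hxc, sub_zero, sub_sub_cancel_left, inner_neg_right, inner_smul_right, ← hn,
      real_inner_self_eq_norm_sq] at this
    rw [this]
    have : 0 < ‖n‖ ^ 2 := by
      have := norm_pos_iff.2 hn0
      positivity
    nlinarith
  have hST : S ≠ T := by
    rintro rfl
    exact absurd ((mem_hull_iff hS').1 hzS c hc) (not_le.2 hneg)
  have hFS : T.erase c ⊆ S := fun a ha => by
    obtain ⟨hac, haT⟩ := Finset.mem_erase.1 ha
    exact M.mem_of_bary_ne hT hS hxm hxS (hxT a haT hac).ne'
  -- elements with this facet and their opposite vertices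
  have hopp : ∀ R ∈ M.elems, T.erase c ⊆ R → ∃ b ∈ R, R.erase b = T.erase c := by
    intro R hR hFR
    obtain ⟨b, hb, h⟩ := exists_eq_erase (M.card_eq R hR) (F := T.erase c)
      (Finset.mem_powersetCard.2 ⟨hFR, (Finset.mem_powersetCard.1 hF).2⟩)
    exact ⟨b, hb, h.symm⟩
  have hsgn : ∀ R ∈ M.elems, R ≠ T → ∀ b ∈ R, R.erase b = T.erase c → bary R b c < 0 := by
    intro R hR hRT b hb h
    have hprop := bary_eq_smul_of_erase_eq (M.isSimplex hR) hT' hc h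
    rcases lt_trichotomy (bary R b c) 0 with h0 | h0 | h0
    · exact h0
    · rw [h0, zero_smul] at hprop
      have := bary_self (M.isSimplex hR) hb
      rw [hprop] at this
      simp at this
    · exact absurd (M.eq_of_same_side hd hR hT hc h h0) hRT
  obtain ⟨b, hb, hbF⟩ := hopp S hS hFS
  have hset : (M.elems.filter fun S => T.erase c ⊆ S) = {T, S} := by
    ext R
    simp only [Finset.mem_filter, Finset.mem_insert, Finset.mem_singleton]
    constructor
    · rintro ⟨hR, hFR⟩
      by_contra! hcon
      obtain ⟨e, he, heF⟩ := hopp R hR hFR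
      have k1 := hsgn R hR hcon.1 e he heF
      have k2 := hsgn S hS hST b hb hbF
      have k3 := bary_eq_smul_of_erase_eq (M.isSimplex hR) hS' hb (heF.trans hbF.symm)
      have k4 : bary R e c = bary R e b * bary S b c := by
        conv_lhs => rw [k3]
        simp
      refine hcon.2 (M.eq_of_same_side hd hR hS hb (heF.trans hbF.symm) ?_)
      rw [k4] at k1
      by_contra! hle
      nlinarith
    · rintro (rfl | rfl)
      · exact ⟨hT, Finset.erase_subset _ _⟩
      · exact ⟨hS, hFS⟩
  have e1 : facetN S (T.erase c) = outN (bary S b) := by rw [← hbF, facetN_erase hb]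
  rw [hset, Finset.sum_pair hST.symm, facetN_erase hc, e1,
    bary_eq_smul_of_erase_eq hS' hT' hc hbF, outN_smul_neg (hsgn S hS hST b hb hbF),
    add_neg_cancel]

open Classical in
/-- All facets of the elements. -/
def Triangulation.facets (M : Triangulation Ω) : Finset (Finset (E d)) :=
  M.elems.biUnion fun T => T.powersetCard d

lemma Triangulation.sum_elems_facets [DecidableEq (E d)] (M : Triangulation Ω) {A : Type*}
    [AddCommMonoid A] (φ : Finset (E d) → Finset (E d) → A) :
    ∑ T ∈ M.elems, ∑ F ∈ T.powersetCard d, φ T F =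
      ∑ F ∈ M.facets, ∑ T ∈ M.elems with F ⊆ T, φ T F := by
  refine Finset.sum_comm' fun T F => ?_
  simp only [Triangulation.facets, Finset.mem_biUnion, Finset.mem_powersetCard, Finset.mem_filter]
  constructor
  · rintro ⟨hT, hFT, hF⟩
    exact ⟨⟨hT, hFT⟩, T, hT, hFT, hF⟩
  · rintro ⟨⟨hT, hFT⟩, S, hS, hFS, hF⟩
    exact ⟨hT, hFT, hF⟩

/-- The divergence theorem on a simplex. -/
lemma divergence_simplex (hd : 1 ≤ d) {T : Finset (E d)} (hT : IsSimplex T) {g : E d → E d}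
    (hg : ContinuousOn g (hull T)) {D : E d → ℝ} (hD : HasWeakDiv (interior (hull T)) g D)
    (hDi : IntegrableOn D (hull T)) :
    ∫ x in hull T, D x =
      ∑ F ∈ T.powersetCard d, ∫ x in hull F, inner ℝ (g x) (facetN T F) ∂μHE[d - 1] := by
  classical
  have h := divergence_polytope T (fun a => bary T a)
    (fun a ha => affGrad_bary_ne_zero hT hd ha)
    (fun a ha b hb hab => ⟨b, bary_of_ne hT hb hab, by rw [bary_self hT hb]; norm_num⟩)
    (P := hull T) (U := interior (hull T))
    (by ext x; exact mem_hull_iff hT) (by ext x; exact mem_interior_hull_iff hT)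
    (isCompact_hull T) hg hD (hDi.mono_set interior_subset)
  rw [restrict_interior_hull] at h
  rw [h, sum_powersetCard_eq hT.card_eq]
  refine Finset.sum_congr rfl fun c hc => ?_
  rw [facetN_erase hc, hull_erase_eq hT hc]

end Facets

/-! ### Piecewise smooth functions on a triangulation -/

section Piecewise

open Filter Topology

variable {d : ℕ} {Ω : Set (E d)} {M : Triangulation Ω}

/-- Surface integrals over the boundaries of the elements cancel if the fields agree on interior
facets and the scalar factor vanishes on boundary facets. -/
lemma Triangulation.sum_facets_eq_zero (M : Triangulation Ω) (hΩ : IsBoundedLipschitzDomain Ω)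
    (hd : 1 ≤ d) (B : Finset (E d) → E d → E d) (w : E d → ℝ)
    (hB : ∀ F, ¬ hull F ⊆ frontier Ω → ∀ S ∈ M.elems, ∀ T ∈ M.elems, F ⊆ S → F ⊆ T →
      ∀ x ∈ hull F, x ∈ Ω → B S x = B T x)
    (hi : ∀ T ∈ M.elems, ∀ F ∈ T.powersetCard d,
      IntegrableOn (fun x => w x * inner ℝ (B T x) (facetN T F)) (hull F) μHE[d - 1])
    (hw : ∀ T ∈ M.elems, ∀ F ∈ T.powersetCard d, hull F ⊆ frontier Ω →
      ∀ᵐ x ∂(μHE[d - 1]).restrict (hull F), w x = 0) :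
    ∑ T ∈ M.elems, ∑ F ∈ T.powersetCard d,
      ∫ x in hull F, w x * inner ℝ (B T x) (facetN T F) ∂μHE[d - 1] = 0 := by
  classical
  rw [M.sum_elems_facets]
  refine Finset.sum_eq_zero fun F hF => ?_
  obtain ⟨T, hT, hFT⟩ := Finset.mem_biUnion.1 hF
  have hFcard := (Finset.mem_powersetCard.1 hFT).2
  by_cases hFΓ : hull F ⊆ frontier Ω
  · refine Finset.sum_eq_zero fun S _ => ?_
    refine integral_eq_zero_of_ae ?_
    filter_upwards [hw T hT F hFT hFΓ] with x hx
    rw [hx, zero_mul]; rfl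
  rw [← integral_finsetSum]
  · refine integral_eq_zero_of_ae ?_
    have hT' := M.isSimplex hT
    obtain ⟨c, hc, rfl⟩ := exists_eq_erase hT'.card_eq hFT
    filter_upwards [ae_facet hT' hd hc,
      ae_restrict_mem (isCompact_hull (T.erase c)).isClosed.measurableSet] with x hx hxF
    have hxΩ := M.mem_of_relint_facet hΩ hT hc hFΓ hx.2.1 hx.2.2
    have : ∀ S ∈ M.elems.filter fun S => T.erase c ⊆ S,
        w x * inner ℝ (B S x) (facetN S (T.erase c)) =
          w x * inner ℝ (B T x) (facetN S (T.erase c)) := by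
      intro S hS
      obtain ⟨hS, hFS⟩ := Finset.mem_filter.1 hS
      rw [hB _ hFΓ S hS T hT hFS (T.erase_subset c) x hxF hxΩ]
    rw [Finset.sum_congr rfl this, ← Finset.mul_sum, ← inner_sum,
      M.sum_facetN_eq_zero hΩ hd hT hFT hFΓ, inner_zero_right, mul_zero]
    rfl
  · intro S hS
    obtain ⟨hS, hFS⟩ := Finset.mem_filter.1 hS
    exact hi S hS F (Finset.mem_powersetCard.2 ⟨hFS, hFcard⟩)

/-- `w` is continuous on the closure of the domain and smooth on each element. -/
def Triangulation.IsPiecewiseSmooth (M : Triangulation Ω) (w : E d → ℝ) : Prop :=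
  ContinuousOn w (closure Ω) ∧
    ∀ T ∈ M.elems, ∃ wT : E d → ℝ, ContDiff ℝ ∞ wT ∧ EqOn w wT (hull T)

lemma gradient_eq_of_eqOn {w wT : E d → ℝ} {s : Set (E d)} (h : EqOn w wT s) {x : E d}
    (hx : x ∈ interior s) : gradient w x = gradient wT x := by
  have : w =ᶠ[𝓝 x] wT := h.eventuallyEq_of_mem (mem_interior_iff_mem_nhds.1 hx)
  rw [gradient, gradient, this.fderiv_eq]

lemma hasWeakDiv_const (U : Set (E d)) (e : E d) : HasWeakDiv U (fun _ => e) fun _ => 0 := by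
  have h := hasWeakDiv_of_components (U := U) (g := fun _ => e) (G := fun _ _ => 0)
    ((locallyIntegrable_const e).locallyIntegrableOn _)
    (by simpa using (locallyIntegrable_const (0 : ℝ)).locallyIntegrableOn _)
    (fun i => by
      have := hasWeakGrad_of_contDiff U (u := fun _ : E d => e i) contDiff_const
      have h0 : gradient (fun _ : E d => e i) = fun _ => 0 := by
        funext x
        rw [gradient, fderiv_fun_const]
        simp
      rwa [h0] at this)
  simpa using h

lemma integrableOn_union_hull (M : Triangulation Ω) {F : Type*} [NormedAddCommGroup F]
    {f : E d → F} (h : ∀ T ∈ M.elems, IntegrableOn f (hull T)) : IntegrableOn f Ω := by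
  have h1 : IntegrableOn f (⋃ T ∈ M.elems, hull T) :=
    integrableOn_finset_iUnion.2 h
  refine h1.mono_set (subset_closure.trans ?_)
  rw [← M.cover]
  exact subset_rfl

lemma Triangulation.IsPiecewiseSmooth.integrableOn_gradient {w : E d → ℝ}
    (hw : M.IsPiecewiseSmooth w) : IntegrableOn (gradient w) Ω := by
  refine integrableOn_union_hull M fun T hT => ?_
  obtain ⟨wT, hs, he⟩ := hw.2 T hT
  rw [IntegrableOn, ← restrict_interior_hull]
  have h1 : IntegrableOn (gradient wT) (interior (hull T)) :=
    ((continuous_gradient hs).continuousOn.integrableOn_compact (isCompact_hull T)).mono_set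
      interior_subset
  exact h1.congr_fun (fun x hx => (gradient_eq_of_eqOn he hx).symm) isOpen_interior.measurableSet

/-- Integration by parts for a piecewise smooth function and a smooth function whose product
vanishes on the boundary. -/
lemma Triangulation.IsPiecewiseSmooth.integral_by_parts (hΩ : IsBoundedLipschitzDomain Ω)
    (hd : 1 ≤ d) {w : E d → ℝ} (hw : M.IsPiecewiseSmooth w) {φ : E d → ℝ} (hφ : ContDiff ℝ ∞ φ)
    (h0 : ∀ x ∈ frontier Ω, φ x * w x = 0) :
    ∫ x in Ω, w x • gradient φ x = -∫ x in Ω, φ x • gradient w x := by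
  have hcl : IsCompact (closure Ω) := hΩ.isBounded.isCompact_closure
  have i1 : IntegrableOn (fun x => w x • gradient φ x) Ω :=
    ((hw.1.smul (continuous_gradient hφ).continuousOn).integrableOn_compact hcl).mono_set
      subset_closure
  have i2 : IntegrableOn (fun x => φ x • gradient w x) Ω := by
    refine integrableOn_union_hull M fun T hT => ?_
    exact (M.integrableOn_hull hΩ hw.integrableOn_gradient hT).continuousOn_smul
      hφ.continuous.continuousOn (isCompact_hull T)
  have hsum : ∫ x in Ω, (w x • gradient φ x + φ x • gradient w x) = _ :=
    M.setIntegral_eq_sum hΩ (i1.add i2)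
  rw [eq_neg_iff_add_eq_zero, ← integral_add i1 i2, hsum]
  refine ext_inner_left ℝ fun e => ?_
  rw [inner_zero_right, inner_sum]
  have hT : ∀ T ∈ M.elems, inner ℝ e (∫ x in hull T, w x • gradient φ x + φ x • gradient w x) =
      ∑ F ∈ T.powersetCard d, ∫ x in hull F, (φ x * w x) * inner ℝ e (facetN T F) ∂μHE[d - 1] := by
    intro T hT
    obtain ⟨wT, hs, he⟩ := hw.2 T hT
    have hprod : ContDiff ℝ ∞ fun x => φ x * wT x := hφ.mul hs
    have hdiv := (hasWeakDiv_const (interior (hull T)) e).smooth_smul isOpen_interior hprod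
    have hcont : Continuous fun x => inner ℝ e (gradient (fun x => φ x * wT x) x) :=
      continuous_const.inner (continuous_gradient hprod)
    have key := divergence_simplex hd (M.isSimplex hT) (g := fun x => (φ x * wT x) • e)
      (hprod.continuous.smul continuous_const).continuousOn hdiv (by
        simp only [mul_zero, zero_add]
        exact hcont.continuousOn.integrableOn_compact (isCompact_hull T))
    simp only [mul_zero, zero_add] at key
    have i3 : IntegrableOn (fun x => w x • gradient φ x + φ x • gradient w x) (hull T) :=
      M.integrableOn_hull hΩ (i1.add i2) hT
    rw [← integral_inner i3]
    have e1 : ∫ x in hull T, inner ℝ e (w x • gradient φ x + φ x • gradient w x) =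
        ∫ x in hull T, inner ℝ e (gradient (fun x => φ x * wT x) x) := by
      rw [← restrict_interior_hull]
      refine setIntegral_congr_fun isOpen_interior.measurableSet fun x hx => ?_
      rw [gradient_mul hφ hs, gradient_eq_of_eqOn he hx, he (interior_subset hx), add_comm]
    rw [e1, key]
    refine Finset.sum_congr rfl fun F hF => ?_
    have hm : MeasurableSet (hull F) := (isCompact_hull F).isClosed.measurableSet
    refine setIntegral_congr_fun hm fun x hx => ?_
    have hxT : x ∈ hull T :=
      convexHull_mono (by exact_mod_cast (Finset.mem_powersetCard.1 hF).1) hx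
    rw [real_inner_smul_left, he hxT]
  rw [Finset.sum_congr rfl hT]
  refine M.sum_facets_eq_zero hΩ hd (fun _ _ => e) (fun x => φ x * w x)
    (fun _ _ _ _ _ _ _ _ _ _ _ => rfl) (fun T hT F hF => ?_) (fun T _ F _ hFΓ => ?_)
  · refine integrableOn_facet hd (M.isSimplex hT) hF ?_
    refine ContinuousOn.mul (hφ.continuous.continuousOn.mul (hw.1.mono ?_)) continuousOn_const
    exact (convexHull_mono (by exact_mod_cast (Finset.mem_powersetCard.1 hF).1)).trans
      (M.hull_subset hT)
  · filter_upwards [ae_restrict_mem (isCompact_hull F).isClosed.measurableSet] with x hx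
      using h0 x (hFΓ hx)

lemma Triangulation.IsPiecewiseSmooth.integrableOn (hΩ : IsBoundedLipschitzDomain Ω)
    {w : E d → ℝ} (hw : M.IsPiecewiseSmooth w) : IntegrableOn w Ω :=
  (hw.1.integrableOn_compact hΩ.isBounded.isCompact_closure).mono_set subset_closure

/-- A piecewise smooth function has its piecewise gradient as weak gradient. -/
lemma Triangulation.IsPiecewiseSmooth.hasWeakGrad (hΩ : IsBoundedLipschitzDomain Ω)
    (hd : 1 ≤ d) {w : E d → ℝ} (hw : M.IsPiecewiseSmooth w) : HasWeakGrad Ω w (gradient w) := by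
  refine ⟨(hw.integrableOn hΩ).locallyIntegrableOn,
    hw.integrableOn_gradient.locallyIntegrableOn, fun φ hφ => ?_⟩
  refine hw.integral_by_parts hΩ hd hφ.1 fun x hx => ?_
  rw [hΩ.isOpen.frontier_eq] at hx
  have h : φ x = 0 := image_eq_zero_of_notMem_tsupport fun h => hx.2 (hφ.2.2 h)
  rw [h, zero_mul]

/-- The extension by zero of a piecewise smooth function with zero boundary values has a weak
gradient on the whole space. -/
lemma Triangulation.IsPiecewiseSmooth.hasWeakGrad_indicator (hΩ : IsBoundedLipschitzDomain Ω)
    (hd : 1 ≤ d) {w : E d → ℝ} (hw : M.IsPiecewiseSmooth w) (h0 : ∀ x ∈ frontier Ω, w x = 0) :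
    HasWeakGrad univ (Ω.indicator w) (Ω.indicator (gradient w)) := by
  have hm := hΩ.isOpen.measurableSet
  refine ⟨((integrable_indicator_iff hm).2
    (hw.integrableOn hΩ)).locallyIntegrable.locallyIntegrableOn _,
    ((integrable_indicator_iff hm).2
    hw.integrableOn_gradient).locallyIntegrable.locallyIntegrableOn _, fun φ hφ => ?_⟩
  have key := hw.integral_by_parts hΩ hd hφ.1 fun x hx => by rw [h0 x hx, mul_zero]
  rw [← integral_indicator hm, ← integral_indicator hm] at key
  rw [setIntegral_univ, setIntegral_univ]
  have e1 : (fun x => Ω.indicator w x • gradient φ x) =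
      Ω.indicator fun x => w x • gradient φ x := by
    funext x
    by_cases hx : x ∈ Ω <;> simp [hx]
  have e2 : (fun x => φ x • Ω.indicator (gradient w) x) =
      Ω.indicator fun x => φ x • gradient w x := by
    funext x
    by_cases hx : x ∈ Ω <;> simp [hx]
  rw [e1, e2, key]

/-- Almost every point lies in the interior of an element. -/
lemma Triangulation.ae_mem_interior (M : Triangulation Ω) (hΩ : IsBoundedLipschitzDomain Ω) :
    ∀ᵐ x ∂volume.restrict Ω, ∃ T ∈ M.elems, x ∈ interior (hull T) := by
  have h0 : volume (⋃ T ∈ M.elems, frontier (hull T)) = 0 :=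
    (measure_biUnion_null_iff M.elems.countable_toSet).2 fun T _ => volume_frontier_hull T
  filter_upwards [ae_restrict_mem hΩ.isOpen.measurableSet,
    ae_restrict_of_ae (measure_eq_zero_iff_ae_notMem.1 h0)] with x hx hxn
  obtain ⟨T, hT, hxT⟩ := M.exists_mem_hull (subset_closure hx)
  refine ⟨T, hT, ?_⟩
  by_contra h
  refine hxn (mem_iUnion₂.2 ⟨T, hT, ?_⟩)
  rw [(isCompact_hull T).isClosed.frontier_eq]
  exact ⟨hxT, h⟩

/-- Piecewise gradients are bounded. -/
lemma Triangulation.IsPiecewiseSmooth.exists_bound {w : E d → ℝ} (hΩ : IsBoundedLipschitzDomain Ω)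
    (hw : M.IsPiecewiseSmooth w) : ∃ C, 0 ≤ C ∧ ∀ᵐ x ∂volume.restrict Ω, ‖gradient w x‖ ≤ C := by
  classical
  have : ∀ T : M.elems, ∃ C, ∀ x ∈ interior (hull T.1), ‖gradient w x‖ ≤ C := by
    intro T
    obtain ⟨wT, hs, he⟩ := hw.2 T.1 T.2
    obtain ⟨C, hC⟩ := (isCompact_hull T.1).exists_bound_of_continuousOn
      (continuous_gradient hs).continuousOn
    exact ⟨C, fun x hx => by rw [gradient_eq_of_eqOn he hx]; exact hC x (interior_subset hx)⟩
  choose C hC using this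
  refine ⟨∑ T, |C T|, Finset.sum_nonneg fun _ _ => abs_nonneg _, ?_⟩
  filter_upwards [M.ae_mem_interior hΩ] with x hx
  obtain ⟨T, hT, hxT⟩ := hx
  refine (hC ⟨T, hT⟩ x hxT).trans ((le_abs_self _).trans ?_)
  exact Finset.single_le_sum (f := fun T => |C T|) (fun _ _ => abs_nonneg _) (Finset.mem_univ _)

end Piecewise

/-! ### Piecewise affine functions with zero boundary values belong to `H¹₀` -/

section SobolevZero

open Filter Topology

variable {d : ℕ} {Ω : Set (E d)} {M : Triangulation Ω}

/-- A smooth function which vanishes near `0` and is the identity far from `0`. -/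
def shrink (s : ℝ) : ℝ := s * cutoff (s ^ 2)

/-- Smooth truncations at height `1 / (n + 1)`. -/
def trunc (n : ℕ) (s : ℝ) : ℝ := ((n : ℝ) + 1)⁻¹ * shrink (((n : ℝ) + 1) * s)

lemma contDiff_shrink : ContDiff ℝ ∞ shrink :=
  contDiff_id.mul (contDiff_cutoff.comp (contDiff_id.pow 2))

lemma contDiff_trunc (n : ℕ) : ContDiff ℝ ∞ (trunc n) :=
  contDiff_const.mul (contDiff_shrink.comp (contDiff_const.mul contDiff_id))

lemma trunc_of_abs_le {n : ℕ} {s : ℝ} (h : |s| ≤ ((n : ℝ) + 1)⁻¹) : trunc n s = 0 := by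
  have hn : (0 : ℝ) < (n : ℝ) + 1 := by positivity
  have : ((((n : ℝ) + 1) * s) ^ 2) ≤ 1 := by
    rw [← sq_abs, abs_mul, abs_of_pos hn]
    have h1 : ((n : ℝ) + 1) * |s| ≤ 1 := by
      have := mul_le_mul_of_nonneg_left h hn.le
      rwa [mul_inv_cancel₀ hn.ne'] at this
    have h2 : 0 ≤ ((n : ℝ) + 1) * |s| := by positivity
    nlinarith
  rw [trunc, shrink, cutoff_of_le this, mul_zero, mul_zero]

lemma trunc_of_le_abs {n : ℕ} {s : ℝ} (h : 2 * ((n : ℝ) + 1)⁻¹ ≤ |s|) : trunc n s = s := by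
  have hn : (0 : ℝ) < (n : ℝ) + 1 := by positivity
  have : 2 ≤ ((((n : ℝ) + 1) * s) ^ 2) := by
    rw [← sq_abs, abs_mul, abs_of_pos hn]
    have h1 : 2 ≤ ((n : ℝ) + 1) * |s| := by
      have := mul_le_mul_of_nonneg_left h hn.le
      rwa [mul_left_comm, mul_inv_cancel₀ hn.ne', mul_one] at this
    nlinarith
  rw [trunc, shrink, cutoff_of_ge this, mul_one, inv_mul_cancel_left₀ hn.ne']

lemma abs_trunc_le (n : ℕ) (s : ℝ) : |trunc n s| ≤ |s| := by
  have hn : (0 : ℝ) < (n : ℝ) + 1 := by positivity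
  rw [trunc, shrink, ← mul_assoc, inv_mul_cancel_left₀ hn.ne', abs_mul,
    abs_of_nonneg (cutoff_nonneg _)]
  exact mul_le_of_le_one_right (abs_nonneg _) (cutoff_le_one _)

lemma abs_trunc_sub_le (n : ℕ) (s : ℝ) : |trunc n s - s| ≤ 2 * ((n : ℝ) + 1)⁻¹ := by
  have hn : (0 : ℝ) < (n : ℝ) + 1 := by positivity
  by_cases h : 2 * ((n : ℝ) + 1)⁻¹ ≤ |s|
  · rw [trunc_of_le_abs h, sub_self, abs_zero]; positivity
  · push Not at h
    refine le_trans ?_ h.le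
    rw [trunc, shrink, ← mul_assoc, inv_mul_cancel_left₀ hn.ne', ← mul_sub_one, abs_mul]
    refine mul_le_of_le_one_right (abs_nonneg _) ?_
    rw [abs_le]
    constructor <;> linarith [cutoff_nonneg ((((n : ℝ) + 1) * s) ^ 2),
      cutoff_le_one ((((n : ℝ) + 1) * s) ^ 2)]

lemma deriv_trunc (n : ℕ) (s : ℝ) : deriv (trunc n) s = deriv shrink (((n : ℝ) + 1) * s) := by
  have hn : (n : ℝ) + 1 ≠ 0 := by positivity
  have h1 : HasDerivAt (trunc n) (((n : ℝ) + 1)⁻¹ *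
      (deriv shrink (((n : ℝ) + 1) * s) * (((n : ℝ) + 1) * 1))) s :=
    (((contDiff_shrink.differentiable (by simp)).differentiableAt).hasDerivAt.comp s
      ((hasDerivAt_id s).const_mul _)).const_mul _
  rw [h1.deriv]
  field_simp

lemma deriv_shrink_eq_one {s : ℝ} (h : 2 ≤ |s|) : deriv shrink s = 1 := by
  have hlt : 2 < s ^ 2 := by
    rw [← sq_abs]; nlinarith
  have : shrink =ᶠ[𝓝 s] id := by
    have hc : Continuous fun s : ℝ => s ^ 2 := by fun_prop
    filter_upwards [hc.continuousAt.eventually_const_lt hlt] with t ht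
    rw [shrink, cutoff_of_ge ht.le, mul_one]; rfl
  rw [this.deriv_eq, deriv_id]

lemma exists_bound_deriv_trunc : ∃ C, 0 ≤ C ∧ ∀ n s, |deriv (trunc n) s| ≤ C := by
  obtain ⟨C, hC⟩ := (isCompact_Icc (a := (-2 : ℝ)) (b := 2)).exists_bound_of_continuousOn
    (contDiff_shrink.continuous_deriv (by simp)).continuousOn
  refine ⟨max C 1, by positivity, fun n s => ?_⟩
  rw [deriv_trunc]
  by_cases h : 2 ≤ |((n : ℝ) + 1) * s|
  · rw [deriv_shrink_eq_one h, abs_one]; exact le_max_right _ _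
  · push Not at h
    exact (hC _ (abs_le.1 h.le)).trans (le_max_left _ _)

lemma gradient_comp {θ : ℝ → ℝ} (hθ : ContDiff ℝ ∞ θ) {w : E d → ℝ} {x : E d}
    (hw : DifferentiableAt ℝ w x) : gradient (fun x => θ (w x)) x = deriv θ (w x) • gradient w x := by
  have h := ((hθ.differentiable (by simp)).differentiableAt (x := w x)).hasDerivAt.comp_hasFDerivAt
    x hw.hasFDerivAt
  have h2 : fderiv ℝ (fun x => θ (w x)) x = _ := h.fderiv
  rw [gradient, gradient, h2]
  simp

lemma Triangulation.MemS1.isPiecewiseSmooth {v : E d → ℝ} (hv : M.MemS1 v) :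
    M.IsPiecewiseSmooth v :=
  ⟨hv.1, fun T hT => by
    obtain ⟨l, hl⟩ := hv.2 T hT
    exact ⟨l, contDiff_affine l, hl⟩⟩

lemma gradient_of_eqOn_affine {v : E d → ℝ} {l : E d →ᵃ[ℝ] ℝ} {s : Set (E d)} (h : EqOn v l s)
    {x : E d} (hx : x ∈ interior s) : gradient v x = affGrad l := by
  rw [gradient_eq_of_eqOn h hx]
  exact (hasGradientAt_affine l x).gradient

lemma Triangulation.MemS1.trunc {v : E d → ℝ} (hv : M.MemS1 v) (n : ℕ) :
    M.IsPiecewiseSmooth fun x => FVM.trunc n (v x) :=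
  ⟨(contDiff_trunc n).continuous.comp_continuousOn hv.1, fun T hT => by
    obtain ⟨l, hl⟩ := hv.2 T hT
    exact ⟨fun x => FVM.trunc n (l x), (contDiff_trunc n).comp (contDiff_affine l),
      fun x hx => by simp only [hl hx]⟩⟩

lemma gradient_trunc {v : E d → ℝ} {l : E d →ᵃ[ℝ] ℝ} {s : Set (E d)} (h : EqOn v l s) (n : ℕ)
    {x : E d} (hx : x ∈ interior s) :
    gradient (fun x => trunc n (v x)) x = deriv (trunc n) (v x) • affGrad l := by
  have h1 : EqOn (fun x => trunc n (v x)) (fun x => trunc n (l x)) s :=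
    fun y hy => by simp only [h hy]
  rw [gradient_eq_of_eqOn h1 hx, gradient_comp (contDiff_trunc n)
    ((contDiff_affine l (n := ∞)).differentiable (by simp) x), h (interior_subset hx),
    (hasGradientAt_affine l x).gradient]

open scoped Convolution in
/-- A function of `S¹₀` is approximated, boundedly and almost everywhere together with its gradient,
by test functions: mollify the truncations of the function away from its zero set. -/
lemma Triangulation.MemS10.exists_approx (hΩ : IsBoundedLipschitzDomain Ω) (hd : 1 ≤ d)
    {v : E d → ℝ} (hv : M.MemS10 v) : ∃ (f : ℕ → E d → ℝ) (C : ℝ),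
      (∀ n, IsTestFun Ω (f n)) ∧ (∀ n x, |f n x| ≤ C) ∧ (∀ n x, ‖gradient (f n) x‖ ≤ C) ∧
      ∀ᵐ x ∂volume.restrict Ω, Tendsto (fun n => f n x) atTop (𝓝 (v x)) ∧
        Tendsto (fun n => gradient (f n) x) atTop (𝓝 (gradient v x)) := by
  classical
  obtain ⟨hv1, hv0⟩ := hv
  have hcl : IsCompact (closure Ω) := hΩ.isBounded.isCompact_closure
  obtain ⟨B, hB⟩ := hcl.exists_bound_of_continuousOn hv1.1
  obtain ⟨C1, hC1, hgrad⟩ := hv1.isPiecewiseSmooth.exists_bound hΩ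
  obtain ⟨C2, hC2, hder⟩ := exists_bound_deriv_trunc
  set w : ℕ → E d → ℝ := fun n x => trunc n (v x) with hw
  have hws : ∀ n, M.IsPiecewiseSmooth (w n) := fun n => hv1.trunc n
  have hpos : ∀ n : ℕ, (0 : ℝ) < ((n : ℝ) + 1)⁻¹ := fun n => by positivity
  have hw0 : ∀ n, ∀ x ∈ frontier Ω, w n x = 0 := fun n x hx =>
    trunc_of_abs_le (by rw [hv0 x hx, abs_zero]; exact (hpos n).le)
  have hGw : ∀ n, HasWeakGrad univ (Ω.indicator (w n)) (Ω.indicator (gradient (w n))) := fun n =>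
    (hws n).hasWeakGrad_indicator hΩ hd (hw0 n)
  -- the truncations are supported in compact subsets of `Ω`
  set K : ℕ → Set (E d) := fun n => {x ∈ closure Ω | ((n : ℝ) + 1)⁻¹ ≤ |v x|} with hK
  have hKc : ∀ n, IsCompact (K n) := by
    intro n
    have : K n = closure Ω ∩ (fun x => |v x|) ⁻¹' Ici ((n : ℝ) + 1)⁻¹ := rfl
    rw [this]
    exact hcl.of_isClosed_subset
      ((continuous_abs.comp_continuousOn hv1.1).preimage_isClosed_of_isClosed isClosed_closure
        isClosed_Ici) inter_subset_left
  have hKΩ : ∀ n, K n ⊆ Ω := by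
    intro n x hx
    refine hΩ.mem_of_notMem_frontier hx.1 fun hxΓ => ?_
    have h1 := hx.2
    rw [hv0 x hxΓ, abs_zero] at h1
    exact absurd h1 (not_le.2 (hpos n))
  choose δ hδ hδΩ using fun n => (hKc n).exists_cthickening_subset_open hΩ.isOpen (hKΩ n)
  set φ : ℕ → ContDiffBump (0 : E d) := fun n =>
    { rIn := min (δ n) ((n : ℝ) + 1)⁻¹ / 2
      rOut := min (δ n) ((n : ℝ) + 1)⁻¹
      rIn_pos := half_pos (lt_min (hδ n) (hpos n))
      rIn_lt_rOut := half_lt_self (lt_min (hδ n) (hpos n)) } with hφ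
  have hφ0 : Tendsto (fun n => (φ n).rOut) atTop (𝓝 0) := by
    have h := tendsto_one_div_add_atTop_nhds_zero_nat (𝕜 := ℝ)
    refine squeeze_zero (fun n => (φ n).rOut_pos.le) (fun n => ?_) h
    rw [one_div]
    exact min_le_right _ _
  set f : ℕ → E d → ℝ := fun n =>
    (φ n).normed volume ⋆[ContinuousLinearMap.lsmul ℝ ℝ, volume] (Ω.indicator (w n)) with hf
  have hIl : ∀ n, LocallyIntegrable (Ω.indicator (w n)) := fun n =>
    ((integrable_indicator_iff hΩ.isOpen.measurableSet).2
      ((hws n).integrableOn hΩ)).locallyIntegrable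
  have hfg : ∀ n z, HasGradientAt (f n)
      (∫ y, (φ n).normed volume (z - y) • Ω.indicator (gradient (w n)) y) z := by
    intro n z
    have := hasGradientAt_convolution (hGw n) (by rw [indicator_univ]; exact hIl n) isOpen_univ
      ((φ n).contDiff_normed (μ := volume)) ((φ n).hasCompactSupport_normed (μ := volume)) (z := z) (fun _ _ => mem_univ _)
    rwa [indicator_univ, setIntegral_univ] at this
  have hwz : ∀ n y, y ∉ K n → Ω.indicator (w n) y = 0 := by
    intro n y hy
    by_cases hyΩ : y ∈ Ω
    · rw [indicator_of_mem hyΩ]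
      refine trunc_of_abs_le ?_
      by_contra! h
      exact hy ⟨subset_closure hyΩ, h.le⟩
    · exact indicator_of_notMem hyΩ _
  have hwB : ∀ n, ∀ᵐ y ∂volume.restrict univ, ‖Ω.indicator (w n) y‖ ≤ max B 0 := by
    intro n
    refine Eventually.of_forall fun y => ?_
    by_cases hyΩ : y ∈ Ω
    · rw [indicator_of_mem hyΩ]
      exact (abs_trunc_le _ _).trans ((hB y (subset_closure hyΩ)).trans (le_max_left _ _))
    · rw [indicator_of_notMem hyΩ, norm_zero]; exact le_max_right _ _
  have hgB : ∀ n, ∀ᵐ y ∂volume.restrict univ, ‖Ω.indicator (gradient (w n)) y‖ ≤ C2 * C1 := by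
    intro n
    rw [Measure.restrict_univ]
    have h1 := (ae_restrict_iff' hΩ.isOpen.measurableSet).1 hgrad
    have h2 := (ae_restrict_iff' hΩ.isOpen.measurableSet).1 (M.ae_mem_interior hΩ)
    filter_upwards [h1, h2] with y hy1 hy2
    by_cases hyΩ : y ∈ Ω
    · rw [indicator_of_mem hyΩ]
      obtain ⟨T, hT, hyT⟩ := hy2 hyΩ
      obtain ⟨l, hl⟩ := hv1.2 T hT
      have h3 := hy1 hyΩ
      rw [gradient_of_eqOn_affine hl hyT] at h3
      rw [hw, gradient_trunc hl n hyT, norm_smul]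
      exact mul_le_mul (hder _ _) h3 (norm_nonneg _) hC2
    · rw [indicator_of_notMem hyΩ, norm_zero]; positivity
  refine ⟨f, max (max B 0) (C2 * C1), fun n => ?_, fun n x => ?_, fun n x => ?_, ?_⟩
  · have hsupp : Function.support (f n) ⊆ Metric.cthickening (δ n) (K n) := by
      intro z hz
      by_contra hzn
      refine hz ?_
      rw [hf]
      simp only
      rw [convolution_eq_swap]
      refine integral_eq_zero_of_ae (Eventually.of_forall fun y => ?_)
      by_cases hy : y ∈ K n
      · have : (φ n).normed volume (z - y) = 0 := by
          by_contra h
          have h1 : z - y ∈ Metric.ball (0 : E d) (φ n).rOut := by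
            rw [← (φ n).support_normed_eq (μ := volume)]; exact h
          rw [mem_ball_zero_iff] at h1
          refine hzn (Metric.mem_cthickening_of_dist_le z y _ _ hy ?_)
          rw [dist_eq_norm]
          exact h1.le.trans (min_le_left _ _)
        simp [this]
      · simp [hwz n y hy]
    have hts : tsupport (f n) ⊆ Metric.cthickening (δ n) (K n) :=
      closure_minimal hsupp Metric.isClosed_cthickening
    refine ⟨?_, (hKc n).cthickening.of_isClosed_subset (isClosed_tsupport _) hts,
      hts.trans (hδΩ n)⟩
    exact (φ n).hasCompactSupport_normed.contDiff_convolution_left _ (φ n).contDiff_normed (hIl n)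
  · refine le_trans ?_ (le_max_left _ _)
    have := norm_setIntegral_bump_le (φ n) (le_max_right B 0) (hwB n) x
    rw [setIntegral_univ] at this
    rw [hf]
    simp only
    rw [convolution_eq_swap]
    exact this
  · refine le_trans ?_ (le_max_right _ _)
    rw [(hfg n x).gradient]
    have := norm_setIntegral_bump_le (φ n) (mul_nonneg hC2 hC1) (hgB n) x
    rwa [setIntegral_univ] at this
  · have hae : ∀ᵐ x ∂volume.restrict Ω, ∀ T ∈ M.elems, ∀ l : E d →ᵃ[ℝ] ℝ, EqOn v l (hull T) →
        x ∈ hull T → affGrad l ≠ 0 → v x ≠ 0 := by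
      rw [Finset.eventually_all]
      intro T hT
      obtain ⟨l, hl⟩ := hv1.2 T hT
      have hgr : ∀ l' : E d →ᵃ[ℝ] ℝ, EqOn v l' (hull T) → affGrad l' = affGrad l := by
        intro l' hl'
        obtain ⟨y, hy⟩ := interior_hull_nonempty (M.isSimplex hT)
        rw [← gradient_of_eqOn_affine hl' hy, gradient_of_eqOn_affine hl hy]
      by_cases h0 : affGrad l = 0
      · refine Eventually.of_forall fun x l' hl' _ hne => absurd ?_ hne
        rw [hgr l' hl', h0]
      · have hex : ∃ y, l y ≠ 0 := by
          by_contra! hall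
          refine h0 (ext_inner_right ℝ fun y => ?_)
          have := affine_sub_eq l y 0
          rw [hall, hall, sub_zero, sub_zero] at this
          rw [← this, inner_zero_left]
        have := measure_eq_zero_iff_ae_notMem.1 (measure_affine_eq_zero volume l hex)
        filter_upwards [ae_restrict_of_ae this] with x hx l' hl' hxT _
        rw [hl hxT]; exact hx
    filter_upwards [hae, M.ae_mem_interior hΩ, ae_restrict_mem hΩ.isOpen.measurableSet]
      with x hx hxi hxΩ
    obtain ⟨T, hT, hxT⟩ := hxi
    obtain ⟨l, hl⟩ := hv1.2 T hT
    have hn0 : Tendsto (fun n : ℕ => 2 * ((n : ℝ) + 1)⁻¹) atTop (𝓝 0) := by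
      have h := (tendsto_one_div_add_atTop_nhds_zero_nat (𝕜 := ℝ)).const_mul 2
      simpa [one_div] using h
    have hvc : Tendsto v (𝓝 x) (𝓝 (v x)) :=
      (hv1.1.mono subset_closure).continuousAt (hΩ.isOpen.mem_nhds hxΩ)
    constructor
    · refine ContDiffBump.convolution_tendsto_right hφ0
        (Eventually.of_forall fun n => (hIl n).aestronglyMeasurable) ?_ tendsto_const_nhds
      have h1 : Tendsto (fun p : ℕ × E d => v p.2) (atTop ×ˢ 𝓝 x) (𝓝 (v x)) :=
        hvc.comp tendsto_snd
      have h2 : Tendsto (fun p : ℕ × E d => 2 * ((p.1 : ℝ) + 1)⁻¹) (atTop ×ˢ 𝓝 x) (𝓝 0) :=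
        hn0.comp tendsto_fst
      rw [tendsto_iff_dist_tendsto_zero] at h1 ⊢
      refine squeeze_zero' (Eventually.of_forall fun _ => dist_nonneg) ?_
        (by simpa using h2.add h1)
      filter_upwards [tendsto_snd.eventually (hΩ.isOpen.mem_nhds hxΩ)] with p hp
      refine (dist_triangle _ (v p.2) _).trans (add_le_add_left ?_ _)
      simp only [Function.uncurry]
      rw [indicator_of_mem hp, Real.dist_eq]
      exact abs_trunc_sub_le _ _
    · have e : ∀ n, gradient (f n) x = ((φ n).normed volume
          ⋆[ContinuousLinearMap.lsmul ℝ ℝ, volume] (Ω.indicator (gradient (w n)))) x := by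
        intro n
        rw [(hfg n x).gradient, convolution_eq_swap]
        rfl
      simp only [e]
      refine ContDiffBump.convolution_tendsto_right hφ0
        (Eventually.of_forall fun n => (((integrable_indicator_iff hΩ.isOpen.measurableSet).2
          (hws n).integrableOn_gradient).aestronglyMeasurable)) ?_ tendsto_const_nhds
      rw [gradient_of_eqOn_affine hl hxT]
      refine tendsto_const_nhds.congr' ?_
      have hin : ∀ᶠ p : ℕ × E d in atTop ×ˢ 𝓝 x, p.2 ∈ interior (hull T) ∧ p.2 ∈ Ω :=
        tendsto_snd.eventually
          ((isOpen_interior.eventually_mem hxT).and (hΩ.isOpen.eventually_mem hxΩ))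
      by_cases h0 : affGrad l = 0
      · filter_upwards [hin] with p hp
        simp only [Function.uncurry]
        rw [indicator_of_mem hp.2, hw, gradient_trunc hl _ hp.1, h0, smul_zero]
      · have hvx : v x ≠ 0 := hx T hT l hl (interior_subset hxT) h0
        have h1 : Tendsto (fun p : ℕ × E d => |v p.2|) (atTop ×ˢ 𝓝 x) (𝓝 |v x|) :=
          (hvc.comp tendsto_snd).abs
        have h2 : Tendsto (fun p : ℕ × E d => 2 * ((p.1 : ℝ) + 1)⁻¹) (atTop ×ˢ 𝓝 x) (𝓝 0) :=
          hn0.comp tendsto_fst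
        filter_upwards [hin, h2.eventually_lt h1 (abs_pos.2 hvx)] with p hp hlt
        simp only [Function.uncurry]
        have hpn : (0 : ℝ) < (p.1 : ℝ) + 1 := by positivity
        rw [indicator_of_mem hp.2, hw, gradient_trunc hl _ hp.1, deriv_trunc,
          deriv_shrink_eq_one, one_smul]
        rw [abs_mul, abs_of_pos hpn]
        have := mul_le_mul_of_nonneg_left hlt.le hpn.le
        rwa [mul_left_comm, mul_inv_cancel₀ hpn.ne', mul_one] at this

end SobolevZero

section SobolevZeroMem

open Filter Topology

variable {d : ℕ} {Ω : Set (E d)} {M : Triangulation Ω}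

lemma IsBoundedLipschitzDomain.isFiniteMeasure_restrict (hΩ : IsBoundedLipschitzDomain Ω) :
    IsFiniteMeasure (volume.restrict Ω) :=
  ⟨by rw [Measure.restrict_apply_univ]; exact hΩ.isBounded.measure_lt_top⟩

/-- A piecewise smooth function belongs to `L^∞`, together with its gradient. -/
lemma Triangulation.IsPiecewiseSmooth.memLp (hΩ : IsBoundedLipschitzDomain Ω) {w : E d → ℝ}
    (hw : M.IsPiecewiseSmooth w) (p : ENNReal) : MemLp w p (volume.restrict Ω) := by
  have := hΩ.isFiniteMeasure_restrict
  obtain ⟨B, hB⟩ := hΩ.isBounded.isCompact_closure.exists_bound_of_continuousOn hw.1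
  refine MemLp.of_bound (hw.integrableOn hΩ).aestronglyMeasurable B ?_
  filter_upwards [ae_restrict_mem hΩ.isOpen.measurableSet] with x hx using hB x (subset_closure hx)

lemma Triangulation.IsPiecewiseSmooth.memLp_gradient (hΩ : IsBoundedLipschitzDomain Ω)
    {w : E d → ℝ} (hw : M.IsPiecewiseSmooth w) (p : ENNReal) :
    MemLp (gradient w) p (volume.restrict Ω) := by
  have := hΩ.isFiniteMeasure_restrict
  obtain ⟨C, _, hC⟩ := hw.exists_bound hΩ
  exact MemLp.of_bound hw.integrableOn_gradient.aestronglyMeasurable C hC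

lemma tendsto_integral_norm_sq_sub {F : Type*} [NormedAddCommGroup F] {μ : Measure (E d)}
    [IsFiniteMeasure μ] {g : E d → F} {G : ℕ → E d → F} {C : ℝ}
    (hg : AEStronglyMeasurable g μ) (hG : ∀ n, AEStronglyMeasurable (G n) μ)
    (hb : ∀ n, ∀ᵐ x ∂μ, ‖G n x‖ ≤ C)
    (hl : ∀ᵐ x ∂μ, Tendsto (fun n => G n x) atTop (𝓝 (g x))) :
    Tendsto (fun n => ∫ x, ‖g x - G n x‖ ^ 2 ∂μ) atTop (𝓝 0) := by
  have hgb : ∀ᵐ x ∂μ, ‖g x‖ ≤ C := by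
    filter_upwards [hl, ae_all_iff.2 hb] with x hx hbx
    exact le_of_tendsto hx.norm (Eventually.of_forall hbx)
  have h0 : (0 : ℝ) = ∫ x, (0 : ℝ) ∂μ := by simp
  rw [h0]
  refine tendsto_integral_of_dominated_convergence (fun _ => (C + C) ^ 2)
    (fun n => ((hg.sub (hG n)).norm.pow 2)) (integrable_const _) (fun n => ?_) ?_
  · filter_upwards [hgb, hb n] with x h1 h2
    rw [norm_pow, norm_norm]
    have := (norm_sub_le (g x) (G n x)).trans (add_le_add h1 h2)
    gcongr
  · filter_upwards [hl] with x hx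
    have h := ((tendsto_const_nhds (x := g x)).sub hx).norm.pow 2
    simpa using h

lemma Triangulation.IsPiecewiseSmooth.memH1 (hΩ : IsBoundedLipschitzDomain Ω) (hd : 1 ≤ d)
    {w : E d → ℝ} (hw : M.IsPiecewiseSmooth w) : MemH1 Ω w :=
  ⟨hw.memLp hΩ 2, gradient w, hw.hasWeakGrad hΩ hd, hw.memLp_gradient hΩ 2⟩

/-- `S¹₀(𝒯) ⊆ H¹₀(Ω)`. -/
lemma Triangulation.MemS10.memH10 (hΩ : IsBoundedLipschitzDomain Ω) (hd : 1 ≤ d) {v : E d → ℝ}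
    (hv : M.MemS10 v) : MemH10 Ω v := by
  have hw := hv.1.isPiecewiseSmooth
  refine ⟨hw.memH1 hΩ hd, fun ε hε => ?_⟩
  have := hΩ.isFiniteMeasure_restrict
  obtain ⟨f, C, hf, hb, hgb, hlim⟩ := hv.exists_approx hΩ hd
  have h1 := tendsto_integral_norm_sq_sub (μ := volume.restrict Ω) (g := v) (G := f)
    (hw.integrableOn hΩ).aestronglyMeasurable
    (fun n => (hf n).1.continuous.aestronglyMeasurable)
    (fun n => Eventually.of_forall (hb n)) (hlim.mono fun _ h => h.1)
  have h2 := tendsto_integral_norm_sq_sub (μ := volume.restrict Ω) (g := gradient v)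
    (G := fun n => gradient (f n)) hw.integrableOn_gradient.aestronglyMeasurable
    (fun n => (continuous_gradient (hf n).1).aestronglyMeasurable)
    (fun n => Eventually.of_forall (hgb n)) (hlim.mono fun _ h => h.2)
  have h3 : Tendsto (fun n => H1norm Ω (v - f n)) atTop (𝓝 0) := by
    have h4 := (h1.add h2).sqrt
    rw [add_zero, Real.sqrt_zero] at h4
    refine h4.congr fun n => ?_
    rw [H1norm]
    congr 2
    · refine integral_congr_ae (Eventually.of_forall fun x => ?_)
      simp [Real.norm_eq_abs, sq_abs]
    · have hG := ((hw.hasWeakGrad hΩ hd).sub (hasWeakGrad_of_contDiff Ω (hf n).1))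
      have h5 := HasWeakGrad.weakGrad_ae_eq hΩ.isOpen hG
      refine integral_congr_ae ?_
      filter_upwards [h5] with x hx
      have : weakGrad Ω (v - f n) x = gradient v x - gradient (f n) x := hx
      rw [this]
  obtain ⟨n, hn⟩ := (h3.eventually_lt_const hε).exists
  exact ⟨f n, hf n, hn⟩

end SobolevZeroMem

/-! ### The barycentric dual mesh -/

section DualMesh

open Filter Topology

variable {d : ℕ} {Ω : Set (E d)} {M : Triangulation Ω}

lemma affine_sub_apply (l m : E d →ᵃ[ℝ] ℝ) (x : E d) : (l - m) x = l x - m x := rfl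

/-- The barycentric coordinate of `a` is the strictly largest one at the point `x` of the
simplex. -/
def IsStrictMax (T : Finset (E d)) (a x : E d) : Prop :=
  a ∈ T ∧ x ∈ hull T ∧ ∀ b ∈ T, b ≠ a → bary T b x < bary T a x

lemma bary_pos_of_max {T : Finset (E d)} (hT : IsSimplex T) {a x : E d}
    (h : ∀ b ∈ T, bary T b x ≤ bary T a x) : 0 < bary T a x := by
  by_contra! h0
  have h1 := sum_bary hT x
  have h2 : ∑ b ∈ T, bary T b x ≤ 0 := Finset.sum_nonpos fun b hb => (h b hb).trans h0
  linarith

lemma IsStrictMax.le {T : Finset (E d)} {a x : E d} (h : IsStrictMax T a x) :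
    ∀ b ∈ T, bary T b x ≤ bary T a x := fun b hb => by
  by_cases hba : b = a
  · rw [hba]
  · exact (h.2.2 b hb hba).le

lemma IsStrictMax.mem_dualPart_iff {T : Finset (E d)} (hT : IsSimplex T) {a b x : E d}
    (h : IsStrictMax T a x) (hb : b ∈ T) : x ∈ Triangulation.dualPart T b ↔ b = a := by
  rw [FVM.mem_dualPart_iff hT hb]
  refine ⟨fun hx => ?_, fun hba => ⟨h.2.1, by rw [hba]; exact h.le⟩⟩
  by_contra hne
  exact absurd (hx.2 a h.1) (not_le.2 (h.2.2 b hb hne))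

lemma dualPart_subset_hull {T : Finset (E d)} (hT : IsSimplex T) {a : E d} (ha : a ∈ T) :
    Triangulation.dualPart T a ⊆ hull T := fun _ hx => ((mem_dualPart_iff hT ha).1 hx).1

lemma isClosed_dualPart {T : Finset (E d)} (hT : IsSimplex T) {a : E d} (ha : a ∈ T) :
    IsClosed (Triangulation.dualPart T a) := by
  have : Triangulation.dualPart T a =
      hull T ∩ ⋂ b ∈ T, {x | bary T b x ≤ bary T a x} := by
    ext x
    rw [mem_dualPart_iff hT ha]
    simp
  rw [this]
  exact (isCompact_hull T).isClosed.inter (isClosed_biInter fun b _ =>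
    isClosed_le (continuous_affine _) (continuous_affine _))

lemma isCompact_dualPart {T : Finset (E d)} (hT : IsSimplex T) {a : E d} (ha : a ∈ T) :
    IsCompact (Triangulation.dualPart T a) :=
  (isCompact_hull T).of_isClosed_subset (isClosed_dualPart hT ha) (dualPart_subset_hull hT ha)

lemma Triangulation.isClosed_dualVol (M : Triangulation Ω) (a : E d) : IsClosed (M.dualVol a) := by
  refine M.elems.finite_toSet.isClosed_biUnion fun T hT => ?_
  exact isClosed_iUnion_of_finite fun ha => isClosed_dualPart (M.isSimplex hT) ha

/-- In an element, the dual volume of a vertex consists of the points at which the barycentric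
coordinate of that vertex is maximal. -/
lemma Triangulation.mem_dualVol_iff (M : Triangulation Ω) {T : Finset (E d)} (hT : T ∈ M.elems)
    {a x : E d} (hx : x ∈ hull T) : x ∈ M.dualVol a ↔ a ∈ T ∧ x ∈ Triangulation.dualPart T a := by
  constructor
  · intro h
    obtain ⟨S, hS, ha, hxS⟩ : ∃ S ∈ M.elems, a ∈ S ∧ x ∈ Triangulation.dualPart S a := by
      simp only [Triangulation.dualVol, mem_iUnion] at h
      obtain ⟨S, hS, ha, h⟩ := h
      exact ⟨S, hS, ha, h⟩
    rw [mem_dualPart_iff (M.isSimplex hS) ha] at hxS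
    have hpos := bary_pos_of_max (M.isSimplex hS) hxS.2
    have haT := M.mem_of_bary_ne hS hT hxS.1 hx hpos.ne'
    refine ⟨haT, (mem_dualPart_iff (M.isSimplex hT) haT).2 ⟨hx, fun b hb => ?_⟩⟩
    rw [← M.bary_eq_bary hS hT hxS.1 hx, ← M.bary_eq_bary hS hT hxS.1 hx]
    by_cases hbS : b ∈ S
    · exact hxS.2 b hbS
    · rw [bary_of_notMem hbS]; exact hpos.le
  · rintro ⟨ha, h⟩
    simp only [Triangulation.dualVol, mem_iUnion]
    exact ⟨T, hT, ha, h⟩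

lemma Triangulation.dualFun_of_isStrictMax (M : Triangulation Ω) {T : Finset (E d)}
    (hT : T ∈ M.elems) {a x : E d} (h : IsStrictMax T a x) (α : E d → ℝ) :
    M.dualFun α x = α a := by
  classical
  have key : ∀ b, x ∈ M.dualVol b ↔ b = a := by
    intro b
    rw [M.mem_dualVol_iff hT h.2.1]
    constructor
    · rintro ⟨hb, hx⟩
      exact (h.mem_dualPart_iff (M.isSimplex hT) hb).1 hx
    · rintro rfl
      exact ⟨h.1, (h.mem_dualPart_iff (M.isSimplex hT) h.1).2 rfl⟩
  rw [Triangulation.dualFun, Finset.sum_eq_single a]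
  · exact indicator_of_mem ((key a).2 rfl) _
  · intro b _ hb
    exact indicator_of_notMem (fun hx => hb ((key b).1 hx)) _
  · intro ha
    exact absurd (Finset.mem_biUnion.2 ⟨T, hT, h.1⟩) ha

lemma exists_isStrictMax {T : Finset (E d)} (hT : IsSimplex T) {x : E d} (hx : x ∈ hull T)
    (hne : ∀ a ∈ T, ∀ b ∈ T, a ≠ b → bary T a x ≠ bary T b x) : ∃ a, IsStrictMax T a x := by
  have hTne : T.Nonempty := Finset.card_pos.1 (by rw [hT.card_eq]; omega)
  obtain ⟨a, ha, hmax⟩ := T.exists_max_image (fun a => bary T a x) hTne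
  exact ⟨a, ha, hx, fun b hb hba => lt_of_le_of_ne (hmax b hb) (hne b hb a ha hba)⟩

lemma ae_exists_isStrictMax {T : Finset (E d)} (hT : IsSimplex T) :
    ∀ᵐ x ∂volume.restrict (hull T), ∃ a, IsStrictMax T a x := by
  have h : ∀ᵐ x ∂volume.restrict (hull T), ∀ a ∈ T, ∀ b ∈ T, a ≠ b →
      bary T a x ≠ bary T b x := by
    refine (Finset.eventually_all T).2 fun a ha => (Finset.eventually_all T).2 fun b hb => ?_
    by_cases hab : a = b
    · exact Eventually.of_forall fun x h => absurd hab h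
    · have := measure_affine_eq_zero volume (bary T a - bary T b) ⟨a, by
        simp [bary_self hT ha, bary_of_ne hT ha (Ne.symm hab)]⟩
      filter_upwards [ae_restrict_of_ae (measure_eq_zero_iff_ae_notMem.1 this)] with x hx _ he
      exact hx (by simp [he])
  filter_upwards [h, ae_restrict_mem (isCompact_hull T).isClosed.measurableSet] with x hx hxT
  exact exists_isStrictMax hT hxT hx

lemma ae_facet_exists_isStrictMax [DecidableEq (E d)] (hd : 1 ≤ d) {T : Finset (E d)}
    (hT : IsSimplex T) {c : E d} (hc : c ∈ T) :
    ∀ᵐ x ∂(μHE[d - 1]).restrict (hull (T.erase c)), ∃ a, IsStrictMax T a x := by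
  have h : ∀ᵐ x ∂(μHE[d - 1]).restrict {x | bary T c x = 0}, ∀ a ∈ T, ∀ b ∈ T, a ≠ b →
      bary T a x ≠ bary T b x := by
    refine (Finset.eventually_all T).2 fun a ha => (Finset.eventually_all T).2 fun b hb => ?_
    by_cases hab : a = b
    · exact Eventually.of_forall fun x h => absurd hab h
    · have := ae_hyperplane_ne (l := bary T c) (m := bary T a - bary T b)
        (affGrad_bary_ne_zero hT hd hc) (by
          by_cases hac : a = c
          · subst hac
            exact ⟨b, bary_of_ne hT hb hab, by simp [bary_self hT hb, bary_of_ne hT hb hab]⟩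
          · exact ⟨a, bary_of_ne hT ha (Ne.symm hac), by
              simp [bary_self hT ha, bary_of_ne hT ha (Ne.symm hab)]⟩)
      filter_upwards [this] with x hx _ he
      exact hx (by simp [he])
  have h2 : hull (T.erase c) ⊆ {x | bary T c x = 0} := by
    rw [hull_erase_eq hT hc]; exact inter_subset_right
  filter_upwards [ae_restrict_of_ae_restrict_of_subset h2 h,
    ae_restrict_mem (isCompact_hull (T.erase c)).isClosed.measurableSet] with x hx hxT
  rw [hull_erase_eq hT hc] at hxT
  exact exists_isStrictMax hT hxT.1 hx

/-- Integrals against a dual-mesh piecewise constant function. -/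
lemma Triangulation.setIntegral_mul_dualFun (M : Triangulation Ω) {T : Finset (E d)}
    (hT : T ∈ M.elems) {μ : Measure (E d)} {K : Set (E d)}
    (hK : ∀ᵐ x ∂μ.restrict K, ∃ a, IsStrictMax T a x) {ψ : E d → ℝ} (hψ : IntegrableOn ψ K μ)
    (α : E d → ℝ) :
    IntegrableOn (fun x => ψ x * M.dualFun α x) K μ ∧
    ∫ x in K, ψ x * M.dualFun α x ∂μ =
      ∑ a ∈ T, α a * ∫ x in K ∩ Triangulation.dualPart T a, ψ x ∂μ := by
  have hm : ∀ a ∈ T, MeasurableSet (Triangulation.dualPart T a) := fun a ha =>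
    (isClosed_dualPart (M.isSimplex hT) ha).measurableSet
  have e : (fun x => ψ x * M.dualFun α x) =ᵐ[μ.restrict K]
      fun x => ∑ a ∈ T, α a * (Triangulation.dualPart T a).indicator ψ x := by
    filter_upwards [hK] with x hx
    obtain ⟨a, ha⟩ := hx
    rw [M.dualFun_of_isStrictMax hT ha, Finset.sum_eq_single a]
    · rw [indicator_of_mem ((ha.mem_dualPart_iff (M.isSimplex hT) ha.1).2 rfl), mul_comm]
    · intro b hb hba
      rw [indicator_of_notMem (fun hx => hba ((ha.mem_dualPart_iff (M.isSimplex hT) hb).1 hx)),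
        mul_zero]
    · exact fun h => absurd ha.1 h
  have hi : ∀ a ∈ T, Integrable
      (fun x => α a * (Triangulation.dualPart T a).indicator ψ x) (μ.restrict K) :=
    fun a ha => (hψ.indicator (hm a ha)).const_mul _
  refine ⟨(integrable_finsetSum _ hi).congr e.symm, ?_⟩
  rw [integral_congr_ae e, integral_finsetSum _ hi]
  refine Finset.sum_congr rfl fun a ha => ?_
  rw [integral_const_mul, setIntegral_indicator (hm a ha)]

lemma affGrad_bary_sub_ne_zero {T : Finset (E d)} (hT : IsSimplex T) {a b : E d} (ha : a ∈ T)
    (hb : b ∈ T) (hab : b ≠ a) : affGrad (bary T a - bary T b) ≠ 0 := by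
  refine affGrad_ne_zero (x := a) (y := b) ?_
  simp [affine_sub_apply, bary_self hT ha, bary_of_ne hT ha hab, bary_self hT hb,
    bary_of_ne hT hb hab.symm]
  norm_num

/-- The divergence theorem on the part of a dual volume in an element. -/
lemma divergence_dualPart [DecidableEq (E d)] (hd : 1 ≤ d) {T : Finset (E d)} (hT : IsSimplex T)
    {a : E d} (ha : a ∈ T)
    {g : E d → E d} (hg : ContinuousOn g (hull T)) {D : E d → ℝ}
    (hD : HasWeakDiv (interior (hull T)) g D) (hDi : IntegrableOn D (hull T)) :
    ∫ x in Triangulation.dualPart T a, D x =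
      ∑ b ∈ T.erase a, (∫ x in hull (T.erase b) ∩ Triangulation.dualPart T a,
        inner ℝ (g x) (outN (bary T b)) ∂μHE[d - 1]) +
      ∑ b ∈ T.erase a, ∫ x in Triangulation.dualPart T a ∩ {x | (bary T a - bary T b) x = 0},
        inner ℝ (g x) (outN (bary T a - bary T b)) ∂μHE[d - 1] := by
  set P := Triangulation.dualPart T a with hPdef
  have hPT : P ⊆ hull T := dualPart_subset_hull hT ha
  set ℓ : E d ⊕ E d → E d →ᵃ[ℝ] ℝ := Sum.elim (fun b => bary T b) (fun b => bary T a - bary T b)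
    with hℓ
  set s : Finset (E d ⊕ E d) := (T.erase a).disjSum (T.erase a) with hs
  have hall : ∀ p : E d ⊕ E d → Prop, (∀ i ∈ s, p i) ↔
      ∀ b ∈ T.erase a, p (Sum.inl b) ∧ p (Sum.inr b) := by
    intro p
    simp only [hs, Finset.mem_disjSum]
    constructor
    · exact fun h b hb => ⟨h _ (Or.inl ⟨b, hb, rfl⟩), h _ (Or.inr ⟨b, hb, rfl⟩)⟩
    · rintro h i (⟨b, hb, rfl⟩ | ⟨b, hb, rfl⟩)
      · exact (h b hb).1
      · exact (h b hb).2
  have hother : ∃ b, b ∈ T.erase a := by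
    obtain ⟨b, hb, hba⟩ := exists_ne_mem hT hd a
    exact ⟨b, Finset.mem_erase.2 ⟨hba, hb⟩⟩
  obtain ⟨b₀, hb₀⟩ := hother
  have hP : P = {x | ∀ i ∈ s, 0 ≤ ℓ i x} := by
    ext x
    rw [hPdef, mem_dualPart_iff hT ha, mem_hull_iff hT, mem_ofPred_eq, hall fun i => 0 ≤ ℓ i x]
    simp only [hℓ, Sum.elim_inl, Sum.elim_inr, affine_sub_apply, sub_nonneg]
    constructor
    · exact fun h b hb => ⟨h.1 b (Finset.mem_of_mem_erase hb), h.2 b (Finset.mem_of_mem_erase hb)⟩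
    · intro h
      refine ⟨fun b hb => ?_, fun b hb => ?_⟩ <;> by_cases hba : b = a
      · rw [hba]; exact (h b₀ hb₀).1.trans (h b₀ hb₀).2
      · exact (h b (Finset.mem_erase.2 ⟨hba, hb⟩)).1
      · rw [hba]
      · exact (h b (Finset.mem_erase.2 ⟨hba, hb⟩)).2
  set U : Set (E d) := {x | ∀ i ∈ s, 0 < ℓ i x} with hU
  have hUT : U ⊆ interior (hull T) := by
    intro x hx
    rw [hU, mem_ofPred_eq, hall fun i => 0 < ℓ i x] at hx
    simp only [hℓ, Sum.elim_inl, Sum.elim_inr, affine_sub_apply, sub_pos] at hx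
    rw [mem_interior_hull_iff hT]
    intro b hb
    by_cases hba : b = a
    · rw [hba]; exact (hx b₀ hb₀).1.trans (hx b₀ hb₀).2
    · exact (hx b (Finset.mem_erase.2 ⟨hba, hb⟩)).1
  have hne : ∀ i ∈ s, affGrad (ℓ i) ≠ 0 := by
    rw [hall fun i => affGrad (ℓ i) ≠ 0]
    intro b hb
    obtain ⟨hba, hbT⟩ := Finset.mem_erase.1 hb
    exact ⟨affGrad_bary_ne_zero hT hd hbT, affGrad_bary_sub_ne_zero hT ha hbT hba⟩
  have hdist : ∀ i ∈ s, ∀ j ∈ s, i ≠ j → ∃ q, ℓ i q = 0 ∧ ℓ j q ≠ 0 := by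
    rw [hall fun i => ∀ j ∈ s, i ≠ j → ∃ q, ℓ i q = 0 ∧ ℓ j q ≠ 0]
    intro b hb
    obtain ⟨hba, hbT⟩ := Finset.mem_erase.1 hb
    rw [hall fun j => Sum.inl b ≠ j → ∃ q, ℓ (Sum.inl b) q = 0 ∧ ℓ j q ≠ 0,
      hall fun j => Sum.inr b ≠ j → ∃ q, ℓ (Sum.inr b) q = 0 ∧ ℓ j q ≠ 0]
    simp only [hℓ, Sum.elim_inl, Sum.elim_inr, affine_sub_apply]
    refine ⟨fun c hc => ?_, fun c hc => ?_⟩ <;> obtain ⟨hca, hcT⟩ := Finset.mem_erase.1 hc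
    · refine ⟨fun hbc => ⟨c, bary_of_ne hT hcT (by simpa using hbc), ?_⟩,
        fun _ => ⟨a, bary_of_ne hT ha hba, ?_⟩⟩
      · rw [bary_self hT hcT]; exact one_ne_zero
      · rw [bary_self hT ha, bary_of_ne hT ha hca]; norm_num
    · refine ⟨fun _ => ?_, fun hbc => ⟨c, ?_, ?_⟩⟩
      · by_cases hcb : c = b
        · subst hcb
          refine ⟨midpoint ℝ a c, ?_, ?_⟩
          · rw [AffineMap.map_midpoint, AffineMap.map_midpoint, bary_self hT ha,
              bary_self hT hcT, bary_of_ne hT ha hba, bary_of_ne hT hcT (Ne.symm hba),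
              midpoint_comm, sub_self]
          · rw [AffineMap.map_midpoint, bary_self hT hcT, bary_of_ne hT ha hba,
              midpoint_eq_smul_add]
            norm_num
        · refine ⟨c, ?_, ?_⟩
          · rw [bary_of_ne hT hcT (Ne.symm hca), bary_of_ne hT hcT (Ne.symm hcb), sub_self]
          · rw [bary_self hT hcT]; exact one_ne_zero
      · rw [bary_of_ne hT hcT (Ne.symm hca), bary_of_ne hT hcT (by simpa using hbc), sub_self]
      · rw [bary_self hT hcT, bary_of_ne hT hcT (Ne.symm hca)]; norm_num
  have key := divergence_polytope s ℓ hne hdist hP hU (isCompact_dualPart hT ha) (hg.mono hPT)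
    (hD.mono hUT) (hDi.mono_set (hUT.trans interior_subset))
  have hUP : U =ᵐ[volume] P := by
    have hnull : volume (⋃ i ∈ s, {x | ℓ i x = 0}) = 0 := by
      refine (measure_biUnion_null_iff s.countable_toSet).2 fun i hi => ?_
      refine measure_affine_eq_zero volume (ℓ i) ?_
      by_contra! h0
      refine hne i hi (ext_inner_right ℝ fun y => ?_)
      have := affine_sub_eq (ℓ i) y 0
      rw [h0, h0, sub_zero, sub_zero] at this
      rw [← this, inner_zero_left]
    rw [hP]
    filter_upwards [measure_eq_zero_iff_ae_notMem.1 hnull] with x hx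
    refine propext ⟨fun h i hi => (h i hi).le, fun h i hi => lt_of_le_of_ne (h i hi) fun h0 => ?_⟩
    exact hx (mem_iUnion₂.2 ⟨i, hi, h0.symm⟩)
  rw [← setIntegral_congr_set hUP, key, hs, Finset.sum_disjSum]
  congr 1
  refine Finset.sum_congr rfl fun b hb => ?_
  have : P ∩ {x | ℓ (Sum.inl b) x = 0} = hull (T.erase b) ∩ P := by
    rw [hull_erase_eq hT (Finset.mem_of_mem_erase hb)]
    ext x
    simp only [hℓ, Sum.elim_inl, mem_inter_iff, mem_ofPred_eq]
    constructor
    · exact fun h => ⟨⟨hPT h.1, h.2⟩, h.1⟩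
    · exact fun h => ⟨h.2, h.1.2⟩
  rw [this]
  rfl

/-- Points at which the barycentric coordinate of an interior node is strictly maximal lie in the
interior of the dual volume of that node. -/
lemma Triangulation.mem_interior_dualVol (M : Triangulation Ω) (hΩ : IsBoundedLipschitzDomain Ω)
    {T : Finset (E d)} (hT : T ∈ M.elems) {a x : E d} (haΓ : a ∉ frontier Ω)
    (h : IsStrictMax T a x) : x ∈ interior (M.dualVol a) := by
  have hpos := bary_pos_of_max (M.isSimplex hT) h.le
  have hxΩ := M.mem_of_bary_pos hΩ hT h.1 haΓ h.2.1 hpos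
  have hlt : ∀ S ∈ M.elems, x ∈ hull S → a ∈ S ∧ ∀ b ∈ S, b ≠ a → bary S b x < bary S a x := by
    intro S hS hxS
    refine ⟨M.mem_of_bary_ne hT hS h.2.1 hxS hpos.ne', fun b _ hba => ?_⟩
    rw [← M.bary_eq_bary hT hS h.2.1 hxS, ← M.bary_eq_bary hT hS h.2.1 hxS]
    by_cases hbT : b ∈ T
    · exact h.2.2 b hbT hba
    · rw [bary_of_notMem hbT]; exact hpos
  have hev : ∀ᶠ y in 𝓝 x, ∀ S ∈ M.elems, x ∈ hull S → ∀ b ∈ S, b ≠ a →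
      bary S b y < bary S a y := by
    refine (Finset.eventually_all _).2 fun S hS => ?_
    by_cases hxS : x ∈ hull S
    · refine Eventually.mono ((Finset.eventually_all S).2 fun b hb => ?_) fun y hy _ => hy
      by_cases hba : b = a
      · exact Eventually.of_forall fun y h => absurd hba h
      · exact ((continuous_affine _).continuousAt.eventually_lt (continuous_affine _).continuousAt
          ((hlt S hS hxS).2 b hb hba)).mono fun y hy _ => hy
    · exact Eventually.of_forall fun y h => absurd h hxS
  rw [mem_interior_iff_mem_nhds]
  filter_upwards [hev, M.eventually_mem_hull x, hΩ.isOpen.eventually_mem hxΩ] with y hy1 hy2 hyΩ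
  obtain ⟨S, hS, hyS⟩ := M.exists_mem_hull (subset_closure hyΩ)
  have hxS := hy2 S hS hyS
  have haS := (hlt S hS hxS).1
  refine (M.mem_dualVol_iff hS hyS).2 ⟨haS, (mem_dualPart_iff (M.isSimplex hS) haS).2 ⟨hyS, ?_⟩⟩
  intro b hb
  by_cases hba : b = a
  · rw [hba]
  · exact (hy1 S hS hxS b hb hba).le

/-- The boundary of the dual volume of an interior node within an element. -/
lemma Triangulation.frontier_dualVol_inter (M : Triangulation Ω) (hΩ : IsBoundedLipschitzDomain Ω)
    [DecidableEq (E d)]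
    {T : Finset (E d)} (hT : T ∈ M.elems) {a : E d} (ha : a ∈ T) (haΓ : a ∉ frontier Ω) :
    frontier (M.dualVol a) ∩ hull T = ⋃ b ∈ T.erase a,
      Triangulation.dualPart T a ∩ {x | (bary T a - bary T b) x = 0} := by
  have hT' := M.isSimplex hT
  rw [(M.isClosed_dualVol a).frontier_eq]
  ext x
  simp only [mem_inter_iff, Set.mem_sdiff, mem_iUnion, mem_ofPred_eq, exists_prop, Finset.mem_erase]
  constructor
  · rintro ⟨⟨hx, hxi⟩, hxT⟩
    have hxP := ((M.mem_dualVol_iff hT hxT).1 hx).2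
    have hmax := ((mem_dualPart_iff hT' ha).1 hxP).2
    by_contra! hne
    refine hxi (M.mem_interior_dualVol hΩ hT haΓ ⟨ha, hxT, fun b hb hba => ?_⟩)
    refine lt_of_le_of_ne (hmax b hb) fun h => hne b ⟨hba, hb⟩ hxP ?_
    simp [h]
  · rintro ⟨b, ⟨hba, hb⟩, hxP, hxe⟩
    have hxP' := (mem_dualPart_iff hT' ha).1 hxP
    refine ⟨⟨(M.mem_dualVol_iff hT hxP'.1).2 ⟨ha, hxP⟩, fun hxi => ?_⟩, hxP'.1⟩
    -- moving from `x` in the direction `b - a` leaves the dual volume but not the element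
    have hpos := bary_pos_of_max hT' hxP'.2
    have hc : Tendsto (fun t : ℝ => x + t • (b - a)) (𝓝[>] 0) (𝓝 x) := by
      have : Tendsto (fun t : ℝ => x + t • (b - a)) (𝓝 0) (𝓝 (x + (0 : ℝ) • (b - a))) := by
        have hcont : Continuous fun t : ℝ => x + t • (b - a) := by fun_prop
        exact hcont.tendsto 0
      rw [zero_smul, add_zero] at this
      exact this.mono_left nhdsWithin_le_nhds
    have hev := hc.eventually (isOpen_interior.eventually_mem hxi)
    have hsmall : ∀ᶠ t : ℝ in 𝓝[>] 0, t < bary T a x :=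
      eventually_nhdsWithin_of_eventually_nhds (gt_mem_nhds hpos)
    obtain ⟨t, ⟨ht1, ht2⟩, ht0⟩ := ((hev.and hsmall).and self_mem_nhdsWithin).exists
    have ht0 : 0 < t := ht0
    have hval : ∀ c, bary T c (x + t • (b - a)) = bary T c x + t * (bary T c b - bary T c a) := by
      intro c
      rw [affine_add_apply, inner_smul_right, affine_sub_eq]
    have hyT : x + t • (b - a) ∈ hull T := by
      rw [mem_hull_iff hT']
      intro c hc
      rw [hval]
      have h0 := (mem_hull_iff hT').1 hxP'.1 c hc
      by_cases hca : c = a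
      · rw [hca, bary_self hT' ha, bary_of_ne hT' hb (Ne.symm hba)]; linarith
      · by_cases hcb : c = b
        · rw [hcb, bary_self hT' hb, bary_of_ne hT' ha hba]
          rw [hcb] at h0; linarith
        · rw [bary_of_ne hT' hb hcb, bary_of_ne hT' ha hca]; linarith
    have hy := ((M.mem_dualVol_iff hT hyT).1 (interior_subset ht1)).2
    have hle := ((mem_dualPart_iff hT' ha).1 hy).2 b hb
    rw [hval, hval, bary_self hT' ha, bary_self hT' hb, bary_of_ne hT' hb (Ne.symm hba),
      bary_of_ne hT' ha hba] at hle
    have : bary T a x - bary T b x = 0 := by simpa using hxe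
    linarith

/-- Boundary integrals over the dual volume of an interior node, restricted to an element. -/
lemma Triangulation.setIntegral_frontier_dualVol (M : Triangulation Ω)
    (hΩ : IsBoundedLipschitzDomain Ω) [DecidableEq (E d)]
    {T : Finset (E d)} (hT : T ∈ M.elems) {a : E d} (ha : a ∈ T) (haΓ : a ∉ frontier Ω)
    {g : E d → E d} (hg : ContinuousOn g (hull T)) :
    ∫ x in frontier (M.dualVol a) ∩ hull T, inner ℝ (g x) (outerNormal (M.dualVol a) x)
      ∂μHE[d - 1] =
    ∑ b ∈ T.erase a, ∫ x in Triangulation.dualPart T a ∩ {x | (bary T a - bary T b) x = 0},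
        inner ℝ (g x) (outN (bary T a - bary T b)) ∂μHE[d - 1] := by
  have hT' := M.isSimplex hT
  set P := Triangulation.dualPart T a with hP
  set Q : E d → Set (E d) := fun b => P ∩ {x | (bary T a - bary T b) x = 0} with hQ
  have hgrad : ∀ b ∈ T.erase a, affGrad (bary T a - bary T b) ≠ 0 := by
    intro b hb
    obtain ⟨hba, hbT⟩ := Finset.mem_erase.1 hb
    exact affGrad_bary_sub_ne_zero hT' ha hbT hba
  have hQc : ∀ b, IsClosed (Q b) := fun b => (isClosed_dualPart hT' ha).inter
    (isClosed_eq (continuous_affine _) continuous_const)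
  have hQm : ∀ b, MeasurableSet (Q b) := fun b => (hQc b).measurableSet
  have hfr : frontier (M.dualVol a) ∩ hull T = ⋃ b ∈ T.erase a, Q b :=
    M.frontier_dualVol_inter hΩ hT ha haΓ
  rw [hfr]
  -- generically, exactly one other barycentric coordinate attains the maximum
  have hgen : ∀ b ∈ T.erase a, ∀ᵐ x ∂(μHE[d - 1]).restrict (Q b),
      (∀ c ∈ T.erase a, c ≠ b → x ∉ Q c) ∧
        outerNormal (M.dualVol a) x = outN (bary T a - bary T b) := by
    intro b hb
    obtain ⟨hba, hbT⟩ := Finset.mem_erase.1 hb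
    have h1 : ∀ᵐ x ∂(μHE[d - 1]).restrict {x | (bary T a - bary T b) x = 0},
        ∀ c ∈ T, c ≠ a → c ≠ b → (bary T a - bary T c) x ≠ 0 ∧ bary T c x ≠ 0 := by
      refine (Finset.eventually_all T).2 fun c hc => ?_
      by_cases hca : c = a
      · exact Eventually.of_forall fun x h => absurd hca h
      by_cases hcb : c = b
      · exact Eventually.of_forall fun x _ h => absurd hcb h
      have h0 : (bary T a - bary T b) c = 0 := by
        simp [bary_of_ne hT' hc (Ne.symm hca), bary_of_ne hT' hc (Ne.symm hcb)]
      filter_upwards [ae_hyperplane_ne (m := bary T a - bary T c) (hgrad b hb) ⟨c, h0, by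
          simp [bary_of_ne hT' hc (Ne.symm hca), bary_self hT' hc]⟩,
        ae_hyperplane_ne (m := bary T c) (hgrad b hb) ⟨c, h0, by
          simp [bary_self hT' hc]⟩] with x hx1 hx2 _ _ using ⟨hx1, hx2⟩
    filter_upwards [ae_restrict_of_ae_restrict_of_subset inter_subset_right h1,
      ae_restrict_mem (hQm b)] with x hx hxQ
    obtain ⟨hxP, hxe⟩ := hxQ
    have hxe : (bary T a - bary T b) x = 0 := hxe
    have hxP' := (mem_dualPart_iff hT' ha).1 hxP
    have hpos := bary_pos_of_max hT' hxP'.2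
    have heq : bary T b x = bary T a x := by
      rw [affine_sub_apply] at hxe; linarith
    refine ⟨fun c hc hcb hxc => ?_, ?_⟩
    · obtain ⟨hca, hcT⟩ := Finset.mem_erase.1 hc
      exact (hx c hcT hca hcb).1 hxc.2
    refine outerNormal_eq (hgrad b hb) hxe ?_
    have hint : x ∈ interior (hull T) := by
      rw [mem_interior_hull_iff hT']
      intro c hc
      by_cases hca : c = a
      · rw [hca]; exact hpos
      by_cases hcb : c = b
      · rw [hcb, heq]; exact hpos
      exact lt_of_le_of_ne ((mem_hull_iff hT').1 hxP'.1 c hc) (hx c hc hca hcb).2.symm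
    have hev : ∀ᶠ y in 𝓝 x, ∀ c ∈ T, c ≠ a → c ≠ b → bary T c y < bary T a y := by
      refine (Finset.eventually_all T).2 fun c hc => ?_
      by_cases hca : c = a
      · exact Eventually.of_forall fun x h => absurd hca h
      by_cases hcb : c = b
      · exact Eventually.of_forall fun x _ h => absurd hcb h
      have hlt : bary T c x < bary T a x := by
        refine lt_of_le_of_ne (hxP'.2 c hc) fun h => (hx c hc hca hcb).1 ?_
        simp [h]
      exact ((continuous_affine _).continuousAt.eventually_lt (continuous_affine _).continuousAt
        hlt).mono fun y hy _ _ => hy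
    filter_upwards [isOpen_interior.eventually_mem hint, hev] with y hyi hy
    have hyT := interior_subset hyi
    rw [M.mem_dualVol_iff hT hyT, mem_dualPart_iff hT' ha, affine_sub_apply]
    refine ⟨fun h => ⟨ha, hyT, fun c hc => ?_⟩, fun h h2 => ?_⟩
    · by_cases hca : c = a
      · rw [hca]
      by_cases hcb : c = b
      · rw [hcb]; linarith
      exact (hy c hc hca hcb).le
    · have := h2.2.2 b hbT
      linarith
  have hcong : (fun x => inner ℝ (g x) (outerNormal (M.dualVol a) x))
      =ᵐ[(μHE[d - 1]).restrict (⋃ b ∈ T.erase a, Q b)]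
      fun x => ∑ b ∈ T.erase a, (Q b).indicator
        (fun x => inner ℝ (g x) (outN (bary T a - bary T b))) x := by
    refine (ae_restrict_biUnion_finset_iff _ _ _).2 fun b hb => ?_
    filter_upwards [hgen b hb, ae_restrict_mem (hQm b)] with x hx hxQ
    rw [hx.2, Finset.sum_eq_single b, indicator_of_mem hxQ]
    · exact fun c hc hcb => indicator_of_notMem (hx.1 c hc hcb) _
    · exact fun h => absurd hb h
  have hint : ∀ b ∈ T.erase a, IntegrableOn
      (fun x => inner ℝ (g x) (outN (bary T a - bary T b))) (Q b) μHE[d - 1] := by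
    intro b hb
    have hcont : ContinuousOn (fun x => inner ℝ (g x) (outN (bary T a - bary T b))) (Q b) :=
      (hg.mono (inter_subset_left.trans (dualPart_subset_hull hT' ha))).inner continuousOn_const
    have hcomp : IsCompact (Q b) := (isCompact_dualPart hT' ha).inter_right
      (isClosed_eq (continuous_affine _) continuous_const)
    obtain ⟨C, hC⟩ := hcomp.exists_bound_of_continuousOn hcont
    refine IntegrableOn.of_bound
      (measure_hyperplane_inter_compact (hgrad b hb) (isCompact_dualPart hT' ha))
      (hcont.aestronglyMeasurable (hQm b)) C ?_
    filter_upwards [ae_restrict_mem (hQm b)] with x hx using hC x hx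
  rw [integral_congr_ae hcong, integral_finsetSum]
  · refine Finset.sum_congr rfl fun b hb => ?_
    rw [setIntegral_indicator (hQm b), inter_eq_self_of_subset_right]
    exact subset_biUnion_of_mem (u := Q) hb
  · intro b hb
    exact ((integrable_indicator_iff (hQm b)).2 (hint b hb)).integrableOn

end DualMesh

section DualMeshSum

open Filter Topology

variable {d : ℕ} {Ω : Set (E d)} {M : Triangulation Ω}

/-- The nodal values of a function with zero boundary values are admissible test values of the
finite volume scheme. -/
lemma Triangulation.memP00_of_boundary (M : Triangulation Ω) (hΩ : IsBoundedLipschitzDomain Ω)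
    {α : E d → ℝ} (hα : ∀ a ∈ frontier Ω, α a = 0) : M.MemP00 α := by
  rintro a - ⟨x, hx, hxΓ⟩
  have hxV := (M.isClosed_dualVol a).frontier_subset hx
  obtain ⟨S, hS, ha, hxS⟩ : ∃ S ∈ M.elems, a ∈ S ∧ x ∈ Triangulation.dualPart S a := by
    simp only [Triangulation.dualVol, mem_iUnion] at hxV
    obtain ⟨S, hS, ha, h⟩ := hxV
    exact ⟨S, hS, ha, h⟩
  rw [mem_dualPart_iff (M.isSimplex hS) ha] at hxS
  by_contra h
  have haΓ : a ∉ frontier Ω := fun haΓ => h (hα a haΓ)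
  have hxΩ := M.mem_of_bary_pos hΩ hS ha haΓ hxS.1 (bary_pos_of_max (M.isSimplex hS) hxS.2)
  rw [hΩ.isOpen.frontier_eq] at hxΓ
  exact hxΓ.2 hxΩ

lemma Triangulation.dualVol_subset (M : Triangulation Ω) (a : E d) :
    M.dualVol a ⊆ closure Ω := by
  intro x hx
  simp only [Triangulation.dualVol, mem_iUnion] at hx
  obtain ⟨S, hS, ha, h⟩ := hx
  exact M.hull_subset hS (dualPart_subset_hull (M.isSimplex hS) ha h)

lemma Triangulation.restrict_closure (M : Triangulation Ω) (hΩ : IsBoundedLipschitzDomain Ω) :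
    volume.restrict (closure Ω) = volume.restrict Ω := by
  refine Measure.restrict_congr_set ?_
  rw [closure_eq_self_union_frontier]
  exact union_ae_eq_left_of_ae_eq_empty (ae_eq_empty.2 (M.volume_frontier hΩ))

lemma Triangulation.setIntegral_mul_dualFun_domain (M : Triangulation Ω)
    (hΩ : IsBoundedLipschitzDomain Ω) {ψ : E d → ℝ} (hψ : IntegrableOn ψ Ω) {α : E d → ℝ}
    (hα : ∀ a ∈ frontier Ω, α a = 0) :
    ∫ x in Ω, ψ x * M.dualFun α x = ∑ a ∈ M.intNodes, α a * ∫ x in M.dualVol a, ψ x := by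
  classical
  have hm : ∀ a, MeasurableSet (M.dualVol a) := fun a => (M.isClosed_dualVol a).measurableSet
  have e : ∀ x, ψ x * M.dualFun α x = ∑ a ∈ M.nodes, α a * (M.dualVol a).indicator ψ x := by
    intro x
    rw [Triangulation.dualFun, Finset.mul_sum]
    refine Finset.sum_congr rfl fun a _ => ?_
    by_cases hx : x ∈ M.dualVol a
    · rw [indicator_of_mem hx, indicator_of_mem hx, mul_comm]
    · rw [indicator_of_notMem hx, indicator_of_notMem hx, mul_zero, mul_zero]
  simp only [e]
  rw [integral_finsetSum _ fun a _ => (hψ.indicator (hm a)).const_mul _, Triangulation.intNodes,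
    Finset.sum_filter]
  refine Finset.sum_congr rfl fun a _ => ?_
  by_cases h : a ∈ frontier Ω
  · rw [hα a h]; simp
  · rw [if_pos h, integral_const_mul, ← M.restrict_closure hΩ, setIntegral_indicator (hm a),
      inter_eq_self_of_subset_right (M.dualVol_subset a)]

/-- The weighted sum of the boundary fluxes of the dual volumes, in terms of volume and facet
integrals of the elements: the divergence theorem on the parts of the dual volumes. -/
lemma Triangulation.sum_boundaryFlux (M : Triangulation Ω) (hΩ : IsBoundedLipschitzDomain Ω)
    (hd : 1 ≤ d) {G : Finset (E d) → E d → E d} {D : Finset (E d) → E d → ℝ}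
    (hG : ∀ T ∈ M.elems, ContinuousOn (G T) (hull T))
    (hD : ∀ T ∈ M.elems, HasWeakDiv (interior (hull T)) (G T) (D T))
    (hDi : ∀ T ∈ M.elems, IntegrableOn (D T) (hull T)) {α : E d → ℝ}
    (hα : ∀ a ∈ frontier Ω, α a = 0) :
    ∑ a ∈ M.intNodes, α a * ∑ T ∈ M.elems, ∫ x in frontier (M.dualVol a) ∩ hull T,
      inner ℝ (G T x) (outerNormal (M.dualVol a) x) ∂μHE[d - 1] =
    ∑ T ∈ M.elems, ((∫ x in hull T, D T x * M.dualFun α x) -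
      ∑ F ∈ T.powersetCard d, ∫ x in hull F, inner ℝ (G T x) (facetN T F) * M.dualFun α x
        ∂μHE[d - 1]) := by
  classical
  have hsum : ∀ T ∈ M.elems, ∀ a ∈ M.intNodes,
      ∫ x in frontier (M.dualVol a) ∩ hull T, inner ℝ (G T x) (outerNormal (M.dualVol a) x)
        ∂μHE[d - 1] =
      if a ∈ T then (∫ x in Triangulation.dualPart T a, D T x) -
        ∑ b ∈ T, ∫ x in hull (T.erase b) ∩ Triangulation.dualPart T a,
          inner ℝ (G T x) (outN (bary T b)) ∂μHE[d - 1] else 0 := by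
    intro T hT a ha
    have hT' := M.isSimplex hT
    split_ifs with haT
    · rw [M.setIntegral_frontier_dualVol hΩ hT haT (Finset.mem_filter.1 ha).2 (hG T hT),
        divergence_dualPart hd hT' haT (hG T hT) (hD T hT) (hDi T hT),
        ← Finset.add_sum_erase T _ haT]
      have : hull (T.erase a) ∩ Triangulation.dualPart T a = ∅ := by
        refine eq_empty_of_forall_notMem fun x hx => ?_
        rw [hull_erase_eq hT' haT, mem_inter_iff, mem_dualPart_iff hT' haT] at hx
        have h0 : bary T a x = 0 := hx.1.2
        exact absurd h0 (bary_pos_of_max hT' hx.2.2).ne'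
      rw [this, setIntegral_empty]
      ring
    · have : frontier (M.dualVol a) ∩ hull T = ∅ := by
        refine eq_empty_of_forall_notMem fun x hx => haT ?_
        exact ((M.mem_dualVol_iff hT hx.2).1 ((M.isClosed_dualVol a).frontier_subset hx.1)).1
      rw [this, setIntegral_empty]
  simp only [Finset.mul_sum]
  rw [Finset.sum_comm]
  refine Finset.sum_congr rfl fun T hT => ?_
  have hT' := M.isSimplex hT
  rw [Finset.sum_congr rfl fun a ha => by rw [hsum T hT a ha]]
  rw [(M.setIntegral_mul_dualFun hT (ae_exists_isStrictMax hT') (hDi T hT) α).2,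
    sum_powersetCard_eq hT'.card_eq]
  have hF : ∀ c ∈ T, ∫ x in hull (T.erase c), inner ℝ (G T x) (facetN T (T.erase c)) *
      M.dualFun α x ∂μHE[d - 1] = ∑ a ∈ T, α a * ∫ x in hull (T.erase c) ∩
        Triangulation.dualPart T a, inner ℝ (G T x) (outN (bary T c)) ∂μHE[d - 1] := by
    intro c hc
    rw [facetN_erase hc]
    refine (M.setIntegral_mul_dualFun hT (ae_facet_exists_isStrictMax hd hT' hc) ?_ α).2
    refine integrableOn_facet hd hT' (erase_mem_powersetCard hT'.card_eq hc) ?_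
    refine ContinuousOn.inner ((hG T hT).mono ?_) continuousOn_const
    exact convexHull_mono (by exact_mod_cast T.erase_subset c)
  rw [Finset.sum_congr rfl hF, Finset.sum_comm, ← Finset.sum_sub_distrib, Triangulation.intNodes,
    Finset.sum_filter]
  have hinter : ∀ φ : E d → ℝ, (∑ a ∈ M.nodes, if a ∈ T then φ a else 0) = ∑ a ∈ T, φ a := by
    intro φ
    rw [← Finset.sum_filter]
    congr 1
    ext a
    simp only [Finset.mem_filter, and_iff_right_iff_imp]
    exact fun ha => Finset.mem_biUnion.2 ⟨T, hT, ha⟩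
  rw [← hinter]
  refine Finset.sum_congr rfl fun a _ => ?_
  by_cases haΓ : a ∈ frontier Ω
  · simp [haΓ, hα a haΓ]
  · by_cases haT : a ∈ T
    · simp only [haΓ, haT, not_false_eq_true, if_true]
      rw [mul_sub, Finset.mul_sum, inter_eq_self_of_subset_right (dualPart_subset_hull hT' haT)]
    · simp [haT]

end DualMeshSum

/-! ### Piecewise affine functions and their dual-mesh interpolants have the same means -/

section MeanZero

open Filter Topology

variable {d : ℕ} {Ω : Set (E d)} {M : Triangulation Ω}

/-- An affine involution which differs from the identity by a rank one map preserves volume. -/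
lemma measurePreserving_shear {V : Type*} [NormedAddCommGroup V] [NormedSpace ℝ V]
    [FiniteDimensional ℝ V] [MeasurableSpace V] [BorelSpace V] (μ : Measure V)
    [μ.IsAddHaarMeasure] (φ : V →ₗ[ℝ] ℝ) {w : V} (hw : φ w = -2) (c : ℝ) :
    MeasurePreserving (fun x => x + (φ x + c) • w) μ μ := by
  set L : V →ₗ[ℝ] V := LinearMap.id + φ.smulRight w with hL
  have hLx : ∀ x, L x = x + φ x • w := fun x => by simp [hL]
  have hLL : L ∘ₗ L = LinearMap.id := by
    ext x
    rw [LinearMap.comp_apply, hLx, hLx, map_add, map_smul, hw, LinearMap.id_apply, smul_eq_mul]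
    module
  have hdet : LinearMap.det L * LinearMap.det L = 1 := by
    rw [← LinearMap.det_comp, hLL, LinearMap.det_id]
  have habs : |(LinearMap.det L)⁻¹| = 1 := by
    rw [abs_inv]
    rcases mul_self_eq_one_iff.1 hdet with h | h <;> rw [h] <;> simp
  have hmp : MeasurePreserving L μ μ := by
    refine ⟨L.continuous_of_finiteDimensional.measurable, ?_⟩
    rw [Measure.map_linearMap_addHaar_eq_smul_addHaar μ
      (fun h => by rw [h] at hdet; simp at hdet), habs]
    simp
  have := (measurePreserving_add_right μ (c • w)).comp hmp
  convert this using 1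
  funext x
  rw [Function.comp_apply, hLx]
  module

/-- The affine map that exchanges the vertices `i` and `j` of the simplex `T` and fixes the other
vertices. -/
def swapMap (T : Finset (E d)) (i j x : E d) : E d := x + (bary T i x - bary T j x) • (j - i)

lemma swapMap_eq (T : Finset (E d)) (i j p y : E d) :
    swapMap T i j (y + p) = (y + (inner ℝ (affGrad (bary T i - bary T j)) y +
      (bary T i p - bary T j p)) • (j - i)) + p := by
  rw [swapMap, add_comm y p, affine_add_apply, affine_add_apply, affGrad_sub, inner_sub_left]
  module

lemma continuous_swapMap (T : Finset (E d)) (i j : E d) : Continuous (swapMap T i j) :=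
  continuous_id.add (((continuous_affine _).sub (continuous_affine _)).smul continuous_const)

variable {T : Finset (E d)}

lemma bary_swapMap (hT : IsSimplex T) {i j : E d} (hi : i ∈ T) (hj : j ∈ T) (hij : i ≠ j)
    (x : E d) : bary T i (swapMap T i j x) = bary T j x ∧ bary T j (swapMap T i j x) = bary T i x ∧
      ∀ k, k ≠ i → k ≠ j → bary T k (swapMap T i j x) = bary T k x := by
  have key : ∀ k, bary T k (swapMap T i j x) =
      bary T k x + (bary T i x - bary T j x) * (bary T k j - bary T k i) := by
    intro k
    rw [swapMap, affine_add_apply, inner_smul_right, affine_sub_eq]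
  refine ⟨?_, ?_, fun k hki hkj => ?_⟩
  · rw [key, bary_self hT hi, bary_of_ne hT hj hij]; ring
  · rw [key, bary_self hT hj, bary_of_ne hT hi hij.symm]; ring
  · rw [key, bary_of_ne hT hj hkj, bary_of_ne hT hi hki]; ring

lemma inner_affGrad_sub_swap (hT : IsSimplex T) {i j : E d} (hi : i ∈ T) (hj : j ∈ T)
    (hij : i ≠ j) : inner ℝ (affGrad (bary T i - bary T j)) (j - i) = -2 := by
  rw [← affine_sub_eq, affine_sub_apply, affine_sub_apply, bary_self hT hi, bary_self hT hj,
    bary_of_ne hT hj hij, bary_of_ne hT hi hij.symm]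
  norm_num

lemma swapMap_mem_hull_iff (hT : IsSimplex T) {i j : E d} (hi : i ∈ T) (hj : j ∈ T) (hij : i ≠ j)
    (x : E d) : swapMap T i j x ∈ hull T ↔ x ∈ hull T := by
  obtain ⟨h1, h2, h3⟩ := bary_swapMap hT hi hj hij x
  rw [mem_hull_iff hT, mem_hull_iff hT]
  have aux : ∀ k ∈ T, k ≠ i → k ≠ j →
      (0 ≤ bary T k (swapMap T i j x) ↔ 0 ≤ bary T k x) := fun k _ hki hkj => by rw [h3 k hki hkj]
  constructor <;> intro h k hk <;> by_cases hki : k = i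
  · rw [hki, ← h2]; exact h j hj
  · by_cases hkj : k = j
    · rw [hkj, ← h1]; exact h i hi
    · exact (aux k hk hki hkj).1 (h k hk)
  · rw [hki, h1]; exact h j hj
  · by_cases hkj : k = j
    · rw [hkj, h2]; exact h i hi
    · exact (aux k hk hki hkj).2 (h k hk)

lemma swapMap_mem_dualPart_iff (hT : IsSimplex T) {i j : E d} (hi : i ∈ T) (hj : j ∈ T)
    (hij : i ≠ j) (x : E d) :
    swapMap T i j x ∈ Triangulation.dualPart T i ↔ x ∈ Triangulation.dualPart T j := by
  obtain ⟨h1, h2, h3⟩ := bary_swapMap hT hi hj hij x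
  rw [mem_dualPart_iff hT hi, mem_dualPart_iff hT hj, swapMap_mem_hull_iff hT hi hj hij, h1]
  refine and_congr_right fun _ => ?_
  constructor <;> intro h k hk <;> by_cases hki : k = i
  · rw [hki, ← h2]; exact h j hj
  · by_cases hkj : k = j
    · rw [hkj]
    · rw [← h3 k hki hkj]; exact h k hk
  · rw [hki, h1]
  · by_cases hkj : k = j
    · rw [hkj, h2]; exact h i hi
    · rw [h3 k hki hkj]; exact h k hk

lemma measurePreserving_swapMap (hT : IsSimplex T) {i j : E d} (hi : i ∈ T) (hj : j ∈ T)
    (hij : i ≠ j) : MeasurePreserving (swapMap T i j)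
      (volume.restrict (hull T)) (volume.restrict (hull T)) := by
  have h : MeasurePreserving (swapMap T i j) volume volume := by
    have := measurePreserving_shear (volume : Measure (E d)) (bary T i - bary T j).linear
      (w := j - i) (by rw [← inner_affGrad]; exact inner_affGrad_sub_swap hT hi hj hij)
      (bary T i 0 - bary T j 0)
    convert this using 1
    funext x
    have := swapMap_eq T i j 0 x
    rw [add_zero, add_zero] at this
    rw [this, inner_affGrad]
  have h2 := h.restrict_preimage (isCompact_hull T).isClosed.measurableSet
  have : swapMap T i j ⁻¹' hull T = hull T := by
    ext x; exact swapMap_mem_hull_iff hT hi hj hij x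
  rwa [this] at h2

lemma measurePreserving_swapMap_facet [DecidableEq (E d)] (hd : 1 ≤ d) (hT : IsSimplex T)
    {c i j : E d} (hc : c ∈ T) (hi : i ∈ T.erase c) (hj : j ∈ T.erase c) (hij : i ≠ j) :
    MeasurePreserving (swapMap T i j) ((μHE[d - 1]).restrict (hull (T.erase c)))
      ((μHE[d - 1]).restrict (hull (T.erase c))) := by
  obtain ⟨hic, hiT⟩ := Finset.mem_erase.1 hi
  obtain ⟨hjc, hjT⟩ := Finset.mem_erase.1 hj
  have hg := affGrad_bary_ne_zero hT hd hc
  set n := outN (bary T c) with hn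
  have hn1 : ‖n‖ = 1 := norm_outN hg
  have hi0 : bary T c i = 0 := bary_of_ne hT hiT (Ne.symm hic)
  have hj0 : bary T c j = 0 := bary_of_ne hT hjT (Ne.symm hjc)
  have hperp : inner ℝ n (j - i) = 0 := by
    rw [hn, outN, inner_neg_left, inner_smul_left, ← affine_sub_eq, hi0, hj0]; simp
  have hH : {x | bary T c x = 0} = {x | inner ℝ n (x - i) = 0} := setOf_affine_eq_zero hg hi0
  -- the map acts on the hyperplane, in coordinates of the orthogonal complement of the normal
  set w : (ℝ ∙ n)ᗮ := ⟨j - i, Submodule.mem_orthogonal_singleton_iff_inner_right.2 hperp⟩ with hw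
  set φ : (ℝ ∙ n)ᗮ →ₗ[ℝ] ℝ := (bary T i - bary T j).linear ∘ₗ (ℝ ∙ n)ᗮ.subtype with hφ
  have hsh := measurePreserving_shear (volume : Measure (ℝ ∙ n)ᗮ) φ (w := w) (by
    have := inner_affGrad_sub_swap hT hiT hjT hij
    rw [inner_affGrad] at this
    exact this) (bary T i i - bary T j i)
  have hcomm : ∀ y : (ℝ ∙ n)ᗮ, swapMap T i j ((y : E d) + i) =
      ((y + (φ y + (bary T i i - bary T j i)) • w : (ℝ ∙ n)ᗮ) : E d) + i := by
    intro y
    rw [swapMap_eq, inner_affGrad]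
    rfl
  have h : MeasurePreserving (swapMap T i j) ((μHE[d - 1]).restrict {x | bary T c x = 0})
      ((μHE[d - 1]).restrict {x | bary T c x = 0}) := by
    refine ⟨(continuous_swapMap T i j).measurable, ?_⟩
    rw [hH, ← map_add_eq_restrict n hn1 i, Measure.map_map (continuous_swapMap T i j).measurable
      (measurableEmbedding_add n i).measurable]
    have : swapMap T i j ∘ (fun y : (ℝ ∙ n)ᗮ => (y : E d) + i) =
        (fun y : (ℝ ∙ n)ᗮ => (y : E d) + i) ∘
          fun y => y + (φ y + (bary T i i - bary T j i)) • w := funext hcomm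
    rw [this, ← Measure.map_map (measurableEmbedding_add n i).measurable hsh.measurable,
      hsh.map_eq]
  have h2 := h.restrict_preimage (isCompact_hull (T.erase c)).isClosed.measurableSet
  have hpre : swapMap T i j ⁻¹' hull (T.erase c) = hull (T.erase c) := by
    ext x
    rw [mem_preimage, hull_erase_eq hT hc, mem_inter_iff, mem_inter_iff,
      swapMap_mem_hull_iff hT hiT hjT hij]
    refine and_congr_right fun _ => ?_
    rw [mem_ofPred_eq, mem_ofPred_eq, (bary_swapMap hT hiT hjT hij x).2.2 c (Ne.symm hic)
      (Ne.symm hjc)]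
  have hsub : hull (T.erase c) ⊆ {x | bary T c x = 0} := by
    rw [hull_erase_eq hT hc]; exact inter_subset_right
  rwa [hpre, Measure.restrict_restrict_of_subset hsub] at h2

lemma integrable_bary (hT : IsSimplex T) {ν : Measure (E d)} [IsFiniteMeasure ν]
    (hae : ∀ᵐ x ∂ν, ∃ a, IsStrictMax T a x) {a : E d} (ha : a ∈ T) : Integrable (bary T a) ν := by
  refine Integrable.of_bound (continuous_affine _).aestronglyMeasurable 1 ?_
  filter_upwards [hae] with x hx
  obtain ⟨b, hb⟩ := hx
  have hn := (mem_hull_iff hT).1 hb.2.1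
  rw [Real.norm_of_nonneg (hn a ha), ← sum_bary hT x]
  exact Finset.single_le_sum (f := fun b => bary T b x) hn ha

/-- If a finite measure on a simplex is invariant under the exchange of any two vertices of a face
which carries the measure, then each vertex has the same weight in the mean of an affine function
as its dual volume has in the measure. -/
lemma integral_bary_eq (hT : IsSimplex T) {ν : Measure (E d)} [IsFiniteMeasure ν]
    {S : Finset (E d)} (hST : S ⊆ T)
    (hmp : ∀ i ∈ S, ∀ j ∈ S, i ≠ j → MeasurePreserving (swapMap T i j) ν ν)
    (hae : ∀ᵐ x ∂ν, ∃ a, IsStrictMax T a x) (h0 : ∀ᵐ x ∂ν, ∀ b ∈ T, b ∉ S → bary T b x = 0)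
    {a : E d} (ha : a ∈ T) :
    ∫ x, bary T a x ∂ν = ν.real (Triangulation.dualPart T a) := by
  have hm : ∀ a ∈ T, MeasurableSet (Triangulation.dualPart T a) := fun a ha =>
    (isClosed_dualPart hT ha).measurableSet
  have hint : ∀ a ∈ T, Integrable (bary T a) ν := fun a ha => integrable_bary hT hae ha
  have hsum1 : ∑ a ∈ T, ∫ x, bary T a x ∂ν = ν.real univ := by
    rw [← integral_finsetSum _ hint]
    simp only [sum_bary hT]
    simp
  have hsum2 : ∑ a ∈ T, ν.real (Triangulation.dualPart T a) = ν.real univ := by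
    have e : (fun x => ∑ a ∈ T, (Triangulation.dualPart T a).indicator (fun _ => (1 : ℝ)) x)
        =ᵐ[ν] fun _ => 1 := by
      filter_upwards [hae] with x hx
      obtain ⟨b, hb⟩ := hx
      rw [Finset.sum_eq_single b]
      · exact indicator_of_mem ((hb.mem_dualPart_iff hT hb.1).2 rfl) _
      · intro c hc hcb
        exact indicator_of_notMem (fun hx => hcb ((hb.mem_dualPart_iff hT hc).1 hx)) _
      · exact fun h => absurd hb.1 h
    have h2 := integral_congr_ae e
    rw [integral_finsetSum _ fun a ha => (integrable_const _).indicator (hm a ha)] at h2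
    rw [Finset.sum_congr rfl fun a ha => by rw [integral_indicator_const _ (hm a ha)]] at h2
    simpa using h2
  have hz1 : ∀ b ∈ T, b ∉ S → ∫ x, bary T b x ∂ν = 0 := by
    intro b hb hbS
    refine integral_eq_zero_of_ae ?_
    filter_upwards [h0] with x hx using hx b hb hbS
  have hz2 : ∀ b ∈ T, b ∉ S → ν.real (Triangulation.dualPart T b) = 0 := by
    intro b hb hbS
    rw [measureReal_eq_zero_iff, measure_eq_zero_iff_ae_notMem]
    filter_upwards [h0] with x hx hxb
    exact (bary_pos_of_max hT ((mem_dualPart_iff hT hb).1 hxb).2).ne' (hx b hb hbS)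
  by_cases haS : a ∉ S
  · rw [hz1 a ha haS, hz2 a ha haS]
  have haS : a ∈ S := not_not.1 haS
  have he1 : ∀ b ∈ S, ∫ x, bary T b x ∂ν = ∫ x, bary T a x ∂ν := by
    intro b hb
    by_cases hba : b = a
    · rw [hba]
    have h := hmp b hb a haS hba
    have h2 : ∫ x, bary T b (swapMap T b a x) ∂ν = ∫ x, bary T b x ∂ν := by
      conv_rhs => rw [← h.map_eq]
      rw [integral_map h.measurable.aemeasurable (continuous_affine _).aestronglyMeasurable]
    rw [← h2]
    refine integral_congr_ae (Eventually.of_forall fun x => ?_)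
    exact (bary_swapMap hT (hST hb) ha hba x).1
  have he2 : ∀ b ∈ S, ν.real (Triangulation.dualPart T b) =
      ν.real (Triangulation.dualPart T a) := by
    intro b hb
    by_cases hba : b = a
    · rw [hba]
    have h := hmp b hb a haS hba
    rw [measureReal_def, measureReal_def, ← h.measure_preimage (hm b (hST hb)).nullMeasurableSet]
    congr 2
    ext x
    exact swapMap_mem_dualPart_iff hT (hST hb) ha hba x
  rw [← Finset.sum_subset hST hz1, Finset.sum_congr rfl he1, Finset.sum_const] at hsum1
  rw [← Finset.sum_subset hST hz2, Finset.sum_congr rfl he2, Finset.sum_const, ← hsum1,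
    nsmul_eq_mul, nsmul_eq_mul] at hsum2
  have hcard : (S.card : ℝ) ≠ 0 := by
    exact_mod_cast (Finset.card_pos.2 ⟨a, haS⟩).ne'
  exact (mul_left_cancel₀ hcard hsum2).symm

/-- The difference of a piecewise affine function and its dual-mesh interpolant has mean zero. -/
lemma Triangulation.integral_sub_dualFun_eq_zero (hT : T ∈ M.elems) {ν : Measure (E d)}
    [IsFiniteMeasure ν] {S : Finset (E d)} (hST : S ⊆ T)
    (hmp : ∀ i ∈ S, ∀ j ∈ S, i ≠ j → MeasurePreserving (swapMap T i j) ν ν)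
    (hae : ∀ᵐ x ∂ν, ∃ a, IsStrictMax T a x) (h0 : ∀ᵐ x ∂ν, ∀ b ∈ T, b ∉ S → bary T b x = 0)
    {v : E d → ℝ} {l : E d →ᵃ[ℝ] ℝ} (hl : EqOn v l (hull T)) :
    ∫ x, (v x - M.dualFun v x) ∂ν = 0 := by
  have hT' := M.isSimplex hT
  have hm : ∀ a ∈ T, MeasurableSet (Triangulation.dualPart T a) := fun a ha =>
    (isClosed_dualPart hT' ha).measurableSet
  have hint : ∀ a ∈ T, Integrable (bary T a) ν := fun a ha => integrable_bary hT' hae ha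
  have e : (fun x => v x - M.dualFun v x) =ᵐ[ν] fun x => ∑ a ∈ T, (bary T a x -
      (Triangulation.dualPart T a).indicator (fun _ => (1 : ℝ)) x) * l a := by
    filter_upwards [hae] with x hx
    obtain ⟨b, hb⟩ := hx
    rw [hl hb.2.1, M.dualFun_of_isStrictMax hT hb, hl (vertex_mem_hull hb.1),
      affine_eq_sum_bary hT' l x]
    simp only [sub_mul, Finset.sum_sub_distrib]
    congr 1
    rw [Finset.sum_eq_single b]
    · rw [indicator_of_mem ((hb.mem_dualPart_iff hT' hb.1).2 rfl), one_mul]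
    · intro c hc hcb
      rw [indicator_of_notMem (fun hx => hcb ((hb.mem_dualPart_iff hT' hc).1 hx)), zero_mul]
    · exact fun h => absurd hb.1 h
  have hi2 : ∀ a ∈ T, Integrable
      ((Triangulation.dualPart T a).indicator fun _ => (1 : ℝ)) ν := fun a ha =>
    (integrable_const _).indicator (hm a ha)
  have hi3 : ∀ a ∈ T, Integrable (fun x => (bary T a x -
      (Triangulation.dualPart T a).indicator (fun _ => (1 : ℝ)) x) * l a) ν := fun a ha =>
    ((hint a ha).sub (hi2 a ha)).mul_const _
  rw [integral_congr_ae e, integral_finsetSum _ hi3]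
  refine Finset.sum_eq_zero fun a ha => ?_
  rw [integral_mul_const, integral_sub (hint a ha) (hi2 a ha), integral_indicator_const _ (hm a ha),
    integral_bary_eq hT' hST hmp hae h0 ha]
  simp

lemma Triangulation.setIntegral_sub_dualFun (hT : T ∈ M.elems)
    {v : E d → ℝ} {l : E d →ᵃ[ℝ] ℝ} (hl : EqOn v l (hull T)) :
    ∫ x in hull T, (v x - M.dualFun v x) = 0 := by
  have hT' := M.isSimplex hT
  have : IsFiniteMeasure (volume.restrict (hull T)) :=
    ⟨by rw [Measure.restrict_apply_univ]; exact (isCompact_hull T).measure_lt_top⟩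
  exact Triangulation.integral_sub_dualFun_eq_zero hT subset_rfl
    (fun i hi j hj hij => measurePreserving_swapMap hT' hi hj hij) (ae_exists_isStrictMax hT')
    (Eventually.of_forall fun x b hb hbT => absurd hb hbT) hl

lemma Triangulation.setIntegral_facet_sub_dualFun (hd : 1 ≤ d) (hT : T ∈ M.elems)
    {F : Finset (E d)} (hF : F ∈ T.powersetCard d)
    {v : E d → ℝ} {l : E d →ᵃ[ℝ] ℝ} (hl : EqOn v l (hull T)) :
    ∫ x in hull F, (v x - M.dualFun v x) ∂μHE[d - 1] = 0 := by
  classical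
  have hT' := M.isSimplex hT
  have : IsFiniteMeasure ((μHE[d - 1]).restrict (hull F)) :=
    ⟨by rw [Measure.restrict_apply_univ]; exact hull_facet_finite hd hT' hF⟩
  obtain ⟨c, hc, rfl⟩ := exists_eq_erase hT'.card_eq hF
  refine Triangulation.integral_sub_dualFun_eq_zero hT (T.erase_subset c)
    (fun i hi j hj hij => measurePreserving_swapMap_facet hd hT' hc hi hj hij)
    (ae_facet_exists_isStrictMax hd hT' hc) ?_ hl
  filter_upwards [ae_facet hT' hd hc] with x hx b hb hbF
  have : b = c := by
    by_contra h
    exact hbF (Finset.mem_erase.2 ⟨h, hb⟩)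
  rw [this]; exact hx.1

end MeanZero

/-! ### The size of facets and of interpolation errors -/

section Sizes

open Filter Topology

variable {d : ℕ} {Ω : Set (E d)} {M : Triangulation Ω} {T : Finset (E d)}

/-- The volume of the unit ball of `ℝᵐ`. -/
def ballVolume (m : ℕ) : ℝ := √Real.pi ^ m / Real.Gamma ((m : ℝ) / 2 + 1)

lemma ballVolume_nonneg (m : ℕ) : 0 ≤ ballVolume m :=
  div_nonneg (by positivity) (Real.Gamma_nonneg_of_nonneg (by positivity))

/-- A facet is contained in a ball of its hyperplane whose radius is the diameter of the element. -/
lemma measureReal_facet_le (hd : 2 ≤ d) (hT : IsSimplex T) {F : Finset (E d)}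
    (hF : F ∈ T.powersetCard d) :
    (μHE[d - 1]).real (hull F) ≤ ballVolume (d - 1) * Metric.diam (hull T) ^ (d - 1) := by
  classical
  have hd1 : 1 ≤ d := by omega
  obtain ⟨c, hc, rfl⟩ := exists_eq_erase hT.card_eq hF
  have hg := affGrad_bary_ne_zero hT hd1 hc
  set n := outN (bary T c) with hn
  have hn1 : ‖n‖ = 1 := norm_outN hg
  obtain ⟨i, hiT, hic⟩ := exists_ne_mem hT hd1 c
  have hi0 : bary T c i = 0 := bary_of_ne hT hiT (Ne.symm hic)
  have hH : {x | bary T c x = 0} = {x | inner ℝ n (x - i) = 0} := setOf_affine_eq_zero hg hi0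
  have hsub : hull (T.erase c) ⊆ {x | inner ℝ n (x - i) = 0} := by
    rw [hull_erase_eq hT hc, hH]; exact inter_subset_right
  have hfin : Module.finrank ℝ (ℝ ∙ n)ᗮ = d - 1 := finrank_orthogonal_unit n hn1
  have : Nontrivial (ℝ ∙ n)ᗮ := Module.finrank_pos_iff.1 (by rw [hfin]; omega)
  have hm : MeasurableSet (hull (T.erase c)) :=
    (isCompact_hull (T.erase c)).isClosed.measurableSet
  have hle : μHE[d - 1] (hull (T.erase c)) ≤
      volume (Metric.closedBall (0 : (ℝ ∙ n)ᗮ) (Metric.diam (hull T))) := by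
    rw [← Measure.restrict_eq_self μHE[d - 1] hsub, ← map_add_eq_restrict n hn1 i,
      Measure.map_apply (measurableEmbedding_add n i).measurable hm]
    refine measure_mono fun y hy => ?_
    rw [mem_closedBall_zero_iff]
    have hyT : (y : E d) + i ∈ hull T := by
      rw [mem_preimage, hull_erase_eq hT hc] at hy
      exact hy.1
    have h := Metric.dist_le_diam_of_mem (isCompact_hull T).isBounded hyT (vertex_mem_hull hiT)
    rwa [dist_eq_norm, add_sub_cancel_right] at h
  rw [InnerProductSpace.volume_closedBall, hfin] at hle
  have h2 := ENNReal.toReal_mono (by finiteness) hle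
  rw [ENNReal.toReal_mul, ENNReal.toReal_pow, ENNReal.toReal_ofReal Metric.diam_nonneg] at h2
  have h3 := ENNReal.toReal_ofReal (ballVolume_nonneg (d - 1))
  rw [ballVolume] at h3 ⊢
  rwa [measureReal_def, mul_comm, ← h3]

lemma Triangulation.abs_sub_dualFun_le (hT : T ∈ M.elems) {v : E d → ℝ} {l : E d →ᵃ[ℝ] ℝ}
    (hl : EqOn v l (hull T)) {x : E d} (hx : ∃ a, IsStrictMax T a x) :
    |v x - M.dualFun v x| ≤ ‖affGrad l‖ * Metric.diam (hull T) := by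
  obtain ⟨a, ha⟩ := hx
  rw [M.dualFun_of_isStrictMax hT ha, hl ha.2.1, hl (vertex_mem_hull ha.1), affine_sub_eq]
  refine (abs_real_inner_le_norm _ _).trans ?_
  gcongr
  rw [← dist_eq_norm]
  exact Metric.dist_le_diam_of_mem (isCompact_hull T).isBounded ha.2.1 (vertex_mem_hull ha.1)

lemma ae_facet_exists_isStrictMax' (hd : 1 ≤ d) (hT : IsSimplex T) {F : Finset (E d)}
    (hF : F ∈ T.powersetCard d) :
    ∀ᵐ x ∂(μHE[d - 1]).restrict (hull F), ∃ a, IsStrictMax T a x := by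
  classical
  obtain ⟨c, hc, rfl⟩ := exists_eq_erase hT.card_eq hF
  exact ae_facet_exists_isStrictMax hd hT hc

lemma Triangulation.ae_sub_dualFun_eq_zero (hd : 1 ≤ d) (hT : T ∈ M.elems) {F : Finset (E d)}
    (hF : F ∈ T.powersetCard d) (hFΓ : hull F ⊆ frontier Ω) {v : E d → ℝ}
    (hv : ∀ x ∈ frontier Ω, v x = 0) :
    ∀ᵐ x ∂(μHE[d - 1]).restrict (hull F), v x - M.dualFun v x = 0 := by
  have hT' := M.isSimplex hT
  filter_upwards [ae_facet_exists_isStrictMax' hd hT' hF,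
    ae_restrict_mem (isCompact_hull F).isClosed.measurableSet] with x ⟨a, ha⟩ hxF
  have haF : a ∈ F := by
    by_contra haF
    have := ((mem_hull_subset_iff hT' (Finset.mem_powersetCard.1 hF).1).1 hxF).2 a ha.1 haF
    exact (bary_pos_of_max hT' ha.le).ne' this
  rw [M.dualFun_of_isStrictMax hT ha, hv x (hFΓ hxF), hv a (hFΓ (vertex_mem_hull haF)), sub_zero]

end Sizes

/-! ### Traces and divergences of the fluxes -/

section Fluxes

open Filter Topology

variable {d : ℕ} {Ω : Set (E d)} {M : Triangulation Ω} {T : Finset (E d)} {D : ModelData d}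

lemma ModelData.diffFlux_apply (v : E d → ℝ) (x : E d) (i : Fin d) :
    D.diffFlux v x i = ∑ j, D.A x i j * gradient v x j := rfl

lemma ModelData.Admissible.memW1inf_diffFlux (hD : D.Admissible Ω M) (hT : T ∈ M.elems)
    {v : E d → ℝ} (hv : M.MemS1 v) (i : Fin d) :
    MemW1inf (interior (hull T)) fun x => D.diffFlux v x i := by
  obtain ⟨l, hl⟩ := hv.2 T hT
  refine MemW1inf.congr isOpen_interior (MemW1inf.sum Finset.univ fun j _ =>
    (hD.A_lip T hT i j).const_mul (affGrad l j)) ?_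
  filter_upwards [ae_restrict_mem isOpen_interior.measurableSet] with x hx
  rw [ModelData.diffFlux_apply, gradient_of_eqOn_affine hl hx]
  exact Finset.sum_congr rfl fun j _ => mul_comm _ _

lemma ModelData.Admissible.memW1inf_b (hΩ : IsBoundedLipschitzDomain Ω) (hD : D.Admissible Ω M)
    (hT : T ∈ M.elems) (i : Fin d) : MemW1inf (interior (hull T)) fun x => D.b x i :=
  (hD.b_lip i).mono (M.interior_hull_subset hΩ hT)

lemma ModelData.Admissible.memW1inf_flux (hΩ : IsBoundedLipschitzDomain Ω)
    (hD : D.Admissible Ω M) (hT : T ∈ M.elems) {v : E d → ℝ} (hv : M.MemS1 v) (i : Fin d) :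
    MemW1inf (interior (hull T)) fun x => D.flux v x i := by
  obtain ⟨l, hl⟩ := hv.2 T hT
  refine MemW1inf.congr isOpen_interior (((hD.memW1inf_diffFlux hT hv i).const_mul (-1)).add
    ((hD.memW1inf_b hΩ hT i).smooth_mul isOpen_interior
      ((isCompact_hull T).isBounded.subset interior_subset) (contDiff_affine l))) ?_
  filter_upwards [ae_restrict_mem isOpen_interior.measurableSet] with x hx
  simp [ModelData.flux, hl (interior_subset hx)]

lemma ModelData.Admissible.trace_flux (hΩ : IsBoundedLipschitzDomain Ω)
    (hD : D.Admissible Ω M) (hT : T ∈ M.elems) {v : E d → ℝ} (hv : M.MemS1 v) :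
    EqOn (trace (hull T) (D.flux v))
      (fun x => -trace (hull T) (D.diffFlux v) x + v x • trace (hull T) D.b x) (hull T) := by
  obtain ⟨h1, h1'⟩ := trace_spec T (hD.memW1inf_flux hΩ hT hv)
  obtain ⟨h2, h2'⟩ := trace_spec T (hD.memW1inf_diffFlux hT hv)
  obtain ⟨h3, h3'⟩ := trace_spec T (hD.memW1inf_b hΩ hT)
  refine eqOn_hull_of_ae_eq (M.isSimplex hT) h1
    (h2.neg.add ((hv.1.mono (M.hull_subset hT)).smul h3)) ?_
  filter_upwards [h1', h2', h3'] with x e1 e2 e3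
  rw [e1, e2, e3]; rfl

/-- The traces of the convection field from different elements agree inside the domain. -/
lemma ModelData.Admissible.trace_b_eq (hΩ : IsBoundedLipschitzDomain Ω)
    (hD : D.Admissible Ω M) {S : Finset (E d)} (hS : S ∈ M.elems) (hT : T ∈ M.elems) {x : E d}
    (hxS : x ∈ hull S) (hxT : x ∈ hull T) (hxΩ : x ∈ Ω) :
    trace (hull S) D.b x = trace (hull T) D.b x := by
  obtain ⟨r, hr, hball⟩ := Metric.isOpen_iff.1 hΩ.isOpen x hxΩ
  obtain ⟨g, hg, hgb⟩ := exists_continuous_of_memW1inf (U := Metric.ball x r) Metric.isOpen_ball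
    (convex_ball x r) (g := D.b) fun i => (hD.b_lip i).mono hball
  have key : ∀ R ∈ M.elems, x ∈ hull R → trace (hull R) D.b x = g x := by
    intro R hR hxR
    obtain ⟨h1, h2⟩ := trace_spec R (hD.memW1inf_b hΩ hR)
    refine eq_of_ae_eq_near (M.isSimplex hR) Metric.isOpen_ball (h1.mono inter_subset_left)
      hg.continuousOn ?_ hxR (Metric.mem_ball_self hr)
    filter_upwards [ae_restrict_of_ae_restrict_of_subset inter_subset_left h2,
      ae_restrict_of_ae_restrict_of_subset inter_subset_right hgb] with y h3 h4
    rw [h3, h4]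
  rw [key S hS hxS, key T hT hxT]

/-- The weak divergence of the flux on an element. -/
lemma ModelData.Admissible.hasWeakDiv_flux (hΩ : IsBoundedLipschitzDomain Ω)
    (hD : D.Admissible Ω M) (hT : T ∈ M.elems) {v : E d → ℝ} (hv : M.MemS1 v) :
    HasWeakDiv (interior (hull T)) (trace (hull T) (D.flux v))
        (weakDiv (interior (hull T)) (D.flux v)) ∧
      MemLp (weakDiv (interior (hull T)) (D.flux v)) ⊤ (volume.restrict (hull T)) := by
  obtain ⟨Dv, h1, h2⟩ := exists_hasWeakDiv_memLp_top isOpen_interior (hD.memW1inf_flux hΩ hT hv)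
  have h3 := h1.weakDiv_ae_eq isOpen_interior
  obtain ⟨-, h4⟩ := trace_spec T (hD.memW1inf_flux hΩ hT hv)
  rw [← restrict_interior_hull] at h4 ⊢
  exact ⟨h1.congr isOpen_interior h4.symm h3.symm, (memLp_congr_ae h3).2 h2⟩

/-- Essential boundedness on the domain follows from that on the elements. -/
lemma Triangulation.memLp_top_of_elems (M : Triangulation Ω) (hΩ : IsBoundedLipschitzDomain Ω)
    {f : E d → ℝ}
    (h : ∀ T ∈ M.elems, MemLp f ⊤ (volume.restrict (interior (hull T)))) :
    MemLp f ⊤ (volume.restrict Ω) := by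
  have hm : AEStronglyMeasurable f (volume.restrict (⋃ T : M.elems, interior (hull T.1))) :=
    aestronglyMeasurable_iUnion_iff.2 fun T => (h T.1 T.2).aestronglyMeasurable
  have hsub : (Ω : Set (E d)) ≤ᵐ[volume] ⋃ T : M.elems, interior (hull T.1) := by
    filter_upwards [(ae_restrict_iff' hΩ.isOpen.measurableSet).1 (M.ae_mem_interior hΩ)] with x hx
    intro hxΩ
    obtain ⟨T, hT, hxT⟩ := hx hxΩ
    exact mem_iUnion.2 ⟨⟨T, hT⟩, hxT⟩
  choose C hC0 hC using fun T : M.elems => ae_norm_le_of_memLp_top (h T.1 T.2)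
  refine memLp_top_of_bound (hm.mono_measure (Measure.restrict_mono' hsub le_rfl)) (∑ T, C T) ?_
  have hall : ∀ᵐ x, ∀ T : M.elems, x ∈ interior (hull T.1) → ‖f x‖ ≤ C T :=
    ae_all_iff.2 fun T => (ae_restrict_iff' isOpen_interior.measurableSet).1 (hC T)
  filter_upwards [M.ae_mem_interior hΩ, ae_restrict_of_ae hall] with x ⟨T, hT, hxT⟩ hx
  exact (hx ⟨T, hT⟩ hxT).trans (Finset.single_le_sum (fun T _ => hC0 T) (Finset.mem_univ _))

end Fluxes

/-! ### The error identity -/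

section Identity

open Filter Topology

variable {d : ℕ} {Ω : Set (E d)} {M : Triangulation Ω} {T : Finset (E d)} {D : ModelData d}

lemma integral_sub_sub {μ : Measure (E d)} {f g h : E d → ℝ} (hf : Integrable f μ)
    (hg : Integrable g μ) (hh : Integrable h μ) :
    ∫ x, f x - g x - h x ∂μ = ∫ x, f x ∂μ - ∫ x, g x ∂μ - ∫ x, h x ∂μ := by
  rw [← integral_sub hf hg]
  exact integral_sub (hf.sub hg) hh

lemma ModelData.Admissible.memLp_A (hΩ : IsBoundedLipschitzDomain Ω) (hD : D.Admissible Ω M)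
    (i j : Fin d) : MemLp (fun x => D.A x i j) ⊤ (volume.restrict Ω) :=
  M.memLp_top_of_elems hΩ fun T hT => (hD.A_lip T hT i j).1

lemma MemH1.memLp_weakGrad (hΩ : IsBoundedLipschitzDomain Ω) {w : E d → ℝ} (hw : MemH1 Ω w) :
    HasWeakGrad Ω w (weakGrad Ω w) ∧ MemLp (weakGrad Ω w) 2 (volume.restrict Ω) := by
  obtain ⟨-, G, hG, hG2⟩ := hw
  have h := hG.weakGrad_ae_eq hΩ.isOpen
  exact ⟨hG.congr hΩ.isOpen (ae_eq_refl _) h.symm, (memLp_congr_ae h).2 hG2⟩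

/-- The integrands of the bilinear form are integrable. -/
lemma ModelData.Admissible.integrable_bilin (hΩ : IsBoundedLipschitzDomain Ω)
    (hD : D.Admissible Ω M) (hd : 1 ≤ d) {w v : E d → ℝ} (hw : MemH1 Ω w) (hv : M.MemS1 v) :
    IntegrableOn (fun x => inner ℝ
      (Matrix.toEuclideanCLM (𝕜 := ℝ) (D.A x) (weakGrad Ω w x) - w x • D.b x) (weakGrad Ω v x)) Ω ∧
    IntegrableOn (fun x => D.c x * w x * v x) Ω := by
  have := hΩ.isFiniteMeasure_restrict
  have hw1 : Integrable w (volume.restrict Ω) := hw.1.integrable one_le_two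
  have hG : Integrable (weakGrad Ω w) (volume.restrict Ω) :=
    (hw.memLp_weakGrad hΩ).2.integrable one_le_two
  have hGj : ∀ j, Integrable (fun x => weakGrad Ω w x j) (volume.restrict Ω) := fun j =>
    (EuclideanSpace.proj (𝕜 := ℝ) j).integrable_comp hG
  have hvs := hv.isPiecewiseSmooth
  have hH : MemLp (weakGrad Ω v) ⊤ (volume.restrict Ω) :=
    (memLp_congr_ae ((hvs.hasWeakGrad hΩ hd).weakGrad_ae_eq hΩ.isOpen)).2 (hvs.memLp_gradient hΩ ⊤)
  have hHi : ∀ i, MemLp (fun x => weakGrad Ω v x i) ⊤ (volume.restrict Ω) := fun i =>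
    (EuclideanSpace.proj (𝕜 := ℝ) i).comp_memLp' hH
  constructor
  · have e : (fun x => inner ℝ (Matrix.toEuclideanCLM (𝕜 := ℝ) (D.A x) (weakGrad Ω w x) -
        w x • D.b x) (weakGrad Ω v x)) = fun x => ∑ i, (∑ j, D.A x i j * weakGrad Ω w x j -
          D.b x i * w x) * weakGrad Ω v x i := by
      funext x
      rw [PiLp.inner_apply]
      refine Finset.sum_congr rfl fun i _ => ?_
      rw [mul_comm (D.b x i)]
      exact mul_comm _ _
    rw [e]
    refine integrable_finsetSum _ fun i _ => ?_
    refine Integrable.mul_of_top_left (φ := fun x => ∑ j, D.A x i j * weakGrad Ω w x j -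
      D.b x i * w x) (Integrable.sub ?_ ?_) (hHi i)
    · exact integrable_finsetSum _ fun j _ => (hGj j).mul_of_top_right (hD.memLp_A hΩ i j)
    · exact hw1.mul_of_top_right (hD.b_lip i).1
  · have h1 : Integrable (fun x => D.c x * w x) (volume.restrict Ω) := hw1.mul_of_top_right hD.c_mem
    exact h1.mul_of_top_left (hvs.memLp hΩ ⊤)

lemma ModelData.Admissible.bilin_sub (hΩ : IsBoundedLipschitzDomain Ω)
    (hD : D.Admissible Ω M) (hd : 1 ≤ d) {u w v : E d → ℝ} (hu : MemH1 Ω u) (hw : MemH1 Ω w)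
    (hv : M.MemS1 v) : D.bilin Ω (u - w) v = D.bilin Ω u v - D.bilin Ω w v := by
  obtain ⟨i1, i2⟩ := hD.integrable_bilin hΩ hd hu hv
  obtain ⟨j1, j2⟩ := hD.integrable_bilin hΩ hd hw hv
  have hG : weakGrad Ω (u - w) =ᵐ[volume.restrict Ω] fun x => weakGrad Ω u x - weakGrad Ω w x :=
    HasWeakGrad.weakGrad_ae_eq hΩ.isOpen
      ((hu.memLp_weakGrad hΩ).1.sub (hw.memLp_weakGrad hΩ).1)
  rw [ModelData.bilin, ModelData.bilin, ModelData.bilin, add_sub_add_comm, ← integral_sub i1 j1,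
    ← integral_sub i2 j2]
  congr 1
  · refine integral_congr_ae ?_
    filter_upwards [hG] with x hx
    rw [hx, ← inner_sub_left, map_sub, Pi.sub_apply, sub_smul]
    congr 1
    abel
  · refine integral_congr_ae (Eventually.of_forall fun x => ?_)
    simp only [Pi.sub_apply]
    ring

/-- Integration by parts of the flux against an affine function on an element. -/
lemma ModelData.Admissible.integral_flux_gradient (hΩ : IsBoundedLipschitzDomain Ω)
    (hD : D.Admissible Ω M) (hd : 1 ≤ d) (hT : T ∈ M.elems) {w v : E d → ℝ} (hw : M.MemS1 w)
    (hv : M.MemS1 v) :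
    ∫ x in hull T, inner ℝ (D.flux w x) (gradient v x) =
      (∑ F ∈ T.powersetCard d, ∫ x in hull F,
        inner ℝ (trace (hull T) (D.flux w) x) (facetN T F) * v x ∂μHE[d - 1]) -
      ∫ x in hull T, weakDiv (interior (hull T)) (D.flux w) x * v x := by
  have hT' := M.isSimplex hT
  obtain ⟨l, hl⟩ := hv.2 T hT
  obtain ⟨hg, hge⟩ := trace_spec T (hD.memW1inf_flux hΩ hT hw)
  obtain ⟨hdiv, hdi⟩ := hD.hasWeakDiv_flux hΩ hT hw
  set g := trace (hull T) (D.flux w)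
  set Dv := weakDiv (interior (hull T)) (D.flux w)
  have : IsFiniteMeasure (volume.restrict (hull T)) :=
    ⟨by rw [Measure.restrict_apply_univ]; exact (isCompact_hull T).measure_lt_top⟩
  have hDvi : IntegrableOn Dv (hull T) := hdi.integrable le_top
  have hlg : ∀ x, gradient l x = affGrad l := fun x => (hasGradientAt_affine l x).gradient
  have i1 : IntegrableOn (fun x => l x * Dv x) (hull T) :=
    hDvi.continuousOn_mul (continuous_affine l).continuousOn (isCompact_hull T)
  have i2 : IntegrableOn (fun x => inner ℝ (g x) (gradient l x)) (hull T) := by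
    simp only [hlg]
    exact (hg.inner continuousOn_const).integrableOn_compact (isCompact_hull T)
  have key := divergence_simplex hd hT' (g := fun x => l x • g x)
    ((continuous_affine l).continuousOn.smul hg)
    (hdiv.smooth_smul isOpen_interior (contDiff_affine l)) (i1.add i2)
  rw [integral_add i1 i2] at key
  have e1 : ∫ x in hull T, inner ℝ (D.flux w x) (gradient v x) =
      ∫ x in hull T, inner ℝ (g x) (gradient l x) := by
    have hgr : ∀ᵐ x ∂volume.restrict (hull T), gradient v x = affGrad l := by
      rw [← restrict_interior_hull]
      filter_upwards [ae_restrict_mem isOpen_interior.measurableSet] with x hx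
      exact gradient_of_eqOn_affine hl hx
    refine integral_congr_ae ?_
    filter_upwards [hge, hgr] with x h1 h2
    rw [h1, h2, hlg]
  have e2 : ∫ x in hull T, Dv x * v x = ∫ x in hull T, l x * Dv x := by
    refine setIntegral_congr_fun (isCompact_hull T).isClosed.measurableSet fun x hx => ?_
    rw [hl hx, mul_comm]
  rw [e1, e2, eq_sub_iff_add_eq, add_comm, key]
  refine Finset.sum_congr rfl fun F hF => ?_
  refine setIntegral_congr_fun (isCompact_hull F).isClosed.measurableSet fun x hx => ?_
  have hxT : x ∈ hull T :=
    convexHull_mono (by exact_mod_cast (Finset.mem_powersetCard.1 hF).1) hx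
  rw [real_inner_smul_left, hl hxT, mul_comm]

/-- The residual of a piecewise affine function is square integrable. -/
lemma ModelData.Admissible.memLp_residual (hΩ : IsBoundedLipschitzDomain Ω)
    (hD : D.Admissible Ω M) (hT : T ∈ M.elems) {w : E d → ℝ} (hw : M.MemS1 w) :
    MemLp (D.residual w T) 2 (volume.restrict (hull T)) := by
  have : IsFiniteMeasure (volume.restrict (hull T)) :=
    ⟨by rw [Measure.restrict_apply_univ]; exact (isCompact_hull T).measure_lt_top⟩
  have hle := M.restrict_hull_le hΩ hT
  have h1 : MemLp D.f 2 (volume.restrict (hull T)) := hD.f_mem.mono_measure hle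
  have h2 := (hD.hasWeakDiv_flux hΩ hT hw).2.mono_exponent (p := 2) le_top
  have h3 : MemLp (fun x => D.c x * w x) 2 (volume.restrict (hull T)) := by
    have h4 : MemLp w 2 (volume.restrict (hull T)) :=
      (hw.isPiecewiseSmooth.memLp hΩ 2).mono_measure hle
    exact h4.mul (hD.c_mem.mono_measure hle)
  exact (h1.sub h2).sub h3

/-- Products with the interpolation error are integrable. -/
lemma Triangulation.integrableOn_mul_sub_dualFun (hT : T ∈ M.elems) {μ : Measure (E d)}
    {K : Set (E d)} (hKc : IsCompact K) (hK : ∀ᵐ x ∂μ.restrict K, ∃ a, IsStrictMax T a x)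
    {ψ v : E d → ℝ} (hψ : IntegrableOn ψ K μ) (hv : ContinuousOn v K) :
    IntegrableOn (fun x => ψ x * v x) K μ ∧ IntegrableOn (fun x => ψ x * M.dualFun v x) K μ ∧
      IntegrableOn (fun x => ψ x * (v x - M.dualFun v x)) K μ ∧
      ∫ x in K, ψ x * (v x - M.dualFun v x) ∂μ =
        ∫ x in K, ψ x * v x ∂μ - ∫ x in K, ψ x * M.dualFun v x ∂μ := by
  have h1 := hψ.mul_continuousOn hv hKc
  have h2 := (M.setIntegral_mul_dualFun hT hK hψ v).1
  refine ⟨h1, h2, ?_, ?_⟩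
  · simp only [mul_sub]; exact h1.sub h2
  · simp only [mul_sub]; exact integral_sub h1 h2

/-- The residual of a piecewise affine function in weak form, after elementwise integration by
parts. -/
lemma ModelData.Admissible.bilin_eq_sum (hΩ : IsBoundedLipschitzDomain Ω)
    (hD : D.Admissible Ω M) (hd : 1 ≤ d) {w v : E d → ℝ} (hw : M.MemS1 w) (hv : M.MemS1 v) :
    (∫ x in Ω, D.f x * v x) - D.bilin Ω w v = ∑ T ∈ M.elems,
      ((∫ x in hull T, D.residual w T x * v x) + ∑ F ∈ T.powersetCard d, ∫ x in hull F,
        inner ℝ (trace (hull T) (D.flux w) x) (facetN T F) * v x ∂μHE[d - 1]) := by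
  have hfin := hΩ.isFiniteMeasure_restrict
  have hws := hw.isPiecewiseSmooth
  have hvs := hv.isPiecewiseSmooth
  obtain ⟨i1, i2⟩ := hD.integrable_bilin hΩ hd (hws.memH1 hΩ hd) hv
  have hf : IntegrableOn D.f Ω := hD.f_mem.integrable one_le_two
  have hfv : IntegrableOn (fun x => D.f x * v x) Ω := hf.mul_of_top_left (hvs.memLp hΩ ⊤)
  have e1 : (fun x => inner ℝ
      (Matrix.toEuclideanCLM (𝕜 := ℝ) (D.A x) (weakGrad Ω w x) - w x • D.b x) (weakGrad Ω v x))
      =ᵐ[volume.restrict Ω] fun x => -inner ℝ (D.flux w x) (gradient v x) := by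
    filter_upwards [(hws.hasWeakGrad hΩ hd).weakGrad_ae_eq hΩ.isOpen,
      (hvs.hasWeakGrad hΩ hd).weakGrad_ae_eq hΩ.isOpen] with x h1 h2
    rw [h1, h2, ← inner_neg_left]
    congr 1
    simp only [ModelData.flux, ModelData.diffFlux]
    abel
  have i1' := i1.congr e1
  rw [ModelData.bilin, integral_congr_ae e1, M.setIntegral_eq_sum hΩ hfv,
    M.setIntegral_eq_sum hΩ i1', M.setIntegral_eq_sum hΩ i2, ← Finset.sum_add_distrib,
    ← Finset.sum_sub_distrib]
  refine Finset.sum_congr rfl fun T hT => ?_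
  have : IsFiniteMeasure (volume.restrict (hull T)) :=
    ⟨by rw [Measure.restrict_apply_univ]; exact (isCompact_hull T).measure_lt_top⟩
  rw [integral_neg, hD.integral_flux_gradient hΩ hd hT hw hv]
  have hdi : IntegrableOn (weakDiv (interior (hull T)) (D.flux w)) (hull T) :=
    (hD.hasWeakDiv_flux hΩ hT hw).2.integrable le_top
  have j1 := M.integrableOn_hull hΩ hfv hT
  have j2 := hdi.mul_continuousOn (hv.1.mono (M.hull_subset hT)) (isCompact_hull T)
  have j3 := M.integrableOn_hull hΩ i2 hT
  have : ∫ x in hull T, D.residual w T x * v x = (∫ x in hull T, D.f x * v x) -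
      (∫ x in hull T, weakDiv (interior (hull T)) (D.flux w) x * v x) -
      ∫ x in hull T, D.c x * w x * v x := by
    rw [← integral_sub_sub j1 j2 j3]
    refine integral_congr_ae (Eventually.of_forall fun x => ?_)
    simp only [ModelData.residual]
    ring
  rw [this]
  ring

/-- The finite volume scheme, tested with the nodal values of `v`, in terms of element and facet
integrals. -/
lemma ModelData.Admissible.fvm_eq_sum (hΩ : IsBoundedLipschitzDomain Ω)
    (hD : D.Admissible Ω M) (hd : 1 ≤ d) {w v : E d → ℝ} (hw : D.IsFVMSolution M w)
    (hv : M.MemS10 v) :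
    0 = ∑ T ∈ M.elems,
      ((∫ x in hull T, D.residual w T x * M.dualFun v x) + ∑ F ∈ T.powersetCard d, ∫ x in hull F,
        inner ℝ (trace (hull T) (D.flux w) x) (facetN T F) * M.dualFun v x ∂μHE[d - 1]) := by
  have hfin := hΩ.isFiniteMeasure_restrict
  obtain ⟨⟨hw1, -⟩, hsol⟩ := hw
  have hf : IntegrableOn D.f Ω := hD.f_mem.integrable one_le_two
  have hcw : IntegrableOn (fun x => D.c x * w x) Ω :=
    Integrable.mul_of_top_right (hw1.isPiecewiseSmooth.integrableOn hΩ) hD.c_mem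
  have hdual : ∀ {ψ : E d → ℝ}, IntegrableOn ψ Ω →
      IntegrableOn (fun x => ψ x * M.dualFun v x) Ω := fun hψ =>
    integrableOn_union_hull M fun T hT => (M.setIntegral_mul_dualFun hT
      (ae_exists_isStrictMax (M.isSimplex hT)) (M.integrableOn_hull hΩ hψ hT) v).1
  have h := hsol v (M.memP00_of_boundary hΩ hv.2)
  have hdi : ∀ T ∈ M.elems, IntegrableOn (weakDiv (interior (hull T)) (D.flux w)) (hull T) := by
    intro T hT
    have : IsFiniteMeasure (volume.restrict (hull T)) :=
      ⟨by rw [Measure.restrict_apply_univ]; exact (isCompact_hull T).measure_lt_top⟩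
    exact (hD.hasWeakDiv_flux hΩ hT hw1).2.integrable le_top
  simp only [ModelData.fvmForm, mul_add, Finset.sum_add_distrib, ModelData.boundaryFlux] at h
  rw [← M.setIntegral_mul_dualFun_domain hΩ hcw hv.2,
    M.sum_boundaryFlux hΩ hd (G := fun T => trace (hull T) (D.flux w))
      (D := fun T => weakDiv (interior (hull T)) (D.flux w))
      (fun T hT => (trace_spec T (hD.memW1inf_flux hΩ hT hw1)).1)
      (fun T hT => (hD.hasWeakDiv_flux hΩ hT hw1).1) hdi hv.2,
    M.setIntegral_eq_sum hΩ (hdual hf), M.setIntegral_eq_sum hΩ (hdual hcw),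
    ← Finset.sum_add_distrib] at h
  rw [← sub_eq_zero.2 h.symm, ← Finset.sum_sub_distrib]
  refine Finset.sum_congr rfl fun T hT => ?_
  have j1 := M.integrableOn_hull hΩ (hdual hf) hT
  have j2 := (M.setIntegral_mul_dualFun hT
      (ae_exists_isStrictMax (M.isSimplex hT)) (hdi T hT) v).1
  have j3 := M.integrableOn_hull hΩ (hdual hcw) hT
  have : ∫ x in hull T, D.residual w T x * M.dualFun v x =
      (∫ x in hull T, D.f x * M.dualFun v x) -
      (∫ x in hull T, weakDiv (interior (hull T)) (D.flux w) x * M.dualFun v x) -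
      ∫ x in hull T, D.c x * w x * M.dualFun v x := by
    rw [← integral_sub_sub j1 j2 j3]
    refine integral_congr_ae (Eventually.of_forall fun x => ?_)
    simp only [ModelData.residual]
    ring
  rw [this]
  ring

/-- The error identity: the Galerkin defect is the residual, tested with the difference between a
piecewise affine function and its dual-mesh interpolant. -/
lemma ModelData.Admissible.bilin_error_eq (hΩ : IsBoundedLipschitzDomain Ω)
    (hD : D.Admissible Ω M) (hd : 1 ≤ d) {u w v : E d → ℝ} (hu : D.IsWeakSolution Ω u)
    (hw : D.IsFVMSolution M w) (hv : M.MemS10 v) :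
    D.bilin Ω (u - w) v = ∑ T ∈ M.elems,
      ((∫ x in hull T, D.residual w T x * (v x - M.dualFun v x)) + ∑ F ∈ T.powersetCard d,
        ∫ x in hull F, inner ℝ (trace (hull T) (D.flux w) x) (facetN T F) *
          (v x - M.dualFun v x) ∂μHE[d - 1]) := by
  have hw1 := hw.1.1
  rw [hD.bilin_sub hΩ hd hu.1.1 (hw1.isPiecewiseSmooth.memH1 hΩ hd) hv.1,
    hu.2 v (hv.memH10 hΩ hd), hD.bilin_eq_sum hΩ hd hw1 hv.1, ← sub_zero (Finset.sum _ _)]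
  conv_lhs => rw [hD.fvm_eq_sum hΩ hd hw hv]
  rw [← Finset.sum_sub_distrib]
  refine Finset.sum_congr rfl fun T hT => ?_
  have hT' := M.isSimplex hT
  have : IsFiniteMeasure (volume.restrict (hull T)) :=
    ⟨by rw [Measure.restrict_apply_univ]; exact (isCompact_hull T).measure_lt_top⟩
  have hvT := hv.1.1.mono (M.hull_subset hT)
  have hR : IntegrableOn (D.residual w T) (hull T) :=
    (hD.memLp_residual hΩ hT hw1).integrable one_le_two
  rw [(M.integrableOn_mul_sub_dualFun hT (isCompact_hull T) (ae_exists_isStrictMax hT') hR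
    hvT).2.2.2, add_sub_add_comm, ← Finset.sum_sub_distrib]
  congr 1
  refine Finset.sum_congr rfl fun F hF => ?_
  have hFT : hull F ⊆ hull T :=
    convexHull_mono (by exact_mod_cast (Finset.mem_powersetCard.1 hF).1)
  refine ((M.integrableOn_mul_sub_dualFun hT (isCompact_hull F)
    (ae_facet_exists_isStrictMax' hd hT' hF) (integrableOn_facet hd hT' hF ?_)
    (hvT.mono hFT)).2.2.2).symm
  exact ((trace_spec T (hD.memW1inf_flux hΩ hT hw1)).1.mono hFT).inner continuousOn_const

end Identity

/-! ### Normal jumps -/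

section Jumps

open Filter Topology

variable {d : ℕ} {Ω : Set (E d)} {M : Triangulation Ω} {T : Finset (E d)} {D : ModelData d}

lemma hull_facet_subset {F : Finset (E d)} (hF : F ∈ T.powersetCard d) : hull F ⊆ hull T :=
  convexHull_mono (by exact_mod_cast (Finset.mem_powersetCard.1 hF).1)

lemma ae_outerNormal_hull (hd : 1 ≤ d) (hT : IsSimplex T) {F : Finset (E d)}
    (hF : F ∈ T.powersetCard d) :
    ∀ᵐ x ∂(μHE[d - 1]).restrict (hull F), outerNormal (hull T) x = facetN T F := by
  classical
  obtain ⟨c, hc, rfl⟩ := exists_eq_erase hT.card_eq hF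
  filter_upwards [ae_facet hT hd hc] with x hx
  rw [facetN_erase hc, outerNormal_hull hT hd hc hx.1 hx.2.2]

lemma ModelData.jump_ae_eq (hd : 1 ≤ d) {F : Finset (E d)} (hF : F.card = d)
    (w : E d → ℝ) : D.jump M w F =ᵐ[(μHE[d - 1]).restrict (hull F)] fun x =>
      ∑ S ∈ M.elems with F ⊆ S, inner ℝ (trace (hull S) (D.diffFlux w) x) (facetN S F) := by
  have h : ∀ᵐ x ∂(μHE[d - 1]).restrict (hull F), ∀ S ∈ M.elems, F ⊆ S →
      outerNormal (hull S) x = facetN S F := by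
    refine (Finset.eventually_all _).2 fun S hS => ?_
    by_cases hFS : F ⊆ S
    · filter_upwards [ae_outerNormal_hull hd (M.isSimplex hS)
        (Finset.mem_powersetCard.2 ⟨hFS, hF⟩)] with x hx _ using hx
    · exact Eventually.of_forall fun x h => absurd h hFS
  filter_upwards [h] with x hx
  refine Finset.sum_congr (by ext; simp) fun S hS => ?_
  obtain ⟨hS, hFS⟩ := Finset.mem_filter.1 hS
  rw [hx S hS hFS]

lemma ModelData.Admissible.continuousOn_trace_diffFlux (hD : D.Admissible Ω M) (hT : T ∈ M.elems)
    {w : E d → ℝ} (hw : M.MemS1 w) {F : Finset (E d)} (hF : F ∈ T.powersetCard d) (e : E d) :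
    ContinuousOn (fun x => inner ℝ (trace (hull T) (D.diffFlux w) x) e) (hull F) :=
  ((trace_spec T (hD.memW1inf_diffFlux hT hw)).1.mono (hull_facet_subset hF)).inner
    continuousOn_const

lemma Triangulation.mem_powersetCard_of_mem_intFacets (M : Triangulation Ω) {F : Finset (E d)}
    (hF : F ∈ M.intFacets T) : F ∈ T.powersetCard d := by
  classical
  rw [Triangulation.intFacets, Finset.mem_filter] at hF
  exact hF.1

/-- The normal jump is square integrable on each facet. -/
lemma ModelData.Admissible.memLp_jump (hD : D.Admissible Ω M) (hd : 1 ≤ d) (hT : T ∈ M.elems)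
    {w : E d → ℝ} (hw : M.MemS1 w) {F : Finset (E d)} (hF : F ∈ T.powersetCard d) :
    MemLp (D.jump M w F) 2 ((μHE[d - 1]).restrict (hull F)) := by
  classical
  have hcard := (Finset.mem_powersetCard.1 hF).2
  have hm : MeasurableSet (hull F) := (isCompact_hull F).isClosed.measurableSet
  have : IsFiniteMeasure ((μHE[d - 1]).restrict (hull F)) :=
    ⟨by rw [Measure.restrict_apply_univ]; exact hull_facet_finite hd (M.isSimplex hT) hF⟩
  have hcont : ContinuousOn (fun x => ∑ S ∈ M.elems with F ⊆ S,
      inner ℝ (trace (hull S) (D.diffFlux w) x) (facetN S F)) (hull F) := by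
    refine continuousOn_finsetSum _ fun S hS => ?_
    obtain ⟨hS, hFS⟩ := Finset.mem_filter.1 hS
    exact hD.continuousOn_trace_diffFlux hS hw (Finset.mem_powersetCard.2 ⟨hFS, hcard⟩) _
  obtain ⟨C, hC⟩ := (isCompact_hull F).exists_bound_of_continuousOn hcont
  refine (memLp_congr_ae (ModelData.jump_ae_eq hd hcard w)).2
    (MemLp.of_bound (hcont.aestronglyMeasurable hm) C ?_)
  filter_upwards [ae_restrict_mem hm] with x hx using hC x hx

/-- The facet integrals of the flux reduce to those of the normal jumps over the interior facets:
the convection field does not jump. -/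
lemma ModelData.Admissible.sum_facets_eq_jump (hΩ : IsBoundedLipschitzDomain Ω)
    (hD : D.Admissible Ω M) (hd : 1 ≤ d) {w v : E d → ℝ} (hw : M.MemS1 w) (hv : M.MemS10 v) :
    ∑ T ∈ M.elems, ∑ F ∈ T.powersetCard d, ∫ x in hull F,
      inner ℝ (trace (hull T) (D.flux w) x) (facetN T F) * (v x - M.dualFun v x) ∂μHE[d - 1] =
    -∑ F ∈ M.facets, ∫ x in hull F, D.jump M w F x * (v x - M.dualFun v x) ∂μHE[d - 1] := by
  have hint : ∀ T ∈ M.elems, ∀ F ∈ T.powersetCard d, ∀ ψ : E d → ℝ, ContinuousOn ψ (hull F) →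
      IntegrableOn (fun x => ψ x * (v x - M.dualFun v x)) (hull F) μHE[d - 1] := by
    intro T hT F hF ψ hψ
    have hT' := M.isSimplex hT
    exact (M.integrableOn_mul_sub_dualFun hT (isCompact_hull F)
      (ae_facet_exists_isStrictMax' hd hT' hF) (integrableOn_facet hd hT' hF hψ)
      (hv.1.1.mono ((hull_facet_subset hF).trans (M.hull_subset hT)))).2.2.1
  have hw0 : ∀ T ∈ M.elems, ∀ F ∈ T.powersetCard d, hull F ⊆ frontier Ω →
      ∀ᵐ x ∂(μHE[d - 1]).restrict (hull F), v x - M.dualFun v x = 0 := fun T hT F hF hFΓ =>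
    M.ae_sub_dualFun_eq_zero hd hT hF hFΓ hv.2
  have hbint : ∀ T ∈ M.elems, ∀ F ∈ T.powersetCard d, IntegrableOn (fun x =>
      w x * (v x - M.dualFun v x) * inner ℝ (trace (hull T) D.b x) (facetN T F))
      (hull F) μHE[d - 1] := by
    intro T hT F hF
    have h := hint T hT F hF (fun x => w x * inner ℝ (trace (hull T) D.b x) (facetN T F))
      ((hw.1.mono ((hull_facet_subset hF).trans (M.hull_subset hT))).mul
        (((trace_spec T (hD.memW1inf_b hΩ hT)).1.mono (hull_facet_subset hF)).inner
          continuousOn_const))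
    refine h.congr_fun (fun x _ => ?_) (isCompact_hull F).isClosed.measurableSet
    ring
  have hb := M.sum_facets_eq_zero hΩ hd (fun T => trace (hull T) D.b)
    (fun x => w x * (v x - M.dualFun v x))
    (fun F _ S hS T hT hFS hFT x hx hxΩ => hD.trace_b_eq hΩ hS hT
      (convexHull_mono (by exact_mod_cast hFS) hx) (convexHull_mono (by exact_mod_cast hFT) hx) hxΩ)
    hbint (fun T hT F hF hFΓ => by
      filter_upwards [hw0 T hT F hF hFΓ] with x hx
      rw [hx, mul_zero])
  have hq : ∀ T ∈ M.elems, ∀ F ∈ T.powersetCard d, IntegrableOn (fun x =>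
      inner ℝ (trace (hull T) (D.diffFlux w) x) (facetN T F) * (v x - M.dualFun v x))
      (hull F) μHE[d - 1] := fun T hT F hF =>
    hint T hT F hF _ (hD.continuousOn_trace_diffFlux hT hw hF _)
  have hsplit : ∀ T ∈ M.elems, ∀ F ∈ T.powersetCard d, ∫ x in hull F,
      inner ℝ (trace (hull T) (D.flux w) x) (facetN T F) * (v x - M.dualFun v x) ∂μHE[d - 1] =
      (∫ x in hull F, w x * (v x - M.dualFun v x) *
        inner ℝ (trace (hull T) D.b x) (facetN T F) ∂μHE[d - 1]) -
      ∫ x in hull F, inner ℝ (trace (hull T) (D.diffFlux w) x) (facetN T F) *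
        (v x - M.dualFun v x) ∂μHE[d - 1] := by
    intro T hT F hF
    rw [← integral_sub (hbint T hT F hF) (hq T hT F hF)]
    refine setIntegral_congr_fun (isCompact_hull F).isClosed.measurableSet fun x hx => ?_
    rw [hD.trace_flux hΩ hT hw (hull_facet_subset hF hx), inner_add_left, inner_neg_left,
      real_inner_smul_left]
    ring
  rw [Finset.sum_congr rfl fun T hT => Finset.sum_congr rfl fun F hF => hsplit T hT F hF]
  simp only [Finset.sum_sub_distrib]
  rw [hb, zero_sub, M.sum_elems_facets]
  congr 1
  refine Finset.sum_congr rfl fun F hF => ?_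
  obtain ⟨T, hT, hFT⟩ := Finset.mem_biUnion.1 hF
  have hcard := (Finset.mem_powersetCard.1 hFT).2
  rw [← integral_finsetSum]
  · refine integral_congr_ae ?_
    filter_upwards [ModelData.jump_ae_eq (D := D) (M := M) hd hcard w] with x hx
    rw [hx, Finset.sum_mul]
  · intro S hS
    obtain ⟨hS, hFS⟩ := Finset.mem_filter.1 hS
    exact hq S hS F (Finset.mem_powersetCard.2 ⟨hFS, hcard⟩)

end Jumps

/-! ### The estimate by the oscillations -/

section Estimate

open Filter Topology

variable {d : ℕ} {Ω : Set (E d)} {M : Triangulation Ω} {T : Finset (E d)} {D : ModelData d}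

lemma integral_abs_le_sqrt {X : Type*} [MeasurableSpace X] {ν : Measure X} [IsFiniteMeasure ν]
    {f : X → ℝ} (hf : MemLp f 2 ν) :
    ∫ x, |f x| ∂ν ≤ √(ν.real univ) * √(∫ x, f x ^ 2 ∂ν) := by
  have h := integral_mul_norm_le_Lp_mul_Lq (μ := ν) (f := f) (g := fun _ => (1 : ℝ))
    Real.HolderConjugate.two_two (by simpa using hf) (memLp_const 1)
  simp only [norm_one, mul_one, Real.norm_eq_abs, integral_const, smul_eq_mul,
    ← Real.sqrt_eq_rpow, Real.rpow_two, sq_abs, one_pow] at h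
  rwa [mul_comm] at h

/-- A function with mean zero does not see constants. -/
lemma abs_integral_mul_le {X : Type*} [MeasurableSpace X] {ν : Measure X} [IsFiniteMeasure ν]
    {f w : X → ℝ} (hf : MemLp f 2 ν) (hw : Integrable w ν) {B : ℝ} (hB : 0 ≤ B)
    (hwB : ∀ᵐ x ∂ν, |w x| ≤ B) (hw0 : ∫ x, w x ∂ν = 0) (c : ℝ) :
    |∫ x, f x * w x ∂ν| ≤ B * (√(ν.real univ) * √(∫ x, (f x - c) ^ 2 ∂ν)) := by
  have hfi := hf.integrable one_le_two
  have hfc : MemLp (fun x => f x - c) 2 ν := hf.sub (memLp_const c)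
  have hwt : MemLp w ⊤ ν := memLp_top_of_bound hw.aestronglyMeasurable B hwB
  have h1 : Integrable (fun x => f x * w x) ν := hfi.mul_of_top_left hwt
  have e : ∫ x, f x * w x ∂ν = ∫ x, (f x - c) * w x ∂ν := by
    simp only [sub_mul]
    rw [integral_sub h1 (hw.const_mul c), integral_const_mul, hw0, mul_zero, sub_zero]
  rw [e]
  refine (abs_integral_le_integral_abs).trans ?_
  refine le_trans ?_ (mul_le_mul_of_nonneg_left (integral_abs_le_sqrt hfc) hB)
  rw [← integral_const_mul]
  refine integral_mono_ae ((hfc.integrable one_le_two).mul_of_top_left hwt).abs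
    ((hfc.integrable one_le_two).abs.const_mul B) ?_
  filter_upwards [hwB] with x hx
  rw [abs_mul, mul_comm]
  gcongr

lemma volume_hull_pos (hT : IsSimplex T) : 0 < volume.real (hull T) := by
  refine ENNReal.toReal_pos ?_ (isCompact_hull T).measure_lt_top.ne
  exact ((isOpen_interior.measure_pos volume (interior_hull_nonempty hT)).trans_le
    (measure_mono interior_subset)).ne'

lemma meshSize_pos (hT : IsSimplex T) : 0 < meshSize T := Real.rpow_pos_of_pos (volume_hull_pos hT) _

lemma meshSize_pow (hd : 1 ≤ d) : meshSize T ^ d = volume.real (hull T) := by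
  rw [meshSize, one_div]
  exact Real.rpow_inv_natCast_pow measureReal_nonneg (by omega)

lemma ModelData.oscLocalSq_nonneg (D : ModelData d) (M : Triangulation Ω) (w : E d → ℝ)
    (hT : IsSimplex T) : 0 ≤ D.oscLocalSq M w T := by
  refine add_nonneg (mul_nonneg (by positivity) (integral_nonneg fun x => by positivity))
    (mul_nonneg (meshSize_pos hT).le (Finset.sum_nonneg fun F _ => integral_nonneg fun x => ?_))
  positivity

lemma ModelData.sqrt_residual_le (D : ModelData d) (M : Triangulation Ω) (w : E d → ℝ)
    (hT : IsSimplex T) :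
    meshSize T * √(∫ x in hull T, (D.residual w T x - ⨍ y in hull T, D.residual w T y) ^ 2) ≤
      √(D.oscLocalSq M w T) := by
  refine Real.le_sqrt_of_sq_le ?_
  rw [mul_pow, Real.sq_sqrt (integral_nonneg fun x => by positivity), ModelData.oscLocalSq]
  refine le_add_of_nonneg_right
    (mul_nonneg (meshSize_pos hT).le (Finset.sum_nonneg fun F _ => integral_nonneg fun x => ?_))
  positivity

lemma ModelData.sqrt_jump_le (D : ModelData d) (M : Triangulation Ω) (w : E d → ℝ)
    (hT : IsSimplex T) {F : Finset (E d)} (hF : F ∈ M.intFacets T) :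
    √(meshSize T) * √(∫ x in hull F, (D.jump M w F x -
      ⨍ y in hull F, D.jump M w F y ∂μHE[d - 1]) ^ 2 ∂μHE[d - 1]) ≤ √(D.oscLocalSq M w T) := by
  rw [← Real.sqrt_mul (meshSize_pos hT).le]
  refine Real.sqrt_le_sqrt ?_
  rw [ModelData.oscLocalSq]
  refine le_add_of_nonneg_of_le
    (mul_nonneg (by positivity) (integral_nonneg fun x => by positivity)) ?_
  refine mul_le_mul_of_nonneg_left ?_ (meshSize_pos hT).le
  exact Finset.single_le_sum (f := fun F => ∫ x in hull F, (D.jump M w F x -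
    ⨍ y in hull F, D.jump M w F y ∂μHE[d - 1]) ^ 2 ∂μHE[d - 1])
    (fun F _ => integral_nonneg fun x => by positivity) hF

/-- The constant in the estimate of a single facet term. -/
def facetConst (d : ℕ) (σ : ℝ) : ℝ := |σ| * √(ballVolume (d - 1) * |σ| ^ (d - 1))

/-- The constant of the oscillation estimate in dimension `d`. -/
def oscConst (d : ℕ) (σ : ℝ) : ℝ := |σ| + (d + 1) * facetConst d σ

lemma facetConst_nonneg (d : ℕ) (σ : ℝ) : 0 ≤ facetConst d σ := by
  unfold facetConst; positivity

lemma oscConst_nonneg (d : ℕ) (σ : ℝ) : 0 ≤ oscConst d σ := by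
  have := facetConst_nonneg d σ
  unfold oscConst; positivity

lemma Triangulation.ShapeRegular.diam_le {σ : ℝ} (hM : M.ShapeRegular σ) (hT : T ∈ M.elems) :
    Metric.diam (hull T) ≤ |σ| * meshSize T := by
  have h := (div_le_iff₀ (meshSize_pos (M.isSimplex hT))).1 (hM T hT)
  exact h.trans (mul_le_mul_of_nonneg_right (le_abs_self σ) (meshSize_pos (M.isSimplex hT)).le)

lemma ModelData.Admissible.element_estimate (hΩ : IsBoundedLipschitzDomain Ω)
    (hD : D.Admissible Ω M) {σ : ℝ} (hM : M.ShapeRegular σ)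
    (hT : T ∈ M.elems) {w v : E d → ℝ} (hw : M.MemS1 w) (hv : M.MemS1 v) {l : E d →ᵃ[ℝ] ℝ}
    (hl : EqOn v l (hull T)) :
    |∫ x in hull T, D.residual w T x * (v x - M.dualFun v x)| ≤
      |σ| * (‖affGrad l‖ * √(volume.real (hull T)) * √(D.oscLocalSq M w T)) := by
  have hT' := M.isSimplex hT
  have : IsFiniteMeasure (volume.restrict (hull T)) :=
    ⟨by rw [Measure.restrict_apply_univ]; exact (isCompact_hull T).measure_lt_top⟩
  have hwi : IntegrableOn (fun x => v x - M.dualFun v x) (hull T) := by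
    simpa using (M.integrableOn_mul_sub_dualFun (ψ := fun _ => 1) hT (isCompact_hull T)
      (ae_exists_isStrictMax hT') (integrable_const _) (hv.1.mono (M.hull_subset hT))).2.2.1
  have h := abs_integral_mul_le (hD.memLp_residual hΩ hT hw) hwi
    (B := ‖affGrad l‖ * Metric.diam (hull T)) (mul_nonneg (norm_nonneg _) Metric.diam_nonneg)
    ((ae_exists_isStrictMax hT').mono fun x hx => M.abs_sub_dualFun_le hT hl hx)
    (Triangulation.setIntegral_sub_dualFun hT hl) (⨍ y in hull T, D.residual w T y)
  rw [measureReal_restrict_apply_univ] at h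
  refine h.trans ?_
  set r := √(∫ x in hull T, (D.residual w T x - ⨍ y in hull T, D.residual w T y) ^ 2) with hr
  calc ‖affGrad l‖ * Metric.diam (hull T) * (√(volume.real (hull T)) * r)
      ≤ ‖affGrad l‖ * (|σ| * meshSize T) * (√(volume.real (hull T)) * r) := by
        have := hM.diam_le hT
        gcongr
    _ = |σ| * (‖affGrad l‖ * √(volume.real (hull T)) * (meshSize T * r)) := by ring
    _ ≤ _ := by
        have := D.sqrt_residual_le M w hT'
        gcongr

lemma ModelData.Admissible.facet_estimate (hd : 2 ≤ d) (hD : D.Admissible Ω M) {σ : ℝ}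
    (hM : M.ShapeRegular σ) (hT : T ∈ M.elems) {w v : E d → ℝ} (hw : M.MemS1 w) (hv : M.MemS1 v)
    {l : E d →ᵃ[ℝ] ℝ} (hl : EqOn v l (hull T)) {F : Finset (E d)} (hF : F ∈ M.intFacets T) :
    |∫ x in hull F, D.jump M w F x * (v x - M.dualFun v x) ∂μHE[d - 1]| ≤
      facetConst d σ * (‖affGrad l‖ * √(volume.real (hull T)) * √(D.oscLocalSq M w T)) := by
  have hd1 : 1 ≤ d := by omega
  have hT' := M.isSimplex hT
  have hFT := M.mem_powersetCard_of_mem_intFacets hF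
  have : IsFiniteMeasure ((μHE[d - 1]).restrict (hull F)) :=
    ⟨by rw [Measure.restrict_apply_univ]; exact hull_facet_finite hd1 hT' hFT⟩
  have hae := ae_facet_exists_isStrictMax' hd1 hT' hFT
  have hwi : IntegrableOn (fun x => v x - M.dualFun v x) (hull F) μHE[d - 1] := by
    simpa using (M.integrableOn_mul_sub_dualFun (ψ := fun _ => 1) hT (isCompact_hull F)
      hae (integrable_const _)
      (hv.1.mono ((hull_facet_subset hFT).trans (M.hull_subset hT)))).2.2.1
  have h := abs_integral_mul_le (hD.memLp_jump hd1 hT hw hFT) hwi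
    (B := ‖affGrad l‖ * Metric.diam (hull T)) (mul_nonneg (norm_nonneg _) Metric.diam_nonneg)
    (hae.mono fun x hx => M.abs_sub_dualFun_le hT hl hx)
    (Triangulation.setIntegral_facet_sub_dualFun hd1 hT hFT hl)
    (⨍ y in hull F, D.jump M w F y ∂μHE[d - 1])
  rw [measureReal_restrict_apply_univ] at h
  refine h.trans ?_
  set r := √(∫ x in hull F, (D.jump M w F x -
    ⨍ y in hull F, D.jump M w F y ∂μHE[d - 1]) ^ 2 ∂μHE[d - 1]) with hr
  have hh := meshSize_pos hT'
  have hdiam := hM.diam_le hT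
  have hball := ballVolume_nonneg (d - 1)
  have hFle : √((μHE[d - 1]).real (hull F)) ≤
      √(ballVolume (d - 1) * |σ| ^ (d - 1)) * √(meshSize T ^ (d - 1)) := by
    rw [← Real.sqrt_mul (by positivity), mul_assoc, ← mul_pow]
    refine Real.sqrt_le_sqrt ((measureReal_facet_le hd hT' hFT).trans ?_)
    have := Metric.diam_nonneg (s := hull T)
    gcongr
  -- the powers of the mesh-size combine to the one in the oscillations
  have hpow : meshSize T * √(meshSize T ^ (d - 1)) = √(volume.real (hull T)) * √(meshSize T) := by
    rw [← Real.sqrt_mul measureReal_nonneg, ← meshSize_pow hd1, ← pow_succ]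
    conv_lhs => rw [← Real.sqrt_sq hh.le, ← Real.sqrt_mul (by positivity), Real.sqrt_sq hh.le,
      ← pow_add]
    congr 2
    omega
  calc ‖affGrad l‖ * Metric.diam (hull T) * (√((μHE[d - 1]).real (hull F)) * r)
      ≤ ‖affGrad l‖ * (|σ| * meshSize T) *
          (√(ballVolume (d - 1) * |σ| ^ (d - 1)) * √(meshSize T ^ (d - 1)) * r) := by gcongr
    _ = facetConst d σ * (‖affGrad l‖ * (meshSize T * √(meshSize T ^ (d - 1))) * r) := by
        rw [facetConst]; ring
    _ = facetConst d σ * (‖affGrad l‖ * √(volume.real (hull T)) * (√(meshSize T) * r)) := by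
        rw [hpow]; ring
    _ ≤ _ := by
        have h1 := D.sqrt_jump_le M w hT' hF
        have h2 := facetConst_nonneg d σ
        gcongr

/-- The sum over all facets is bounded by the sum over the elements and their interior facets. -/
lemma Triangulation.sum_facets_le (M : Triangulation Ω)
    {φ : Finset (E d) → ℝ} (hφ : ∀ F, 0 ≤ φ F) (h0 : ∀ F ∈ M.facets, hull F ⊆ frontier Ω → φ F = 0) :
    ∑ F ∈ M.facets, φ F ≤ ∑ T ∈ M.elems, ∑ F ∈ M.intFacets T, φ F := by
  have e : ∀ T ∈ M.elems, ∑ F ∈ M.intFacets T, φ F = ∑ F ∈ T.powersetCard d, φ F := by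
    classical
    intro T hT
    refine Finset.sum_subset (fun F hF => M.mem_powersetCard_of_mem_intFacets hF)
      fun F hF hFi => ?_
    refine h0 F (Finset.mem_biUnion.2 ⟨T, hT, hF⟩) ?_
    by_contra h
    refine hFi ?_
    rw [Triangulation.intFacets, Finset.mem_filter]
    exact ⟨hF, h⟩
  rw [Finset.sum_congr rfl e, M.sum_elems_facets fun _ F => φ F]
  refine Finset.sum_le_sum fun F hF => ?_
  obtain ⟨T, hT, hFT⟩ := Finset.mem_biUnion.1 hF
  exact Finset.single_le_sum (f := fun _ => φ F) (fun _ _ => hφ F)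
    (Finset.mem_filter.2 ⟨hT, (Finset.mem_powersetCard.1 hFT).1⟩)

/-- The defect estimate in a fixed dimension. -/
theorem ModelData.Admissible.abs_bilin_error_le (hΩ : IsBoundedLipschitzDomain Ω)
    (hd : 2 ≤ d) (hD : D.Admissible Ω M) {σ : ℝ} (hM : M.ShapeRegular σ) {u w v : E d → ℝ}
    (hu : D.IsWeakSolution Ω u) (hw : D.IsFVMSolution M w) (hv : M.MemS10 v) :
    |D.bilin Ω (u - w) v| ≤ oscConst d σ * H1norm Ω v * D.osc M w := by
  classical
  have hd1 : 1 ≤ d := by omega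
  have hw1 := hw.1.1
  have hvs := hv.1.isPiecewiseSmooth
  choose! l hl using hv.1.2
  set e : Finset (E d) → ℝ := fun T => ‖affGrad (l T)‖ * √(volume.real (hull T)) with he
  set o : Finset (E d) → ℝ := fun T => √(D.oscLocalSq M w T) with ho
  have heo : ∀ T, 0 ≤ e T * o T := fun T => by positivity
  have h1 : |D.bilin Ω (u - w) v| ≤ ∑ T ∈ M.elems, oscConst d σ * (e T * o T) := by
    rw [hD.bilin_error_eq hΩ hd1 hu hw hv, Finset.sum_add_distrib,
      hD.sum_facets_eq_jump hΩ hd1 hw1 hv]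
    refine (abs_add_le _ _).trans ?_
    rw [abs_neg]
    have hfac := M.sum_facets_le (φ := fun F =>
      |∫ x in hull F, D.jump M w F x * (v x - M.dualFun v x) ∂μHE[d - 1]|)
      (fun F => abs_nonneg _) fun F hF hFΓ => by
        obtain ⟨T, hT, hFT⟩ := Finset.mem_biUnion.1 hF
        rw [integral_eq_zero_of_ae, abs_zero]
        filter_upwards [M.ae_sub_dualFun_eq_zero hd1 hT hFT hFΓ hv.2] with x hx
        rw [hx, mul_zero]; rfl
    refine (add_le_add (Finset.abs_sum_le_sum_abs _ _)
      ((Finset.abs_sum_le_sum_abs _ _).trans hfac)).trans ?_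
    rw [← Finset.sum_add_distrib]
    refine Finset.sum_le_sum fun T hT => ?_
    have hcard : ((M.intFacets T).card : ℝ) ≤ d + 1 := by
      have h2 := Finset.card_le_card fun F hF => M.mem_powersetCard_of_mem_intFacets (T := T) hF
      rw [Finset.card_powersetCard, (M.isSimplex hT).card_eq, Nat.choose_succ_self_right] at h2
      exact_mod_cast h2
    have h2 : ∑ F ∈ M.intFacets T,
        |∫ x in hull F, D.jump M w F x * (v x - M.dualFun v x) ∂μHE[d - 1]| ≤
        (d + 1) * (facetConst d σ * (e T * o T)) := by
      refine (Finset.sum_le_card_nsmul _ _ _ fun F hF =>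
        hD.facet_estimate hd hM hT hw1 hv.1 (hl T hT) hF).trans ?_
      rw [nsmul_eq_mul]
      exact mul_le_mul_of_nonneg_right hcard (mul_nonneg (facetConst_nonneg d σ) (heo T))
    refine (add_le_add (hD.element_estimate hΩ hM hT hw1 hv.1 (hl T hT)) h2).trans (le_of_eq ?_)
    simp only [oscConst, he, ho]
    ring
  have h2 : ∑ T ∈ M.elems, e T * o T ≤ H1norm Ω v * D.osc M w := by
    refine (Real.sum_mul_le_sqrt_mul_sqrt _ _ _).trans (mul_le_mul ?_ ?_ (by positivity)
      (Real.sqrt_nonneg _))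
    · refine Real.sqrt_le_sqrt ?_
      have hgr : IntegrableOn (fun x => ‖gradient v x‖ ^ 2) Ω :=
        (hvs.memLp_gradient hΩ 2).norm.integrable_sq
      have hsum : ∫ x in Ω, ‖weakGrad Ω v x‖ ^ 2 = ∑ T ∈ M.elems, e T ^ 2 := by
        have : ∫ x in Ω, ‖weakGrad Ω v x‖ ^ 2 = ∫ x in Ω, ‖gradient v x‖ ^ 2 := by
          refine integral_congr_ae ?_
          filter_upwards [(hvs.hasWeakGrad hΩ hd1).weakGrad_ae_eq hΩ.isOpen] with x hx
          rw [hx]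
        rw [this, M.setIntegral_eq_sum hΩ hgr]
        refine Finset.sum_congr rfl fun T hT => ?_
        rw [he]
        simp only
        rw [mul_pow, Real.sq_sqrt measureReal_nonneg, ← restrict_interior_hull,
          setIntegral_congr_fun isOpen_interior.measurableSet (g := fun _ => ‖affGrad (l T)‖ ^ 2)
            fun x hx => by rw [gradient_of_eqOn_affine (hl T hT) hx],
          restrict_interior_hull, setIntegral_const, smul_eq_mul, mul_comm]
      rw [← hsum]
      exact le_add_of_nonneg_left (integral_nonneg fun x => by positivity)
    · refine le_of_eq ?_
      rw [ModelData.osc]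
      congr 1
      exact Finset.sum_congr rfl fun T hT =>
        Real.sq_sqrt (D.oscLocalSq_nonneg M w (M.isSimplex hT))
  rw [mul_assoc]
  refine h1.trans ?_
  rw [← Finset.mul_sum]
  exact mul_le_mul_of_nonneg_left h2 (oscConst_nonneg d σ)

end Estimate

end FVM

end

theorem mainTheorem5 :
    ∀ σ : ℝ, ∃ Cosc : ℝ, 0 < Cosc ∧
      ∀ (d : ℕ) (_hd : d = 2 ∨ d = 3)
        (Ω : Set (FVM.E d)) (_hΩ : FVM.IsBoundedLipschitzDomain Ω)
        (M : FVM.Triangulation Ω) (_hM : M.ShapeRegular σ)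
        (D : FVM.ModelData d) (_hD : D.Admissible Ω M)
        (u : FVM.E d → ℝ) (_hu : D.IsWeakSolution Ω u)
        (uh : FVM.E d → ℝ) (_huh : D.IsFVMSolution M uh)
        (v : FVM.E d → ℝ) (_hv : M.MemS10 v),
        |D.bilin Ω (u - uh) v| ≤ Cosc * FVM.H1norm Ω v * D.osc M uh := by
  intro σ
  refine ⟨1 + FVM.oscConst 2 σ + FVM.oscConst 3 σ, ?_, ?_⟩
  · have h2 := FVM.oscConst_nonneg 2 σ
    have h3 := FVM.oscConst_nonneg 3 σ
    positivity
  intro d hd Ω hΩ M hM D hD u hu uh huh v hv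
  have hle : FVM.oscConst d σ ≤ 1 + FVM.oscConst 2 σ + FVM.oscConst 3 σ := by
    have h2 := FVM.oscConst_nonneg 2 σ
    have h3 := FVM.oscConst_nonneg 3 σ
    rcases hd with rfl | rfl <;> linarith
  have hd2 : 2 ≤ d := by rcases hd with rfl | rfl <;> norm_num
  refine (hD.abs_bilin_error_le hΩ hd2 hM hu huh hv).trans ?_
  have hH : 0 ≤ FVM.H1norm Ω v := Real.sqrt_nonneg _
  have hO : 0 ≤ D.osc M uh := Real.sqrt_nonneg _
  gcongr
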